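/- **Setting.** Let $\mathcal M=(\mathcal S,\mathcal A,H,\{p_h\}_{h\in[H]},s_1)$ be a finite episodic reward-free MDP with $|\mathcal S|=S$, $|\mathcal A|=A\ge 1$, $H\ge 1$, fixed initial state $s_1$, and, by convention, $p_H(\cdot\mid s,a)$ the point mass at $s_1$ (the transition after the last action is not part of a trajectory). A policy $\pi$ (possibly history dependent and randomised) induces a law $q^\pi$ on trajectories $m=(s_1,a_1,\dots,s_H,a_H)\in(\mathcal S\times\mathcal A)^H$; its trajectory entropy is $\mathrm{TE}(q^\pi)=\mathcal H(q^\pi)=\sum_m q^\pi(m)\log\frac1{q^\pi(m)}$, with $\mathcal H$ the Shannon entropy. An algorithm chooses from the $t$ episodes observed so far the policy $\pi^{t+1}$ of the next episode, and whether to stop; if it stops it returns a policy $\widehat\pi$. With $\tau$ the number of episodes at which it stops, it is $(\varepsilon,\delta)$-PAC for maximum trajectory entropy exploration (MTEE) if in every such MDP, with probability at least $1-\delta$, $\tau<\infty$ and $\max_\pi \mathrm{TE}(q^\pi)-\mathrm{TE}(q^{\widehat\pi})\le\varepsilon$. **UCBVI-Ent.** Let $n=n^t_h(s,a)$ and $n_h^t(s'\mid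 s,a)$ be the visit and transition counts after $t$ episodes, $\widehat p=\widehat p^{\,t}_h(\cdot\mid s,a)=n^t_h(\cdot\mid s,a)/n$ (uniform if $n=0$), $\mathrm{clip}(x,m,M)=\max(\min(x,M),m)$, and $$\beta^{\mathrm{KL}}(n)=\log\tfrac{4SAH}{\delta}+S\log(e(1+n)),\qquad \beta^{\mathrm{c}}(n)=\log\tfrac{4SAH}{\delta}+\log(4en(2n+1)),$$ $$\beta^{\mathcal H}(n)=\log^2(n)\Big(\log\tfrac{4SAH}{\delta}+\log(n(n+1))\Big).$$ Put $\overline V^t_{H+1}=\underline V^t_{H+1}=0$, $G^t_{H+1}=0$ and, for $h=H,\dots,1$ (all functions of $h,s,a$ evaluated at $(h,s,a)$), $$b^{\mathcal H}=\sqrt{2\beta^{\mathcal H}(n)/n}+\min\big(\beta^{\mathrm{KL}}(n)/n,\log S\big),$$ $$b^{B}=3\sqrt{\mathrm{Var}_{\widehat p}(\overline V^t_{h+1})\,\beta^{\mathrm c}(n)/n}+9H^2\log(SA)\,\beta^{\mathrm{KL}}(n)/n,\qquad b^p=b^B+\tfrac1H\widehat p\,(\overline V^t_{h+1}-\underline V^t_{h+1}),$$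 $$\overline Q^t_h=\mathrm{clip}\big(\mathcal H(\widehat p)+b^{\mathcal H}+\widehat p\,\overline V^t_{h+1}+b^p,\,0,\,H\log(SA)\big),\quad \underline Q^t_h=\mathrm{clip}\big(\mathcal H(\widehat p)-b^{\mathcal H}+\widehat p\,\underline V^t_{h+1}-b^p,\,0,\,H\log(SA)\big),$$ $$\overline V^t_h(s)=\max_{\pi\in\Delta_{\mathcal A}}\{\pi\overline Q^t_h(s)+\mathcal H(\pi)\},\quad \underline V^t_h(s)=\max_{\pi\in\Delta_{\mathcal A}}\{\pi\underline Q^t_h(s)+\mathcal H(\pi)\},\quad \pi^{t+1}_h(s)=\arg\max_{\pi\in\Delta_{\mathcal A}}\{\pi\overline Q^t_h(s)+\mathcal H(\pi)\},$$ $$G^t_h=\mathrm{clip}\Big(2b^B+2b^{\mathcal H}+\tfrac{4H^2\log(SA)\beta^{\mathrm{KL}}(n)}{n}+\big(1+\tfrac3H\big)\widehat p\,[\pi^{t+1}_{h+1}G^t_{h+1}],\,0,\,H\log(SA)\Big).$$ At pairs with $n=0$ the bonuses are $+\infty$, so there $\overline Q^t_h=G^t_h=H\log(SA)$ and $\underline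 Q^t_h=0$. UCBVI-Ent plays $\pi^{t+1}$ in episode $t+1$, stops at $\tau=\min\{t\ge 0:\ \pi^{t+1}_1G^t_1(s_1)\le\varepsilon\}$, and returns $\widehat\pi=\pi^{\tau+1}$. **Theorem.** For all $S,A,H\ge1$, $\varepsilon>0$ and $\delta\in(0,1)$, UCBVI-Ent is $(\varepsilon,\delta)$-PAC for MTEE. Moreover there is a universal constant $C>0$ such that for all $S,A,H\ge 1$, all $\varepsilon\in(0,1]$ and $\delta\in(0,1)$, in every such MDP, with probability at least $1-\delta$, $$\tau\le C\left(\frac{H^3SA\,\log^2(SA)\,\log(SAH/\delta)\,L^4}{\varepsilon^2}+\frac{H^3SA\,\log(SA)\,\big(\log(SAH/\delta)+SL\big)L}{\varepsilon}\right),$$ where $L=\log(SAH/\varepsilon)+\log\log(SAH/\delta)$. (This bound is of the form $\widetilde{\mathcal O}(H^3SA/\varepsilon^2+H^3S^2A/\varepsilon)$.) -/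

import Mathlib

universe u v w

namespace MTEE

noncomputable section

/-! ### Elementary notions -/

/-- Shannon entropy `∑ i, p i * log (1 / p i)` (natural logarithm, `0 log 0 = 0`). -/
def entropy {ι : Type*} [Fintype ι] (p : ι → ℝ) : ℝ := ∑ i, Real.negMulLog (p i)

/-- Expectation `p f` of `f` under the weights `p`. -/
def mean {ι : Type*} [Fintype ι] (p f : ι → ℝ) : ℝ := ∑ i, p i * f i

/-- Variance `Var_p(f) = p (f - p f)²`. -/
def variance {ι : Type*} [Fintype ι] (p f : ι → ℝ) : ℝ := ∑ i, p i * (f i - mean p f) ^ 2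

/-- `clip(x, m, M) = max (min x M) m`. -/
def clip (x m M : ℝ) : ℝ := max (min x M) m

/-- The value `max_{π ∈ Δ_A} (π Q + ℋ(π))`, in closed form (see `isGreatest_lse`). -/
def lse {A : Type*} [Fintype A] (Q : A → ℝ) : ℝ := Real.log (∑ a, Real.exp (Q a))

/-- The maximiser `argmax_{π ∈ Δ_A} (π Q + ℋ(π))`, in closed form
(see `gibbs_mem`, `gibbs_value` and `eq_gibbs_of_value`). -/
def gibbs {A : Type*} [Fintype A] (Q : A → ℝ) : A → ℝ := fun a => Real.exp (Q a - lse Q)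

theorem term_le (x g : ℝ) (hx : 0 ≤ x) :
    x * g + Real.negMulLog x ≤ Real.exp g - x ∧
      (x * g + Real.negMulLog x = Real.exp g - x → x = Real.exp g) := by
  rcases hx.eq_or_lt with rfl | hx
  · simp [(Real.exp_pos g).le]
  · have hy : 0 < Real.exp g / x := div_pos (Real.exp_pos _) hx
    have hlog : Real.log (Real.exp g / x) = g - Real.log x := by
      rw [Real.log_div (Real.exp_pos _).ne' hx.ne', Real.log_exp]
    have hl : x * g + Real.negMulLog x = x * Real.log (Real.exp g / x) := by
      rw [hlog, Real.negMulLog]; ring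
    have hr : Real.exp g - x = x * (Real.exp g / x - 1) := by
      field_simp
    rw [hl, hr]
    refine ⟨mul_le_mul_of_nonneg_left (Real.log_le_sub_one_of_pos hy) hx.le, fun h => ?_⟩
    by_contra hne
    have : Real.exp g / x ≠ 1 := fun h1 => hne (((div_eq_one_iff_eq hx.ne').1 h1).symm)
    exact (mul_lt_mul_of_pos_left (Real.log_lt_sub_one_of_pos hy this) hx).ne h

theorem value_eq {A : Type*} [Fintype A] (Q : A → ℝ) {p : A → ℝ} (hp : p ∈ stdSimplex ℝ A) :
    mean p Q + entropy p - lse Q = ∑ a, (p a * (Q a - lse Q) + Real.negMulLog (p a)) := by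
  simp only [mean, entropy, mul_sub, Finset.sum_add_distrib, Finset.sum_sub_distrib,
    ← Finset.sum_mul, hp.2]
  ring

section gibbs

variable {A : Type*} [Fintype A] [Nonempty A]

theorem gibbs_mem (Q : A → ℝ) : gibbs Q ∈ stdSimplex ℝ A := by
  have hpos : 0 < ∑ a, Real.exp (Q a) :=
    Finset.sum_pos (fun a _ => Real.exp_pos _) Finset.univ_nonempty
  refine ⟨fun a => (Real.exp_pos _).le, ?_⟩
  simp only [gibbs, lse, Real.exp_sub, Real.exp_log hpos]
  rw [← Finset.sum_div, div_self hpos.ne']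

theorem gibbs_value (Q : A → ℝ) : mean (gibbs Q) Q + entropy (gibbs Q) = lse Q := by
  have h : ∀ a, gibbs Q a * Q a + Real.negMulLog (gibbs Q a) = gibbs Q a * lse Q := by
    intro a
    simp only [gibbs, Real.negMulLog, Real.log_exp]
    ring
  rw [mean, entropy, ← Finset.sum_add_distrib, Finset.sum_congr rfl (fun a _ => h a),
    ← Finset.sum_mul, (gibbs_mem Q).2, one_mul]

theorem sum_gibbs_sub (Q : A → ℝ) {p : A → ℝ} (hp : p ∈ stdSimplex ℝ A) :
    ∑ a, (Real.exp (Q a - lse Q) - p a) = 0 := by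
  have := (gibbs_mem Q).2
  simp only [gibbs] at this
  rw [Finset.sum_sub_distrib, this, hp.2, sub_self]

/-- `lse Q` is the maximum over the simplex of `π Q + ℋ(π)`. -/
theorem isGreatest_lse (Q : A → ℝ) :
    IsGreatest ((fun p => mean p Q + entropy p) '' stdSimplex ℝ A) (lse Q) := by
  refine ⟨⟨gibbs Q, gibbs_mem Q, gibbs_value Q⟩, ?_⟩
  rintro _ ⟨p, hp, rfl⟩
  have h1 := Finset.sum_le_sum (s := Finset.univ)
    (fun a _ => (term_le (p a) (Q a - lse Q) (hp.1 a)).1)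
  rw [← value_eq Q hp, sum_gibbs_sub Q hp] at h1
  simpa using h1

/-- `gibbs Q` is the only maximiser. -/
theorem eq_gibbs_of_value (Q : A → ℝ) {p : A → ℝ} (hp : p ∈ stdSimplex ℝ A)
    (h : mean p Q + entropy p = lse Q) : p = gibbs Q := by
  have h1 := (Finset.sum_eq_sum_iff_of_le (s := Finset.univ)
    (fun a _ => (term_le (p a) (Q a - lse Q) (hp.1 a)).1)).1
    (by rw [← value_eq Q hp, sum_gibbs_sub Q hp, h, sub_self])
  funext a
  exact (term_le (p a) (Q a - lse Q) (hp.1 a)).2 (h1 a (Finset.mem_univ a))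

end gibbs

/-! ### Reward-free episodic MDPs, policies, trajectory entropy

Steps are numbered `0, …, H - 1` instead of `1, …, H`. -/

/-- A finite episodic reward-free MDP with initial state `s₁`: `p h s a s'` is the probability of
moving from `s` to `s'` by playing `a` at step `h`.  By convention the transition after the last
action is the deterministic return to `s₁`: it is not part of a trajectory
`(s_1, a_1, …, s_H, a_H)`. -/
structure MDP (S : Type u) (A : Type v) [Fintype S] [DecidableEq S] (H : ℕ) (s₁ : S) where
  p : Fin H → S → A → S → ℝ
  p_mem : ∀ h s a, p h s a ∈ stdSimplex ℝ S
  p_last : ∀ h : Fin H, h.val + 1 = H → ∀ s a, p h s a = Pi.single s₁ 1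

/-- A general randomised, history-dependent policy: `act h past s a` is the probability of playing
`a` at step `h` in state `s` when `past` are the state-action pairs of the steps before `h`. -/
structure Policy (S : Type u) (A : Type v) [Fintype A] (H : ℕ) where
  act : (h : Fin H) → (Fin h.val → S × A) → S → A → ℝ
  act_mem : ∀ h past s, act h past s ∈ stdSimplex ℝ A

variable {S : Type u} {A : Type v} [Fintype S] [DecidableEq S] [Fintype A] [DecidableEq A]
  {H : ℕ} {s₁ : S}

/-- The Markovian policy that plays `a` in state `s` at step `h` with probability `f h s a`. -/
def Policy.markov (f : Fin H → S → A → ℝ) (hf : ∀ h s, f h s ∈ stdSimplex ℝ A) :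
    Policy S A H where
  act h _ s := f h s
  act_mem h _ s := hf h s

/-- The part of a trajectory before step `h`. -/
def past (m : Fin H → S × A) (h : Fin H) : Fin h.val → S × A :=
  fun i => m ⟨i.val, i.isLt.trans h.isLt⟩

/-- The probability `q^π(m)` of the trajectory `m = (s_1, a_1, …, s_H, a_H)`. -/
def MDP.trajProb (M : MDP S A H s₁) (π : Policy S A H) (m : Fin H → S × A) : ℝ :=
  (if ∀ h : Fin H, h.val = 0 → (m h).1 = s₁ then 1 else 0) *
    ∏ h : Fin H, (π.act h (past m h) (m h).1 (m h).2 *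
      (if hh : h.val + 1 < H then M.p h (m h).1 (m h).2 (m ⟨h.val + 1, hh⟩).1 else 1))

/-- The trajectory entropy `TE(q^π) = ℋ(q^π)`. -/
def MDP.TE (M : MDP S A H s₁) (π : Policy S A H) : ℝ := entropy (M.trajProb π)

/-! ### Interaction and PAC algorithms -/

/-- What is observed in an episode: the states `s_1, …, s_{H+1}` and the actions `a_1, …, a_H`. -/
abbrev Episode (S : Type u) (A : Type v) (H : ℕ) : Type (max u v) :=
  (Fin (H + 1) → S) × (Fin H → A)

/-- The state-action pairs of an episode. -/
def Episode.pairs (e : Episode S A H) : Fin H → S × A := fun h => (e.1 h.castSucc, e.2 h)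

/-- The probability of observing the episode `e` when playing `π`. -/
def MDP.episodeProb (M : MDP S A H s₁) (π : Policy S A H) (e : Episode S A H) : ℝ :=
  (if e.1 0 = s₁ then 1 else 0) *
    ∏ h : Fin H, (π.act h (past (Episode.pairs e) h) (e.1 h.castSucc) (e.2 h) *
      M.p h (e.1 h.castSucc) (e.2 h) (e.1 h.succ))

/-- An algorithm: from the `t` episodes observed so far it computes the policy `π^{t+1}` of the
next episode, whether it stops now, and the policy `π̂` that it returns if it does. -/
structure Algorithm (S : Type u) (A : Type v) [Fintype A] (H : ℕ) where
  policy : (t : ℕ) → (Fin t → Episode S A H) → Policy S A H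
  halts : (t : ℕ) → (Fin t → Episode S A H) → Prop
  output : (t : ℕ) → (Fin t → Episode S A H) → Policy S A H

/-- The first `t` episodes of a sequence. -/
def firstEpisodes (D : ℕ → Episode S A H) (t : ℕ) : Fin t → Episode S A H := fun i => D i.val

/-- `τ` is the first number of observed episodes at which the algorithm stops. -/
def Algorithm.StopsAt (alg : Algorithm S A H) (D : ℕ → Episode S A H) (τ : ℕ) : Prop :=
  IsLeast {t : ℕ | alg.halts t (firstEpisodes D t)} τ

/-- The random episodes `X 0, X 1, …` on `(Ω, μ)` are generated by letting the sampling rule of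
`alg` interact with `M`: given the first `t` episodes, the next one is drawn by playing the
policy computed from them. -/
structure IsInteraction {Ω : Type w} [MeasurableSpace Ω] (M : MDP S A H s₁)
    (alg : Algorithm S A H) (μ : MeasureTheory.Measure Ω) (X : ℕ → Ω → Episode S A H) : Prop where
  measurable : ∀ t e, MeasurableSet {ω | X t ω = e}
  law : ∀ (t : ℕ) (D : ℕ → Episode S A H),
    μ {ω | ∀ i < t, X i ω = D i} =
      ENNReal.ofReal (∏ i ∈ Finset.range t,
        M.episodeProb (alg.policy i (firstEpisodes D i)) (D i))

/-- `alg` is `(ε, δ)`-PAC for maximum trajectory entropy exploration: in every MDP, with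
probability at least `1 - δ`, it stops and returns a policy whose trajectory entropy is within `ε`
of that of every policy. -/
def IsPAC (alg : Algorithm S A H) (s₁ : S) (ε δ : ℝ) : Prop :=
  ∀ (M : MDP S A H s₁) (Ω : Type w) [MeasurableSpace Ω] (μ : MeasureTheory.Measure Ω)
    (X : ℕ → Ω → Episode S A H), IsInteraction M alg μ X →
    ENNReal.ofReal (1 - δ) ≤
      μ {ω | ∃ τ : ℕ, alg.StopsAt (fun t => X t ω) τ ∧
        ∀ π : Policy S A H,
          M.TE π - M.TE (alg.output τ (firstEpisodes (fun t => X t ω) τ)) ≤ ε}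

/-! ### The algorithm UCBVI-Ent -/

/-- `β^KL(δ, n)` for `S` states, `A` actions and horizon `H`. -/
def betaKL (S A H : ℕ) (δ : ℝ) (n : ℕ) : ℝ :=
  Real.log (4 * S * A * H / δ) + S * Real.log (Real.exp 1 * (1 + n))

/-- `β^conc(δ, n)`. -/
def betaConc (S A H : ℕ) (δ : ℝ) (n : ℕ) : ℝ :=
  Real.log (4 * S * A * H / δ) + Real.log (4 * Real.exp 1 * n * (2 * n + 1))

/-- `β^ℋ(δ, n)`. -/
def betaEnt (S A H : ℕ) (δ : ℝ) (n : ℕ) : ℝ :=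
  Real.log n ^ 2 * (Real.log (4 * S * A * H / δ) + Real.log (n * (n + 1)))

section planning

variable {t : ℕ} (D : Fin t → Episode S A H) (δ : ℝ)

/-- Number of visits `n_h^t(s, a)`. -/
def count (h : Fin H) (s : S) (a : A) : ℕ :=
  (Finset.univ.filter fun i : Fin t => (D i).1 h.castSucc = s ∧ (D i).2 h = a).card

/-- Number of transitions `n_h^t(s' | s, a)`. -/
def countNext (h : Fin H) (s : S) (a : A) (s' : S) : ℕ :=
  (Finset.univ.filter fun i : Fin t =>
    (D i).1 h.castSucc = s ∧ (D i).2 h = a ∧ (D i).1 h.succ = s').card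

/-- Empirical transition probabilities (uniform for a pair that was never visited). -/
def pHat (h : Fin H) (s : S) (a : A) (s' : S) : ℝ :=
  if count D h s a = 0 then 1 / (Fintype.card S : ℝ)
  else (countNext D h s a s' : ℝ) / count D h s a

/-- `H · R_max` with `R_max = log(SA)`. -/
def maxVal (S : Type u) (A : Type v) [Fintype S] [Fintype A] (H : ℕ) : ℝ :=
  H * Real.log (Fintype.card S * Fintype.card A)

/-- `β^KL(δ, n) / n` at `n = n_h^t(s, a)`. -/
def rateKL (h : Fin H) (s : S) (a : A) : ℝ :=
  betaKL (Fintype.card S) (Fintype.card A) H δ (count D h s a) / count D h s a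

/-- `β^conc(δ, n) / n` at `n = n_h^t(s, a)`. -/
def rateConc (h : Fin H) (s : S) (a : A) : ℝ :=
  betaConc (Fintype.card S) (Fintype.card A) H δ (count D h s a) / count D h s a

/-- Entropy bonus `b^{ℋ,t}_h(s, a)`. -/
def bonusEnt (h : Fin H) (s : S) (a : A) : ℝ :=
  Real.sqrt (2 * betaEnt (Fintype.card S) (Fintype.card A) H δ (count D h s a) /
      count D h s a) +
    min (rateKL D δ h s a) (Real.log (Fintype.card S))

/-- Bernstein bonus `b^{B,t}_h(s, a)`, where `Vu` is the upper bound for step `h + 1`. -/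
def bonusB (h : Fin H) (Vu : S → ℝ) (s : S) (a : A) : ℝ :=
  3 * Real.sqrt (variance (pHat D h s a) Vu * rateConc D δ h s a) +
    9 * (H : ℝ) ^ 2 * Real.log (Fintype.card S * Fintype.card A) * rateKL D δ h s a

/-- Transition bonus `b^{p,t}_h(s, a) = b^{B,t}_h(s, a) + b^{corr,t}_h(s, a)`, where `Vu`, `Vl` are
the upper and lower bounds for step `h + 1`. -/
def bonusP (h : Fin H) (Vu Vl : S → ℝ) (s : S) (a : A) : ℝ :=
  bonusB D δ h Vu s a + 1 / (H : ℝ) * mean (pHat D h s a) (fun s' => Vu s' - Vl s')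

/-- Upper bound on `Q_h^⋆`, from the bounds for step `h + 1`.  Bonuses of unvisited pairs are
infinite, hence clipped. -/
def stepUp (h : Fin H) (Vu Vl : S → ℝ) (s : S) (a : A) : ℝ :=
  if count D h s a = 0 then maxVal S A H
  else clip (entropy (pHat D h s a) + bonusEnt D δ h s a + mean (pHat D h s a) Vu +
    bonusP D δ h Vu Vl s a) 0 (maxVal S A H)

/-- Lower bound on `Q_h^⋆`, from the bounds for step `h + 1`. -/
def stepLow (h : Fin H) (Vu Vl : S → ℝ) (s : S) (a : A) : ℝ :=
  if count D h s a = 0 then 0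
  else clip (entropy (pHat D h s a) + mean (pHat D h s a) Vl -
    bonusP D δ h Vu Vl s a - bonusEnt D δ h s a) 0 (maxVal S A H)

/-- The pair of the upper and the lower bound on `V_h^⋆`, by backward recursion from `0`. -/
def bounds (h : ℕ) : (S → ℝ) × (S → ℝ) :=
  if hh : h < H then
    (fun s => lse (stepUp D δ ⟨h, hh⟩ (bounds (h + 1)).1 (bounds (h + 1)).2 s),
      fun s => lse (stepLow D δ ⟨h, hh⟩ (bounds (h + 1)).1 (bounds (h + 1)).2 s))
  else (fun _ => 0, fun _ => 0)
termination_by H - h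

/-- The upper bound on `Q_h^⋆` after `t` episodes. -/
def upQ (h : Fin H) : S → A → ℝ :=
  stepUp D δ h (bounds D δ (h.val + 1)).1 (bounds D δ (h.val + 1)).2

/-- The optimistic policy `π_h^{t+1}(s)`. -/
def optimistic (h : Fin H) (s : S) : A → ℝ := gibbs (upQ D δ h s)

/-- The gap `G_h^t(s, a)`, where `g` is `π_{h+1}^{t+1} G_{h+1}^t`.  Bonuses of unvisited pairs are
infinite, hence clipped. -/
def stepGap (h : Fin H) (g : S → ℝ) (s : S) (a : A) : ℝ :=
  if count D h s a = 0 then maxVal S A H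
  else clip (2 * bonusB D δ h (bounds D δ (h.val + 1)).1 s a + 2 * bonusEnt D δ h s a +
    4 * (H : ℝ) ^ 2 * Real.log (Fintype.card S * Fintype.card A) * rateKL D δ h s a +
    (1 + 3 / (H : ℝ)) * mean (pHat D h s a) g) 0 (maxVal S A H)

/-- `π_h^{t+1} G_h^t`, by backward recursion from `0`. -/
def gap (h : ℕ) : S → ℝ :=
  if hh : h < H then
    fun s => mean (optimistic D δ ⟨h, hh⟩ s) (stepGap D δ ⟨h, hh⟩ (gap (h + 1)) s)
  else fun _ => 0
termination_by H - h

end planning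

/-- The policy `π^{t+1}` computed by optimistic planning. -/
def optimisticPolicy [Nonempty A] (δ : ℝ) (t : ℕ) (D : Fin t → Episode S A H) : Policy S A H :=
  Policy.markov (optimistic D δ) fun _ _ => gibbs_mem _

/-- UCBVI-Ent with precision `ε` and confidence `δ`: it plays `π^{t+1}`, stops at the first `t` with
`π_1^{t+1} G_1^t(s₁) ≤ ε`, and returns `π^{τ+1}`. -/
def ucbviEnt (S : Type u) (A : Type v) [Fintype S] [DecidableEq S] [Fintype A] [DecidableEq A]
    [Nonempty A] (H : ℕ) (s₁ : S) (ε δ : ℝ) : Algorithm S A H where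
  policy t D := optimisticPolicy δ t D
  halts _ D := gap D δ 0 s₁ ≤ ε
  output t D := optimisticPolicy δ t D

/-- The quantity `L = log(SAH/ε) + log log(SAH/δ)`. -/
def logFactor (S A H : ℕ) (ε δ : ℝ) : ℝ :=
  Real.log (S * A * H / ε) + Real.log (Real.log (S * A * H / δ))

/-- The sample complexity `H³SA log²(SA) log(SAH/δ) L⁴ / ε²
+ H³SA log(SA) (log(SAH/δ) + S L) L / ε`. -/
def complexity (S A H : ℕ) (ε δ : ℝ) : ℝ :=
  (H : ℝ) ^ 3 * S * A * Real.log (S * A) ^ 2 * Real.log (S * A * H / δ) *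
      logFactor S A H ε δ ^ 4 / ε ^ 2 +
    (H : ℝ) ^ 3 * S * A * Real.log (S * A) *
      (Real.log (S * A * H / δ) + S * logFactor S A H ε δ) * logFactor S A H ε δ / ε

end

end MTEE

set_option linter.unusedSectionVars false

namespace MTEE

noncomputable section

/-! ### Means, variances, entropies and changes of measure on a finite set -/

section weights

variable {ι : Type*} [Fintype ι] {p q f g : ι → ℝ}

/-! Reduction to planning. By the chain rule for Shannon entropy, the entropy of a trajectory is the
expected sum of the entropies of the transition laws and of the action laws met along it. Trajectory
entropy is therefore the value of an MDP whose reward at (h, s, a) is the entropy of `M.p h s a`,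
regularised by the entropy of the policy. Its Bellman equation has `lse` in place of a maximum, and
history-dependent policies gain nothing (`MDP.TE_le_optV`, `MDP.TE_markov`). UCBVI-Ent is optimistic
value iteration for this problem.

Concentration. Each way in which an estimate can fail is encoded as a nonnegative supermartingale
that is at least 1 when the failure occurs. Their sum `totalFailure` starts below δ, so by Ville's
inequality (`IsInteraction.ville`) it stays below 1 with probability at least 1 - δ, and then
`IsGood` holds at all times: the squared Hellinger distance between the empirical and true
transitions is at most β^KL / n, the fixed function `M.optV` satisfies a Bernstein bound, the
empirical entropies lie within their bonus, and the visit counts are not far below their predictable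
sums `cumOcc`.

Correctness. On this event backward induction gives `lowV` ≤ `optV` ≤ `upV` (`IsGood.optV_mem`), and
the computable `gap` dominates `upV` minus the value of the optimistic policy
(`IsGood.upV_sub_polV_le_gap`). A gap of at most ε thus certifies ε-optimality. Hellinger distance
serves to change measure at a multiplicative cost 1 + 1/H, which compounds to a constant over H
steps.

Sample complexity. Moved to the true transitions and to the value of the policy played, the gap is
at most exp 8 times the expected sum of the pair costs (`IsGood.gap_le`). Summing over T unstopped
episodes, Cauchy-Schwarz combines the law of total variance (`MDP.sum_occ_variance_le`), which saves
a factor H, with a logarithmic bound on the sums of reciprocal visits. This gives ε T ≤ a √T + b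
with a and b polylogarithmic in T (`mul_le_of_forall_isGood`). Solving first for √T and then for log
(1 + T) yields the bound. -/

theorem mean_mono (hp : p ∈ stdSimplex ℝ ι) (h : ∀ i, f i ≤ g i) : mean p f ≤ mean p g :=
  Finset.sum_le_sum fun i _ => mul_le_mul_of_nonneg_left (h i) (hp.1 i)

theorem mean_const (hp : p ∈ stdSimplex ℝ ι) (c : ℝ) : mean p (fun _ => c) = c := by
  simp [mean, ← Finset.sum_mul, hp.2]

theorem mean_nonneg (hp : p ∈ stdSimplex ℝ ι) (h : ∀ i, 0 ≤ f i) : 0 ≤ mean p f :=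
  Finset.sum_nonneg fun i _ => mul_nonneg (hp.1 i) (h i)

theorem mean_le (hp : p ∈ stdSimplex ℝ ι) {c : ℝ} (h : ∀ i, f i ≤ c) : mean p f ≤ c :=
  (mean_mono hp h).trans_eq (mean_const hp c)

theorem le_mean (hp : p ∈ stdSimplex ℝ ι) {c : ℝ} (h : ∀ i, c ≤ f i) : c ≤ mean p f :=
  (mean_const hp c).symm.trans_le (mean_mono hp h)

theorem mean_add (p f g : ι → ℝ) : mean p (fun i => f i + g i) = mean p f + mean p g := by
  simp [mean, mul_add, Finset.sum_add_distrib]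

theorem mean_sub (p f g : ι → ℝ) : mean p (fun i => f i - g i) = mean p f - mean p g := by
  simp [mean, mul_sub, Finset.sum_sub_distrib]

theorem mean_mul_left (p f : ι → ℝ) (c : ℝ) : mean p (fun i => c * f i) = c * mean p f := by
  simp only [mean, Finset.mul_sum]
  exact Finset.sum_congr rfl fun i _ => by ring

theorem variance_nonneg (hp : p ∈ stdSimplex ℝ ι) (f : ι → ℝ) : 0 ≤ variance p f :=
  Finset.sum_nonneg fun i _ => mul_nonneg (hp.1 i) (sq_nonneg _)

theorem mean_sq_sub (hp : p ∈ stdSimplex ℝ ι) (f : ι → ℝ) (c : ℝ) :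
    mean p (fun i => (f i - c) ^ 2) = variance p f + (mean p f - c) ^ 2 := by
  have h : ∀ i, p i * (f i - c) ^ 2 = p i * (f i - mean p f) ^ 2 +
      2 * (mean p f - c) * (p i * f i) + ((c ^ 2 - mean p f ^ 2)) * p i := fun i => by ring
  rw [mean, Finset.sum_congr rfl fun i _ => h i, Finset.sum_add_distrib, Finset.sum_add_distrib,
    ← Finset.mul_sum, ← Finset.mul_sum, hp.2]
  change variance p f + 2 * (mean p f - c) * mean p f + _ = _
  ring

theorem variance_le_mean_sq_sub (hp : p ∈ stdSimplex ℝ ι) (f : ι → ℝ) (c : ℝ) :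
    variance p f ≤ mean p (fun i => (f i - c) ^ 2) := by
  rw [mean_sq_sub hp]
  exact le_add_of_nonneg_right (sq_nonneg _)

theorem mean_sq (hp : p ∈ stdSimplex ℝ ι) (f : ι → ℝ) :
    mean p (fun i => f i ^ 2) = variance p f + mean p f ^ 2 := by
  simpa using mean_sq_sub hp f 0

theorem sq_mean_le (hp : p ∈ stdSimplex ℝ ι) (f : ι → ℝ) :
    mean p f ^ 2 ≤ mean p (fun i => f i ^ 2) := by
  rw [mean_sq hp]
  exact le_add_of_nonneg_left (variance_nonneg hp f)

/-- Centring f at the mean of g only increases the second moment; then (x + y)² ≤ 2x² + 2y². -/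
theorem variance_le_add (hp : p ∈ stdSimplex ℝ ι) (f g : ι → ℝ) :
    variance p f ≤ 2 * variance p g + 2 * mean p (fun i => (f i - g i) ^ 2) := by
  refine (variance_le_mean_sq_sub hp f (mean p g)).trans ?_
  rw [variance, ← mean, ← mean_mul_left, ← mean_mul_left, ← mean_add]
  exact mean_mono hp fun i => by nlinarith [sq_nonneg ((f i - g i) - (g i - mean p g))]

/-- Squared Hellinger distance (without the factor `1 / 2`). -/
def hel (p q : ι → ℝ) : ℝ := ∑ i, (√(p i) - √(q i)) ^ 2

theorem hel_comm (p q : ι → ℝ) : hel p q = hel q p :=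
  Finset.sum_congr rfl fun i _ => by ring

/-- Young's inequality in the square roots; the slack is the perfect square displayed in the proof,
divided by η. -/
theorem le_add_sqrt_sub_sq {x y η : ℝ} (hx : 0 ≤ x) (hy : 0 ≤ y) (hη : 0 < η) :
    y ≤ (1 + η) * x + (1 + 1 / η) * (√x - √y) ^ 2 := by
  obtain ⟨a, ha, rfl⟩ : ∃ a, 0 ≤ a ∧ x = a ^ 2 := ⟨√x, Real.sqrt_nonneg _, (Real.sq_sqrt hx).symm⟩
  obtain ⟨b, hb, rfl⟩ : ∃ b, 0 ≤ b ∧ y = b ^ 2 := ⟨√y, Real.sqrt_nonneg _, (Real.sq_sqrt hy).symm⟩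
  rw [Real.sqrt_sq ha, Real.sqrt_sq hb]
  have h : (1 + η) * a ^ 2 + (1 + 1 / η) * (a - b) ^ 2 - b ^ 2 = (η * a + (a - b)) ^ 2 / η := by
    field_simp
    ring
  have : 0 ≤ (η * a + (a - b)) ^ 2 / η := by positivity
  linarith

/-- Change of measure for nonnegative functions: a relative loss η is traded for an additive error
of order c · hel / η. With η = 1 / H the relative losses over H steps multiply to a constant. -/
theorem mean_le_hel (hp : p ∈ stdSimplex ℝ ι) (hq : q ∈ stdSimplex ℝ ι) {c η : ℝ} (hη : 0 < η)
    (h0 : ∀ i, 0 ≤ f i) (hc : ∀ i, f i ≤ c) :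
    mean q f ≤ (1 + η) * mean p f + (1 + 1 / η) * (c * hel p q) := by
  simp only [mean, hel, Finset.mul_sum]
  rw [← Finset.sum_add_distrib]
  refine Finset.sum_le_sum fun i _ => ?_
  have h1 := mul_le_mul_of_nonneg_right (le_add_sqrt_sub_sq (hp.1 i) (hq.1 i) hη) (h0 i)
  have h2 : (1 + 1 / η) * ((√(p i) - √(q i)) ^ 2 * f i) ≤
      (1 + 1 / η) * ((√(p i) - √(q i)) ^ 2 * c) := by
    have := hc i
    gcongr
  linarith

/-- `mean_le_hel` with η = 1, applied to the squared deviation from the mean under p, which is no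
worse a centre for q than its own mean up to the inequality sign. -/
theorem variance_le_hel (hp : p ∈ stdSimplex ℝ ι) (hq : q ∈ stdSimplex ℝ ι) {b : ℝ}
    (h0 : ∀ i, 0 ≤ f i) (hb : ∀ i, f i ≤ b) :
    variance q f ≤ 2 * variance p f + 2 * (b ^ 2 * hel p q) := by
  refine (variance_le_mean_sq_sub hq f (mean p f)).trans ?_
  have h := mean_le_hel (f := fun i => (f i - mean p f) ^ 2) (c := b ^ 2) hp hq one_pos
    (fun i => sq_nonneg _) fun i => by
      have h1 := mean_nonneg hp h0
      have h2 := mean_le hp hb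
      have h3 := h0 i
      have h4 := hb i
      exact sq_le_sq' (by linarith) (by linarith)
  have e : variance p f = mean p (fun i => (f i - mean p f) ^ 2) := rfl
  rw [e]
  norm_num at h
  linarith

theorem entropy_nonneg (hp : p ∈ stdSimplex ℝ ι) : 0 ≤ entropy p :=
  Finset.sum_nonneg fun i _ => Real.negMulLog_nonneg (hp.1 i)
    (hp.2 ▸ Finset.single_le_sum (fun j _ => hp.1 j) (Finset.mem_univ i))

theorem lse_zero : lse (fun _ : ι => (0 : ℝ)) = Real.log (Fintype.card ι) := by
  simp [lse]

theorem mean_zero (p : ι → ℝ) : mean p (fun _ => 0) = 0 := by simp [mean]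

theorem mean_add_entropy_le_lse [Nonempty ι] (hp : p ∈ stdSimplex ℝ ι) (Q : ι → ℝ) :
    mean p Q + entropy p ≤ lse Q :=
  (isGreatest_lse Q).2 ⟨p, hp, rfl⟩

theorem entropy_le_log_card [Nonempty ι] (hp : p ∈ stdSimplex ℝ ι) :
    entropy p ≤ Real.log (Fintype.card ι) := by
  have := mean_add_entropy_le_lse hp (fun _ => 0)
  rwa [mean_zero, zero_add, lse_zero] at this

theorem lse_mono [Nonempty ι] {P Q : ι → ℝ} (h : ∀ i, P i ≤ Q i) : lse P ≤ lse Q :=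
  Real.log_le_log (Finset.sum_pos (fun _ _ => Real.exp_pos _) Finset.univ_nonempty)
    (Finset.sum_le_sum fun i _ => Real.exp_le_exp.2 (h i))

theorem lse_le [Nonempty ι] {Q : ι → ℝ} {c : ℝ} (h : ∀ i, Q i ≤ c) :
    lse Q ≤ c + Real.log (Fintype.card ι) := by
  rw [← gibbs_value Q]
  exact add_le_add (mean_le (gibbs_mem Q) h) (entropy_le_log_card (gibbs_mem Q))

theorem log_card_le_lse [Nonempty ι] {Q : ι → ℝ} (h : ∀ i, 0 ≤ Q i) :
    Real.log (Fintype.card ι) ≤ lse Q := by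
  rw [← lse_zero]
  exact lse_mono h

theorem log_card_nonneg (ι : Type*) [Fintype ι] : 0 ≤ Real.log (Fintype.card ι) :=
  Real.log_natCast_nonneg _

theorem entropy_single [DecidableEq ι] (i : ι) : entropy (Pi.single i (1 : ℝ)) = 0 :=
  Finset.sum_eq_zero fun j _ => by
    by_cases h : j = i
    · subst h; simp
    · simp [h]

/-- Chain rule for the Shannon entropy. -/
theorem entropy_chain {κ : Type*} [Fintype κ] (p : ι → ℝ) (q : ι → κ → ℝ)
    (hq : ∀ i, q i ∈ stdSimplex ℝ κ) :
    entropy (fun x : ι × κ => p x.1 * q x.1 x.2) = entropy p + mean p (fun i => entropy (q i)) := by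
  simp only [entropy, mean, Fintype.sum_prod_type, Real.negMulLog_mul, Finset.sum_add_distrib,
    ← Finset.mul_sum, ← Finset.sum_mul, (hq _).2, one_mul]

theorem clip_le (x : ℝ) {m M : ℝ} (h : m ≤ M) : clip x m M ≤ M := max_le (min_le_right _ _) h

theorem le_clip (x m M : ℝ) : m ≤ clip x m M := le_max_right _ _

end weights

section

variable {S : Type u} {A : Type v} [Fintype S] [DecidableEq S] [Fintype A] [DecidableEq A]
  {H : ℕ} {s₁ : S}

/-! ### Value functions -/

/-- The action values at step `h`, given the state values `V` of step `h + 1`. -/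
def MDP.backup (M : MDP S A H s₁) (h : Fin H) (V : S → ℝ) (s : S) (a : A) : ℝ :=
  entropy (M.p h s a) + mean (M.p h s a) V

/-- The optimal value function of the entropy-regularised problem. -/
def MDP.optV (M : MDP S A H s₁) (h : ℕ) : S → ℝ :=
  if hh : h < H then fun s => lse (M.backup ⟨h, hh⟩ (MDP.optV M (h + 1)) s) else fun _ => 0
termination_by H - h

/-- The value function of the Markovian policy `f` in the entropy-regularised problem. -/
def MDP.polV (M : MDP S A H s₁) (f : Fin H → S → A → ℝ) (h : ℕ) : S → ℝ :=
  if hh : h < H then fun s => mean (f ⟨h, hh⟩ s) (M.backup ⟨h, hh⟩ (MDP.polV M f (h + 1)) s) +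
    entropy (f ⟨h, hh⟩ s) else fun _ => 0
termination_by H - h

theorem MDP.optV_of_lt (M : MDP S A H s₁) (h : Fin H) (s : S) :
    M.optV h s = lse (M.backup h (M.optV (h.val + 1)) s) := by
  rw [MDP.optV, dif_pos h.isLt]

theorem MDP.optV_last (M : MDP S A H s₁) (s : S) : M.optV H s = 0 := by
  rw [MDP.optV, dif_neg (lt_irrefl _)]

theorem MDP.polV_of_lt (M : MDP S A H s₁) (f : Fin H → S → A → ℝ) (h : Fin H) (s : S) :
    M.polV f h s = mean (f h s) (M.backup h (M.polV f (h.val + 1)) s) + entropy (f h s) := by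
  rw [MDP.polV, dif_pos h.isLt]

theorem MDP.polV_last (M : MDP S A H s₁) (f : Fin H → S → A → ℝ) (s : S) : M.polV f H s = 0 := by
  rw [MDP.polV, dif_neg (lt_irrefl _)]

/-! ### The trajectory entropy through value functions -/

/-- The law of the state of step `k` given the state-action pairs before it. -/
def MDP.nextState (M : MDP S A H s₁) : (k : ℕ) → (Fin k → S × A) → S → ℝ
  | 0, _ => Pi.single s₁ 1
  -- After the last action this is the return to s₁; beyond the horizon the value is a filler that
  -- no later argument meets.
  | k + 1, m => if hh : k < H then M.p ⟨k, hh⟩ (m (Fin.last k)).1 (m (Fin.last k)).2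
      else Pi.single s₁ 1

theorem MDP.nextState_mem (M : MDP S A H s₁) (k : ℕ) (m : Fin k → S × A) :
    M.nextState k m ∈ stdSimplex ℝ S := by
  cases k with
  | zero => exact single_mem_stdSimplex ℝ s₁
  | succ k =>
    rw [MDP.nextState]
    split_ifs
    · exact M.p_mem _ _ _
    · exact single_mem_stdSimplex ℝ s₁

/-- The law of the state-action pairs before step `k`. -/
def MDP.prefixProb (M : MDP S A H s₁) (π : Policy S A H) : (k : ℕ) → k ≤ H → (Fin k → S × A) → ℝ
  | 0, _, _ => 1
  | k + 1, hk, m => MDP.prefixProb M π k (Nat.le_of_succ_le hk) (Fin.init m) *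
      (M.nextState k (Fin.init m) (m (Fin.last k)).1 *
        π.act ⟨k, hk⟩ (Fin.init m) (m (Fin.last k)).1 (m (Fin.last k)).2)

theorem MDP.prefixProb_eq_prod (M : MDP S A H s₁) (π : Policy S A H) (k : ℕ) (hk : k ≤ H)
    (m : Fin k → S × A) :
    M.prefixProb π k hk m = ∏ i : Fin k, (M.nextState i (fun j => m ⟨j, j.2.trans i.2⟩) (m i).1 *
      π.act ⟨i, i.2.trans_le hk⟩ (fun j => m ⟨j, j.2.trans i.2⟩) (m i).1 (m i).2) := by
  induction k with
  | zero => simp [MDP.prefixProb]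
  | succ k ih =>
    rw [MDP.prefixProb, ih, Fin.prod_univ_castSucc]
    rfl

/-- The two products group factors differently: `trajProb` pairs each action with the transition out
of its state, `prefixProb` with the transition into it. The shift by one matches the initial
indicator with `nextState 0` and the missing last transition with the factor 1. -/
theorem MDP.trajProb_eq_prefixProb (M : MDP S A H s₁) (π : Policy S A H) :
    M.trajProb π = M.prefixProb π H le_rfl := by
  funext m
  rw [MDP.prefixProb_eq_prod, MDP.trajProb, Finset.prod_mul_distrib, Finset.prod_mul_distrib,
    mul_left_comm, mul_comm]
  congr 1
  cases H with
  | zero => simp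
  | succ n =>
    rw [Fin.prod_univ_castSucc, Fin.prod_univ_succ]
    congr 1
    · simp only [Fin.val_zero, MDP.nextState, Pi.single_apply]
      congr 1
      apply propext
      constructor
      · intro h; exact h 0 rfl
      · intro h i hi
        rwa [show i = 0 from Fin.ext hi]
    · simp only [Fin.val_last, lt_irrefl, dite_false, mul_one]
      refine Finset.prod_congr rfl fun i _ => ?_
      simp only [Fin.val_castSucc, Fin.val_succ, MDP.nextState]
      rw [dif_pos (by simp), dif_pos (i.2.trans (Nat.lt_succ_self n))]
      rfl

theorem entropy_comp_equiv {ι κ : Type*} [Fintype ι] [Fintype κ] (e : ι ≃ κ) (p : κ → ℝ) :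
    entropy (fun i => p (e i)) = entropy p :=
  e.sum_comp fun i => Real.negMulLog (p i)

theorem mean_comp_equiv {ι κ : Type*} [Fintype ι] [Fintype κ] (e : ι ≃ κ) (p f : κ → ℝ) :
    mean (fun i => p (e i)) (fun i => f (e i)) = mean p f :=
  e.sum_comp fun i => p i * f i

theorem mul_mem_stdSimplex {ι κ : Type*} [Fintype ι] [Fintype κ] {p : ι → ℝ} {q : ι → κ → ℝ}
    (hp : p ∈ stdSimplex ℝ ι) (hq : ∀ i, q i ∈ stdSimplex ℝ κ) :
    (fun x : ι × κ => p x.1 * q x.1 x.2) ∈ stdSimplex ℝ (ι × κ) := by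
  refine ⟨fun x => mul_nonneg (hp.1 _) ((hq _).1 _), ?_⟩
  simp [Fintype.sum_prod_type, ← Finset.mul_sum, (hq _).2, hp.2]

theorem mean_chain {ι κ : Type*} [Fintype ι] [Fintype κ] (p : ι → ℝ) (q : ι → κ → ℝ)
    (f : ι → κ → ℝ) :
    mean (fun x : ι × κ => p x.1 * q x.1 x.2) (fun x => f x.1 x.2) =
      mean p (fun i => mean (q i) (f i)) := by
  simp [mean, Fintype.sum_prod_type, Finset.mul_sum, mul_assoc]

/-- Appending the last element. -/
def snocPair (S : Type u) (A : Type v) (k : ℕ) :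
    (Fin k → S × A) × (S × A) ≃ (Fin (k + 1) → S × A) :=
  (Equiv.prodComm _ _).trans (Fin.snocEquiv fun _ => S × A)

theorem snocPair_apply (k : ℕ) (x : (Fin k → S × A) × (S × A)) :
    snocPair S A k x = Fin.snoc x.1 x.2 := rfl

theorem MDP.prefixProb_snoc (M : MDP S A H s₁) (π : Policy S A H) (k : ℕ) (hk : k + 1 ≤ H)
    (x : (Fin k → S × A) × (S × A)) :
    M.prefixProb π (k + 1) hk (snocPair S A k x) =
      M.prefixProb π k (Nat.le_of_succ_le hk) x.1 *
        (M.nextState k x.1 x.2.1 * π.act ⟨k, hk⟩ x.1 x.2.1 x.2.2) := by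
  rw [snocPair_apply, MDP.prefixProb, Fin.init_snoc, Fin.snoc_last]

theorem MDP.prefixProb_mem (M : MDP S A H s₁) (π : Policy S A H) (k : ℕ) (hk : k ≤ H) :
    M.prefixProb π k hk ∈ stdSimplex ℝ (Fin k → S × A) := by
  induction k with
  | zero => exact ⟨fun _ => by simp [MDP.prefixProb], by simp [MDP.prefixProb]⟩
  | succ k ih =>
    have h := mul_mem_stdSimplex (ih (Nat.le_of_succ_le hk)) fun m =>
      mul_mem_stdSimplex (M.nextState_mem k m) fun s => π.act_mem ⟨k, hk⟩ m s
    refine ⟨fun m => ?_, ?_⟩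
    · obtain ⟨x, rfl⟩ := (snocPair S A k).surjective m
      rw [M.prefixProb_snoc]
      exact h.1 x
    · rw [← (snocPair S A k).sum_comp]
      simp only [M.prefixProb_snoc]
      exact h.2

/-- The entropy of the first `k` state-action pairs plus the value of the rest. -/
def MDP.potential (M : MDP S A H s₁) (π : Policy S A H) (V : ℕ → S → ℝ) (k : ℕ) (hk : k ≤ H) : ℝ :=
  entropy (M.prefixProb π k hk) + mean (M.prefixProb π k hk) fun m =>
    entropy (M.nextState k m) + mean (M.nextState k m) (V k)

theorem MDP.potential_zero (M : MDP S A H s₁) (π : Policy S A H) (V : ℕ → S → ℝ) :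
    M.potential π V 0 (Nat.zero_le _) = V 0 s₁ := by
  have h1 : entropy (M.prefixProb π 0 (Nat.zero_le _)) = 0 := by
    simp [entropy, MDP.prefixProb]
  rw [MDP.potential, h1]
  simp only [MDP.nextState, entropy_single]
  simp [MDP.prefixProb, mean, Pi.single_apply]

/-- The return to s₁ after the last action is a point mass, so it adds no entropy and only the
trajectory itself remains. -/
theorem MDP.potential_last (M : MDP S A H s₁) (π : Policy S A H) (V : ℕ → S → ℝ)
    (hV : ∀ s, V H s = 0) (hH : 1 ≤ H) : M.potential π V H le_rfl = M.TE π := by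
  rw [MDP.potential, MDP.TE, MDP.trajProb_eq_prefixProb]
  obtain ⟨n, rfl⟩ : ∃ n, H = n + 1 := ⟨H - 1, by omega⟩
  have : ∀ m, entropy (M.nextState (n + 1) m) + mean (M.nextState (n + 1) m) (V (n + 1)) = 0 := by
    intro m
    rw [MDP.nextState, dif_pos (Nat.lt_succ_self n), M.p_last ⟨n, _⟩ rfl, entropy_single]
    simp [mean, hV]
  simp only [this, mean_zero, add_zero]

/-- Two uses of the chain rule, splitting the last pair from the prefix and then the action from the
state. The result is the potential at k with `V k` replaced by a one-step Bellman expression, so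
potentials of consecutive steps can be compared pointwise. -/
theorem MDP.potential_succ (M : MDP S A H s₁) (π : Policy S A H) (V : ℕ → S → ℝ) (k : ℕ)
    (hk : k + 1 ≤ H) :
    M.potential π V (k + 1) hk =
      entropy (M.prefixProb π k (Nat.le_of_succ_le hk)) +
        mean (M.prefixProb π k (Nat.le_of_succ_le hk)) fun m =>
          entropy (M.nextState k m) + mean (M.nextState k m) fun s =>
            mean (π.act ⟨k, hk⟩ m s) (M.backup ⟨k, hk⟩ (V (k + 1)) s) +
              entropy (π.act ⟨k, hk⟩ m s) := by
  rw [MDP.potential, ← entropy_comp_equiv (snocPair S A k), ← mean_comp_equiv (snocPair S A k)]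
  simp only [M.prefixProb_snoc]
  have h1 := entropy_chain (M.prefixProb π k (Nat.le_of_succ_le hk))
    (fun m => fun x : S × A => M.nextState k m x.1 * π.act ⟨k, hk⟩ m x.1 x.2)
    (fun m => mul_mem_stdSimplex (M.nextState_mem k m) fun s => π.act_mem ⟨k, hk⟩ m s)
  have h2 := fun m => entropy_chain (M.nextState k m) (π.act ⟨k, hk⟩ m) (π.act_mem ⟨k, hk⟩ m)
  rw [h1]
  have h3 := mean_chain (M.prefixProb π k (Nat.le_of_succ_le hk))
    (fun m => fun x : S × A => M.nextState k m x.1 * π.act ⟨k, hk⟩ m x.1 x.2)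
    (fun _ x => M.backup ⟨k, hk⟩ (V (k + 1)) x.1 x.2)
  have h4 : ∀ x : (Fin k → S × A) × (S × A),
      entropy (M.nextState (k + 1) (snocPair S A k x)) +
        mean (M.nextState (k + 1) (snocPair S A k x)) (V (k + 1)) =
      M.backup ⟨k, hk⟩ (V (k + 1)) x.2.1 x.2.2 := by
    intro x
    rw [snocPair_apply, MDP.nextState, dif_pos (Nat.lt_of_succ_le hk), Fin.snoc_last]
    rfl
  simp only [h4, h2, h3, add_assoc]
  rw [← mean_add]
  congr 2
  funext m
  rw [mean_chain (M.nextState k m) (π.act ⟨k, hk⟩ m)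
    (fun s a => M.backup ⟨k, hk⟩ (V (k + 1)) s a), add_assoc, ← mean_add]
  congr 2
  funext s
  ring

/-- With `V = optV` the potential cannot increase with k, because no action law beats `lse`. The
comparison is made for each prefix separately, so dependence on history does not matter. -/
theorem MDP.TE_le_optV [Nonempty A] (M : MDP S A H s₁) (hH : 1 ≤ H) (π : Policy S A H) :
    M.TE π ≤ M.optV 0 s₁ := by
  rw [← M.potential_last π M.optV M.optV_last hH, ← M.potential_zero π M.optV]
  have h : ∀ k (hk : k ≤ H), M.potential π M.optV k hk ≤
      M.potential π M.optV 0 (Nat.zero_le _) := by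
    intro k
    induction k with
    | zero => intro _; exact le_rfl
    | succ k ih =>
      intro hk
      refine le_trans ?_ (ih (Nat.le_of_succ_le hk))
      rw [MDP.potential_succ, MDP.potential]
      gcongr
      refine mean_mono (M.prefixProb_mem π k _) fun m => ?_
      gcongr
      refine mean_mono (M.nextState_mem k m) fun s => ?_
      rw [M.optV_of_lt ⟨k, hk⟩]
      exact mean_add_entropy_le_lse (π.act_mem _ _ _) _
  exact h H le_rfl

/-- With `V = polV` the Bellman expression reproduces the value exactly, so the potential is
constant in k. -/
theorem MDP.TE_markov (M : MDP S A H s₁) (hH : 1 ≤ H) (f : Fin H → S → A → ℝ)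
    (hf : ∀ h s, f h s ∈ stdSimplex ℝ A) : M.TE (Policy.markov f hf) = M.polV f 0 s₁ := by
  rw [← M.potential_last (Policy.markov f hf) (M.polV f) (M.polV_last f) hH,
    ← M.potential_zero (Policy.markov f hf) (M.polV f)]
  have h : ∀ k (hk : k ≤ H), M.potential (Policy.markov f hf) (M.polV f) k hk =
      M.potential (Policy.markov f hf) (M.polV f) 0 (Nat.zero_le _) := by
    intro k
    induction k with
    | zero => intro _; rfl
    | succ k ih =>
      intro hk
      rw [← ih (Nat.le_of_succ_le hk), MDP.potential_succ, MDP.potential]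
      congr 2
      funext m
      congr 2
      funext s
      rw [M.polV_of_lt f ⟨k, hk⟩]
      rfl
  exact h H le_rfl

end

section

variable {S : Type u} {A : Type v} [Fintype S] [DecidableEq S] [Fintype A] [DecidableEq A]
  {H : ℕ} {s₁ : S}

/-! ### Expectations over episodes of Markovian policies -/

/-- Sum of `F` over the paths from `s`, weighted by the products of the kernels `k`. -/
def pathSum (k : Fin H → S → A → S → ℝ) (s : S) (F : Episode S A H → ℝ) : ℝ :=
  ∑ e : Episode S A H, ((if e.1 0 = s then 1 else 0) *
    ∏ h : Fin H, k h (e.1 h.castSucc) (e.2 h) (e.1 h.succ)) * F e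

/-- Markov property at the first step: the remainder is a path sum for the shifted kernels, started
at the next state. -/
theorem pathSum_succ (k : Fin (H + 1) → S → A → S → ℝ) (s : S) (F : Episode S A (H + 1) → ℝ) :
    pathSum k s F = ∑ a, ∑ s', k 0 s a s' *
      pathSum (fun h => k h.succ) s' (fun e => F (Fin.cons s e.1, Fin.cons a e.2)) := by
  have hS : ∀ φ : (Fin (H + 2) → S) → ℝ, ∑ x, φ x = ∑ x : Fin (H + 1) → S, ∑ s, φ (Fin.cons s x) :=
    fun φ => by
      rw [← (Fin.consEquiv fun _ => S).sum_comp, Fintype.sum_prod_type_right]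
      rfl
  have hA : ∀ φ : (Fin (H + 1) → A) → ℝ, ∑ x, φ x = ∑ a, ∑ x : Fin H → A, φ (Fin.cons a x) :=
    fun φ => by
      rw [← (Fin.consEquiv fun _ => A).sum_comp, Fintype.sum_prod_type]
      rfl
  have hL : pathSum k s F = ∑ x : Fin (H + 1) → S, ∑ a, ∑ y : Fin H → A,
      (k 0 s a (x 0) * ∏ h : Fin H, k h.succ (x h.castSucc) (y h) (x h.succ)) *
        F (Fin.cons s x, Fin.cons a y) := by
    rw [pathSum, Fintype.sum_prod_type, hS]
    refine Finset.sum_congr rfl fun x _ => ?_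
    rw [Finset.sum_eq_single s]
    · rw [hA]
      refine Finset.sum_congr rfl fun a _ => Finset.sum_congr rfl fun y _ => ?_
      rw [Fin.prod_univ_succ]
      simp [Fin.cons_succ]
    · intro b _ hb
      refine Finset.sum_eq_zero fun y _ => ?_
      simp [hb]
    · simp
  rw [hL]
  simp only [pathSum, Fintype.sum_prod_type, Finset.mul_sum]
  rw [Finset.sum_comm]
  refine Finset.sum_congr rfl fun a _ => ?_
  rw [Finset.sum_comm (s := Finset.univ (α := S))]
  refine Finset.sum_congr rfl fun x _ => ?_
  rw [Finset.sum_comm]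
  refine Finset.sum_congr rfl fun y _ => ?_
  rw [Finset.sum_eq_single (x 0)]
  · simp only [if_true]
    ring
  · intro b _ hb
    rw [if_neg (Ne.symm hb)]
    ring
  · simp

theorem pathSum_one (k : Fin H → S → A → S → ℝ) (hk : ∀ h s, ∑ a, ∑ s', k h s a s' = 1) (s : S) :
    pathSum k s (fun _ => 1) = 1 := by
  induction H generalizing s with
  | zero =>
    rw [pathSum, Fintype.sum_prod_type, ← (Equiv.funUnique (Fin 1) S).symm.sum_comp]
    simp
  | succ n ih =>
    rw [pathSum_succ]
    simp only [ih (fun h => k h.succ) (fun h => hk h.succ), mul_one, hk]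

/-- In a path, the step at `h` is drawn from the kernel at `h`. -/
theorem pathSum_step (k : Fin H → S → A → S → ℝ) (hk : ∀ h s, ∑ a, ∑ s', k h s a s' = 1)
    (φ : S → A → S → ℝ) (h : Fin H) (s : S) :
    pathSum k s (fun e => φ (e.1 h.castSucc) (e.2 h) (e.1 h.succ)) =
      pathSum k s (fun e => ∑ a, ∑ s', k h (e.1 h.castSucc) a s' * φ (e.1 h.castSucc) a s') := by
  have hc : ∀ (n : ℕ) (k' : Fin n → S → A → S → ℝ) (s' : S) (c : ℝ)
      (_ : ∀ h s, ∑ a, ∑ s', k' h s a s' = 1), pathSum k' s' (fun _ => c) = c := by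
    intro n k' s' c hk'
    have := pathSum_one k' hk' s'
    rw [pathSum] at this ⊢
    rw [← Finset.sum_mul]
    simp only [mul_one] at this
    rw [this, one_mul]
  induction H generalizing s with
  | zero => exact h.elim0
  | succ n ih =>
    rw [pathSum_succ, pathSum_succ]
    refine Fin.cases ?_ (fun h => ?_) h
    · simp only [Fin.castSucc_zero, Fin.cons_zero, Fin.cons_succ]
      simp only [hc n (fun h => k h.succ) _ _ (fun h => hk h.succ)]
      simp only [← Finset.sum_mul, hk, one_mul]
      refine Finset.sum_congr rfl fun a _ => Finset.sum_congr rfl fun s' _ => ?_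
      congr 1
      -- Paths of the tail carry weight only if they start at s', so the constant may be evaluated
      -- at their first state.
      rw [← hc n (fun h => k h.succ) s' (φ s a s') (fun h => hk h.succ)]
      refine Finset.sum_congr rfl fun e _ => ?_
      by_cases h0 : e.1 0 = s'
      · simp only [h0]
      · simp [h0]
    · simp only [← Fin.succ_castSucc, Fin.cons_succ]
      refine Finset.sum_congr rfl fun a _ => Finset.sum_congr rfl fun s' _ => ?_
      rw [ih (fun h => k h.succ) (fun h => hk h.succ) h s']

/-- Expectation over the episodes of a policy. -/
def MDP.expect (M : MDP S A H s₁) (π : Policy S A H) (F : Episode S A H → ℝ) : ℝ :=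
  mean (M.episodeProb π) F

section markov

variable (M : MDP S A H s₁) (f : Fin H → S → A → ℝ) (hf : ∀ h s, f h s ∈ stdSimplex ℝ A)

theorem MDP.expect_markov (F : Episode S A H → ℝ) :
    M.expect (Policy.markov f hf) F = pathSum (fun h s a s' => f h s a * M.p h s a s') s₁ F :=
  rfl

theorem MDP.kernel_sum (hf : ∀ h s, f h s ∈ stdSimplex ℝ A) (h : Fin H) (s : S) : ∑ a, ∑ s', f h s a * M.p h s a s' = 1 := by
  simp [← Finset.mul_sum, (M.p_mem h s _).2, (hf h s).2]

theorem MDP.episodeProb_markov_mem :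
    M.episodeProb (Policy.markov f hf) ∈ stdSimplex ℝ (Episode S A H) := by
  refine ⟨fun e => ?_, ?_⟩
  · refine mul_nonneg (by split_ifs <;> simp) (Finset.prod_nonneg fun h _ => ?_)
    exact mul_nonneg ((hf _ _).1 _) ((M.p_mem _ _ _).1 _)
  · have := pathSum_one (fun h s a s' => f h s a * M.p h s a s') (M.kernel_sum f hf) s₁
    rw [← M.expect_markov f hf] at this
    simpa [MDP.expect, mean] using this

theorem MDP.expect_action (φ : S → A → ℝ) (h : Fin H) :
    M.expect (Policy.markov f hf) (fun e => φ (e.1 h.castSucc) (e.2 h)) =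
      M.expect (Policy.markov f hf) (fun e => mean (f h (e.1 h.castSucc)) (φ (e.1 h.castSucc))) := by
  rw [M.expect_markov, M.expect_markov, pathSum_step _ (M.kernel_sum f hf) (fun s a _ => φ s a)]
  congr 1
  funext e
  simp [mean, ← Finset.sum_mul, ← Finset.mul_sum, (M.p_mem h _ _).2]

theorem MDP.expect_next (φ : S → A → S → ℝ) (h : Fin H) :
    M.expect (Policy.markov f hf) (fun e => φ (e.1 h.castSucc) (e.2 h) (e.1 h.succ)) =
      M.expect (Policy.markov f hf) (fun e =>
        mean (M.p h (e.1 h.castSucc) (e.2 h)) (φ (e.1 h.castSucc) (e.2 h))) := by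
  rw [M.expect_action f hf (fun s a => mean (M.p h s a) (φ s a)), M.expect_markov,
    M.expect_markov, pathSum_step _ (M.kernel_sum f hf) φ]
  simp [mean, Finset.mul_sum, mul_assoc]

theorem MDP.expect_start (φ : S → ℝ) :
    M.expect (Policy.markov f hf) (fun e => φ (e.1 0)) = φ s₁ := by
  rw [← mean_const (M.episodeProb_markov_mem f hf) (φ s₁)]
  refine Finset.sum_congr rfl fun e _ => ?_
  by_cases h0 : e.1 0 = s₁
  · simp only [h0]
  · simp [MDP.episodeProb, h0]

/-- Probability of visiting `(s, a)` at step `h`. -/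
def MDP.occ (M : MDP S A H s₁) (π : Policy S A H) (h : Fin H) (s : S) (a : A) : ℝ :=
  M.expect π fun e => if e.1 h.castSucc = s ∧ e.2 h = a then 1 else 0

theorem MDP.occ_nonneg (h : Fin H) (s : S) (a : A) : 0 ≤ M.occ (Policy.markov f hf) h s a :=
  mean_nonneg (M.episodeProb_markov_mem f hf) fun e => by split_ifs <;> simp

theorem MDP.occ_le_one (h : Fin H) (s : S) (a : A) : M.occ (Policy.markov f hf) h s a ≤ 1 :=
  mean_le (M.episodeProb_markov_mem f hf) fun e => by split_ifs <;> simp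

theorem MDP.expect_eq_sum_occ (π : Policy S A H) (φ : S → A → ℝ) (h : Fin H) :
    M.expect π (fun e => φ (e.1 h.castSucc) (e.2 h)) = ∑ s, ∑ a, M.occ π h s a * φ s a := by
  simp only [MDP.occ, MDP.expect, mean, Finset.sum_mul]
  rw [← Fintype.sum_prod_type', Finset.sum_comm]
  refine Finset.sum_congr rfl fun e _ => ?_
  rw [Fintype.sum_prod_type, Finset.sum_eq_single (e.1 h.castSucc),
    Finset.sum_eq_single (e.2 h)]
  · simp
  · intro b _ hb
    simp [Ne.symm hb]
  · simp
  · intro b _ hb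
    simp [Ne.symm hb]
  · simp

theorem MDP.sum_occ (h : Fin H) : ∑ s, ∑ a, M.occ (Policy.markov f hf) h s a = 1 := by
  have := M.expect_eq_sum_occ (Policy.markov f hf) (fun _ _ => 1) h
  rw [MDP.expect, mean_const (M.episodeProb_markov_mem f hf)] at this
  simpa using this.symm

/-- A quantity that changes only on a visit of (s, a) at step h sees one draw from `M.p h s a` with
probability `occ` and nothing otherwise. All supermartingales along the episodes are obtained from
this. -/
theorem MDP.expect_visit_next (g : S → ℝ) (x : ℝ) (h : Fin H) (s : S) (a : A) :
    M.expect (Policy.markov f hf)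
      (fun e => if e.1 h.castSucc = s ∧ e.2 h = a then g (e.1 h.succ) else x) =
      M.occ (Policy.markov f hf) h s a * mean (M.p h s a) g +
        (1 - M.occ (Policy.markov f hf) h s a) * x := by
  rw [M.expect_next f hf (fun s' a' s'' => if s' = s ∧ a' = a then g s'' else x)]
  have h1 : ∀ e : Episode S A H, mean (M.p h (e.1 h.castSucc) (e.2 h))
      (fun s'' => if e.1 h.castSucc = s ∧ e.2 h = a then g s'' else x) =
      (mean (M.p h s a) g - x) * (if e.1 h.castSucc = s ∧ e.2 h = a then 1 else 0) + x := by
    intro e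
    split_ifs with hc
    · rw [hc.1, hc.2]; ring
    · rw [mean_const (M.p_mem _ _ _)]; ring
  simp only [h1]
  rw [MDP.expect, mean_add, mean_mul_left, mean_const (M.episodeProb_markov_mem f hf),
    ← MDP.expect, ← MDP.occ]
  ring

end markov

end

section

variable {S : Type u} {A : Type v} [Fintype S] [DecidableEq S] [Fintype A] [DecidableEq A]
  {H : ℕ} {s₁ : S}

/-! ### A maximal inequality for the interaction -/

theorem MDP.episodeProb_nonneg (M : MDP S A H s₁) (π : Policy S A H) (e : Episode S A H) :
    0 ≤ M.episodeProb π e :=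
  mul_nonneg (by split_ifs <;> simp) (Finset.prod_nonneg fun _ _ =>
    mul_nonneg ((π.act_mem _ _ _).1 _) ((M.p_mem _ _ _).1 _))

/-- The probability of observing the episodes `D`. -/
def histProb (M : MDP S A H s₁) (alg : Algorithm S A H) (t : ℕ) (D : Fin t → Episode S A H) : ℝ :=
  ∏ i : Fin t, M.episodeProb (alg.policy i fun j => D ⟨j, j.2.trans i.2⟩) (D i)

theorem histProb_nonneg (M : MDP S A H s₁) (alg : Algorithm S A H) (t : ℕ)
    (D : Fin t → Episode S A H) : 0 ≤ histProb M alg t D :=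
  Finset.prod_nonneg fun _ _ => M.episodeProb_nonneg _ _

theorem histProb_snoc (M : MDP S A H s₁) (alg : Algorithm S A H) (t : ℕ)
    (D : Fin t → Episode S A H) (e : Episode S A H) :
    histProb M alg (t + 1) (Fin.snoc D e) =
      histProb M alg t D * M.episodeProb (alg.policy t D) e := by
  have h : ∀ (i : Fin t), (Fin.snoc D e : Fin (t + 1) → Episode S A H) i.castSucc = D i :=
    fun i => Fin.snoc_castSucc (α := fun _ => Episode S A H) e D i
  rw [histProb, Fin.prod_univ_castSucc]
  congr 1
  · refine Finset.prod_congr rfl fun i _ => ?_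
    rw [h]
    congr 2
    funext j
    exact h ⟨j, j.2.trans i.2⟩
  · rw [Fin.snoc_last]
    congr 2
    funext j
    exact h j

theorem sum_hist_succ {E : Type*} [Fintype E] (t : ℕ) (φ : (Fin (t + 1) → E) → ℝ) :
    ∑ D, φ D = ∑ D : Fin t → E, ∑ e, φ (Fin.snoc D e) := by
  rw [← (Fin.snocEquiv fun _ => E).sum_comp, Fintype.sum_prod_type_right]
  rfl

section interaction

variable {Ω : Type w} [MeasurableSpace Ω] {M : MDP S A H s₁} {alg : Algorithm S A H}
  {μ : MeasureTheory.Measure Ω} {X : ℕ → Ω → Episode S A H}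

theorem IsInteraction.measurableSet_hist (hI : IsInteraction M alg μ X) (t : ℕ)
    (D : Fin t → Episode S A H) :
    MeasurableSet {ω | firstEpisodes (fun i => X i ω) t = D} := by
  have : {ω | firstEpisodes (fun i => X i ω) t = D} = ⋂ i : Fin t, {ω | X i ω = D i} := by
    ext ω
    simp [firstEpisodes, funext_iff]
  rw [this]
  exact MeasurableSet.iInter fun i => hI.measurable _ _

theorem IsInteraction.measurableSet_hist_mem (hI : IsInteraction M alg μ X) (t : ℕ)
    (B : Set (Fin t → Episode S A H)) :
    MeasurableSet {ω | firstEpisodes (fun i => X i ω) t ∈ B} := by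
  have : {ω | firstEpisodes (fun i => X i ω) t ∈ B} =
      ⋃ D ∈ B, {ω | firstEpisodes (fun i => X i ω) t = D} := by
    ext ω
    simp
  rw [this]
  exact MeasurableSet.biUnion B.to_countable fun D _ => hI.measurableSet_hist t D

theorem IsInteraction.measure_hist [Nonempty A] (hI : IsInteraction M alg μ X) (t : ℕ)
    (D : Fin t → Episode S A H) :
    μ {ω | firstEpisodes (fun i => X i ω) t = D} = ENNReal.ofReal (histProb M alg t D) := by
  -- The interaction law is stated for infinite sequences; what follows the first t episodes is an
  -- arbitrary filler.
  have e₀ : Episode S A H := (fun _ => s₁, fun _ => Classical.arbitrary A)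
  let D' : ℕ → Episode S A H := fun i => if h : i < t then D ⟨i, h⟩ else e₀
  have hD : ∀ i : Fin t, D' i = D i := fun i => dif_pos i.2
  have hset : {ω | firstEpisodes (fun i => X i ω) t = D} = {ω | ∀ i < t, X i ω = D' i} := by
    ext ω
    simp only [firstEpisodes, funext_iff, Set.mem_ofPred_eq]
    exact ⟨fun h i hi => (h ⟨i, hi⟩).trans (hD ⟨i, hi⟩).symm, fun h i => (h i i.2).trans (hD i)⟩
  rw [hset, hI.law t D', Finset.prod_range, histProb]
  congr 1
  refine Finset.prod_congr rfl fun i _ => ?_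
  rw [hD]
  congr 2
  funext j
  exact hD ⟨j, j.2.trans i.2⟩

theorem IsInteraction.measure_hist_mem [Nonempty A] (hI : IsInteraction M alg μ X) (t : ℕ)
    (B : Set (Fin t → Episode S A H)) [DecidablePred (· ∈ B)] :
    μ {ω | firstEpisodes (fun i => X i ω) t ∈ B} =
      ENNReal.ofReal (∑ D, histProb M alg t D * if D ∈ B then 1 else 0) := by
  have : {ω | firstEpisodes (fun i => X i ω) t ∈ B} =
      ⋃ D ∈ Finset.univ.filter (· ∈ B), {ω | firstEpisodes (fun i => X i ω) t = D} := by
    ext ω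
    simp
  rw [this, MeasureTheory.measure_biUnion_finset
    (fun D _ D' _ h => Set.disjoint_left.2 fun ω h1 h2 => h (h1.symm.trans h2))
    (fun D _ => hI.measurableSet_hist t D)]
  simp only [hI.measure_hist, mul_ite, mul_one, mul_zero]
  rw [← Finset.sum_filter, ENNReal.ofReal_sum_of_nonneg fun D _ => histProb_nonneg _ _ _ _]

/-- `F` has reached `1` at or before time `t`. -/
def reached (F : (t : ℕ) → (Fin t → Episode S A H) → ℝ) :
    (t : ℕ) → (Fin t → Episode S A H) → Prop
  | 0, D => 1 ≤ F 0 D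
  | t + 1, D => reached F t (Fin.init D) ∨ 1 ≤ F (t + 1) D

theorem reached_iff (F : (t : ℕ) → (Fin t → Episode S A H) → ℝ) (D : ℕ → Episode S A H) (T : ℕ) :
    reached F T (firstEpisodes D T) ↔ ∃ t ≤ T, 1 ≤ F t (firstEpisodes D t) := by
  induction T with
  | zero => simp [reached]
  | succ T ih =>
    have h0 : (Fin.init (firstEpisodes D (T + 1)) : Fin T → Episode S A H) =
      firstEpisodes D T := rfl
    rw [reached, h0, ih]
    constructor
    · rintro (⟨t, ht, h⟩ | h)
      · exact ⟨t, ht.trans (Nat.le_succ T), h⟩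
      · exact ⟨T + 1, le_rfl, h⟩
    · rintro ⟨t, ht, h⟩
      rcases Nat.le_succ_iff.1 ht with ht | rfl
      · exact Or.inl ⟨t, ht, h⟩
      · exact Or.inr h

/-- Ville's maximal inequality for nonnegative supermartingales along the interaction. -/
theorem IsInteraction.ville [Nonempty A] (hI : IsInteraction M alg μ X)
    (hmem : ∀ t D, M.episodeProb (alg.policy t D) ∈ stdSimplex ℝ (Episode S A H))
    (F : (t : ℕ) → (Fin t → Episode S A H) → ℝ) (h0 : ∀ t D, 0 ≤ F t D)
    (hF : ∀ t D, M.expect (alg.policy t D) (fun e => F (t + 1) (Fin.snoc D e)) ≤ F t D) {c : ℝ}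
    (hc : ∀ D, F 0 D ≤ c) (T : ℕ) :
    μ {ω | ∃ t ≤ T, 1 ≤ F t (firstEpisodes (fun i => X i ω) t)} ≤ ENNReal.ofReal c := by
  classical
  have hset : {ω | ∃ t ≤ T, 1 ≤ F t (firstEpisodes (fun i => X i ω) t)} =
      {ω | firstEpisodes (fun i => X i ω) T ∈ {D | reached F T D}} := by
    ext ω
    exact (reached_iff F _ T).symm
  rw [hset, hI.measure_hist_mem]
  refine ENNReal.ofReal_le_ofReal ?_
  -- The process frozen at 1 once it has reached 1. Its expectation does not increase, and at time T
  -- it dominates the indicator of the event.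
  let Y : (t : ℕ) → (Fin t → Episode S A H) → ℝ := fun t D => if reached F t D then 1 else F t D
  have hY : ∀ t, ∑ D, histProb M alg t D * Y t D ≤ c := by
    intro t
    induction t with
    | zero =>
      rw [Fintype.sum_unique]
      have h1 : Y 0 default ≤ F 0 default := by
        by_cases h : 1 ≤ F 0 default <;> simp [Y, reached, h]
      simpa [histProb] using h1.trans (hc _)
    | succ t ih =>
      refine le_trans ?_ ih
      rw [sum_hist_succ]
      refine Finset.sum_le_sum fun D _ => ?_
      simp only [histProb_snoc, mul_assoc, ← Finset.mul_sum]
      refine mul_le_mul_of_nonneg_left ?_ (histProb_nonneg _ _ _ _)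
      by_cases hr : reached F t D
      · have : ∀ e, Y (t + 1) (Fin.snoc D e) = 1 := fun e => by
          simp [Y, reached, hr]
        simp [this, (hmem t D).2, Y, hr]
      · have : ∀ e, Y (t + 1) (Fin.snoc D e) ≤ F (t + 1) (Fin.snoc D e) := fun e => by
          simp only [Y, reached, Fin.init_snoc, hr, false_or]
          split_ifs with h
          · exact h
          · exact le_rfl
        refine (mean_mono (hmem t D) this).trans ((hF t D).trans ?_)
        simp [Y, hr]
  refine le_trans (Finset.sum_le_sum fun D _ => ?_) (hY T)
  refine mul_le_mul_of_nonneg_left ?_ (histProb_nonneg _ _ _ _)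
  simp only [Y, Set.mem_ofPred_eq]
  split_ifs
  · exact le_rfl
  · exact h0 _ _

theorem IsInteraction.measure_univ [Nonempty A] (hI : IsInteraction M alg μ X) :
    μ Set.univ = 1 := by
  have := hI.law 0 fun _ => (fun _ => s₁, fun _ => Classical.arbitrary A)
  simpa using this

/-- If for every horizon the failure probability is at most `δ`, then with probability `1 - δ` no
failure ever happens. -/
theorem IsInteraction.le_measure_forall [Nonempty A] (hI : IsInteraction M alg μ X) {δ : ℝ}
    (B : (t : ℕ) → (Fin t → Episode S A H) → Prop)
    (hB : ∀ T, μ {ω | ∃ t ≤ T, ¬ B t (firstEpisodes (fun i => X i ω) t)} ≤ ENNReal.ofReal δ)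
    (hδ : 0 ≤ δ) :
    ENNReal.ofReal (1 - δ) ≤ μ {ω | ∀ t, B t (firstEpisodes (fun i => X i ω) t)} := by
  have hm : ∀ t, MeasurableSet {ω | B t (firstEpisodes (fun i => X i ω) t)} :=
    fun t => hI.measurableSet_hist_mem t {D | B t D}
  have hG : MeasurableSet {ω | ∀ t, B t (firstEpisodes (fun i => X i ω) t)} := by
    rw [Set.ofPred_forall]
    exact MeasurableSet.iInter hm
  have hbad : μ {ω | ∀ t, B t (firstEpisodes (fun i => X i ω) t)}ᶜ ≤ ENNReal.ofReal δ := by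
    have hU : {ω | ∀ t, B t (firstEpisodes (fun i => X i ω) t)}ᶜ =
        ⋃ T, {ω | ∃ t ≤ T, ¬ B t (firstEpisodes (fun i => X i ω) t)} := by
      ext ω
      simp only [Set.mem_compl_iff, Set.mem_ofPred_eq, Set.mem_iUnion, not_forall]
      exact ⟨fun ⟨t, h⟩ => ⟨t, t, le_rfl, h⟩, fun ⟨_, t, _, h⟩ => ⟨t, h⟩⟩
    rw [hU, Monotone.measure_iUnion]
    · exact iSup_le hB
    · intro T T' hT ω ⟨t, ht, h⟩
      exact ⟨t, ht.trans hT, h⟩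
  have : MeasureTheory.IsProbabilityMeasure μ := ⟨hI.measure_univ⟩
  have h1 := MeasureTheory.prob_compl_eq_one_sub (μ := μ) hG
  rw [ENNReal.ofReal_sub _ hδ, ENNReal.ofReal_one]
  rw [h1] at hbad
  exact tsub_le_iff_left.2 (tsub_le_iff_right.1 hbad)

end interaction

end

/-! ### Concentration of count vectors -/

section counts

variable {S : Type u} [Fintype S] [DecidableEq S] {p : S → ℝ}

/-- The counts `c` after one more observation `x`. -/
def incr (c : S → ℕ) (x : S) : S → ℕ := fun s => c s + if s = x then 1 else 0

/-- Nonnegative supermartingales of the counts of an i.i.d. sequence with law `p`. -/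
structure IsCountSupermartingale (p : S → ℝ) (g : (S → ℕ) → ℝ) : Prop where
  nonneg : ∀ c, 0 ≤ g c
  step : ∀ c, mean p (fun x => g (incr c x)) ≤ g c

theorem sum_incr (c : S → ℕ) (x : S) : ∑ s, incr c x s = ∑ s, c s + 1 := by
  simp [incr, Finset.sum_add_distrib]

/-- A single coordinate of the counts only sees a Bernoulli trial with parameter `p s`. -/
theorem mean_coordinate (hp : p ∈ stdSimplex ℝ S) (c : S → ℕ) (s : S) (F : ℕ → ℝ) :
    mean p (fun x => F (incr c x s)) = p s * F (c s + 1) + (1 - p s) * F (c s) := by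
  have h : ∀ x, p x * F (incr c x s) =
      p x * F (c s) + if x = s then p s * (F (c s + 1) - F (c s)) else 0 := by
    intro x
    split_ifs with hx
    · subst hx; simp [incr]; ring
    · simp [incr, Ne.symm hx]
  rw [mean, Finset.sum_congr rfl fun x _ => h x, Finset.sum_add_distrib, ← Finset.sum_mul, hp.2]
  simp
  ring

theorem prod_pow_incr (c : S → ℕ) (x : S) :
    ∏ s, p s ^ incr c x s = (∏ s, p s ^ c s) * p x := by
  simp only [incr, pow_add, Finset.prod_mul_distrib]
  simp [pow_ite]

/-! #### Hellinger distance of the empirical distribution -/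

/-- Probability of a sequence with counts `c` under the uniform mixture of all i.i.d. laws. -/
def mixtureProb (c : S → ℕ) : ℝ :=
  ((Fintype.card S - 1).factorial : ℝ) * (∏ s, ((c s).factorial : ℝ)) /
    ((∑ s, c s + (Fintype.card S - 1)).factorial : ℝ)

theorem mixtureProb_pos (c : S → ℕ) : 0 < mixtureProb c := by
  unfold mixtureProb
  have : 0 < ∏ s, ((c s).factorial : ℝ) := Finset.prod_pos fun s _ => by positivity
  positivity

theorem mixtureProb_zero : mixtureProb (0 : S → ℕ) = 1 := by
  simp [mixtureProb, Nat.factorial_ne_zero]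

/-- Laplace's rule of succession. The predictive probabilities sum to 1, which is what makes the
likelihood ratio a supermartingale. -/
theorem mixtureProb_incr [Nonempty S] (c : S → ℕ) (x : S) :
    mixtureProb (incr c x) =
      mixtureProb c * ((c x + 1) / (∑ s, (c s : ℝ) + Fintype.card S)) := by
  have h1 : ∏ s, ((incr c x s).factorial : ℝ) =
      (∏ s, ((c s).factorial : ℝ)) * (c x + 1) := by
    rw [← Finset.mul_prod_erase _ _ (Finset.mem_univ x),
      ← Finset.mul_prod_erase _ (fun s => ((c s).factorial : ℝ)) (Finset.mem_univ x)]
    have : ∏ s ∈ Finset.univ.erase x, ((incr c x s).factorial : ℝ) =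
        ∏ s ∈ Finset.univ.erase x, ((c s).factorial : ℝ) :=
      Finset.prod_congr rfl fun s hs => by simp [incr, Finset.ne_of_mem_erase hs]
    rw [this]
    simp [incr, Nat.factorial_succ]
    ring
  obtain ⟨k, hk⟩ : ∃ k, Fintype.card S = k + 1 :=
    ⟨Fintype.card S - 1, (Nat.succ_pred_eq_of_pos Fintype.card_pos).symm⟩
  rw [mixtureProb, mixtureProb, h1, sum_incr, hk, Nat.add_sub_cancel,
    show ∑ s, c s + 1 + k = (∑ s, c s + k) + 1 by ring, Nat.factorial_succ]
  have h2 : ((∑ s, c s + k).factorial : ℝ) ≠ 0 := Nat.cast_ne_zero.2 (Nat.factorial_ne_zero _)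
  have h3 : (∑ s, (c s : ℝ)) + ((k + 1 : ℕ) : ℝ) ≠ 0 := by positivity
  push_cast at h3 ⊢
  rw [show ∑ s, (c s : ℝ) + (k : ℝ) + 1 = ∑ s, (c s : ℝ) + (k + 1) by ring]
  field_simp

/-- The likelihood ratio of the mixture, times `d`. -/
def likelihoodRatio (p : S → ℝ) (d : ℝ) (c : S → ℕ) : ℝ :=
  -- Counts impossible under p get the value 1, so a ratio below 1 certifies a nonzero denominator;
  -- they are reached from possible counts with probability zero.
  if ∏ s, p s ^ c s = 0 then 1 else d * mixtureProb c / ∏ s, p s ^ c s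

/-- Weighting by p cancels the denominator and leaves the predictive probabilities of the mixture.
Equality can fail only because outcomes of zero probability are dropped. -/
theorem isCountSupermartingale_likelihoodRatio (hp : p ∈ stdSimplex ℝ S) {d : ℝ} (hd : 0 ≤ d) :
    IsCountSupermartingale p (likelihoodRatio p d) := by
  have hw : ∀ c : S → ℕ, 0 ≤ ∏ s, p s ^ c s :=
    fun c => Finset.prod_nonneg fun s _ => pow_nonneg (hp.1 s) _
  have : Nonempty S := by
    by_contra h
    rw [not_nonempty_iff] at h
    simpa using hp.2
  refine ⟨fun c => ?_, fun c => ?_⟩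
  · rw [likelihoodRatio]
    split_ifs
    · exact zero_le_one
    · exact div_nonneg (mul_nonneg hd (mixtureProb_pos c).le) (hw c)
  · by_cases h : ∏ s, p s ^ c s = 0
    · simp only [likelihoodRatio, prod_pow_incr, h, zero_mul, if_true]
      rw [mean_const hp]
    · have hs : ∀ x, p x * likelihoodRatio p d (incr c x) ≤
          d * mixtureProb c / (∏ s, p s ^ c s) *
            ((c x + 1) / (∑ s, (c s : ℝ) + Fintype.card S)) := by
        intro x
        rcases (hp.1 x).eq_or_lt with hx | hx
        · rw [← hx, zero_mul]
          have := mixtureProb_pos c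
          have := hw c
          positivity
        · rw [likelihoodRatio, prod_pow_incr, if_neg (mul_ne_zero h hx.ne'),
            mixtureProb_incr]
          apply le_of_eq
          field_simp
      refine (Finset.sum_le_sum fun x _ => hs x).trans ?_
      rw [← Finset.mul_sum, ← Finset.sum_div, likelihoodRatio, if_neg h]
      rw [Finset.sum_add_distrib]
      have : (0 : ℝ) < ∑ s, (c s : ℝ) + Fintype.card S := by
        have : 0 < Fintype.card S := Fintype.card_pos
        positivity
      simp [div_self this.ne']

/-- A bound on the binomial coefficient of n + k and k; it gives the price of the mixture in
`prod_empirical_pow_le`. -/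
theorem factorial_add_le (n k : ℕ) :
    (n + k).factorial ≤ (n + 1) ^ k * (k.factorial * n.factorial) := by
  induction k with
  | zero => simp
  | succ k ih =>
    rw [← add_assoc, Nat.factorial_succ, Nat.factorial_succ]
    calc (n + k + 1) * (n + k).factorial
        ≤ ((n + 1) * (k + 1)) * ((n + 1) ^ k * (k.factorial * n.factorial)) :=
          Nat.mul_le_mul (by nlinarith) ih
      _ = _ := by ring

/-- The maximum likelihood exceeds the mixture by a polynomial factor only: the multinomial
coefficient times the empirical likelihood is one term of an expansion that sums to 1. -/
theorem prod_empirical_pow_le (c : S → ℕ) {n : ℕ} (hn : ∑ s, c s = n) (h0 : 0 < n) :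
    ∏ s, ((c s : ℝ) / n) ^ c s ≤ mixtureProb c * (n + 1) ^ (Fintype.card S - 1) := by
  have h1 : Nat.multinomial Finset.univ c * ∏ s, c s ^ c s ≤ n ^ n := by
    have := Finset.sum_pow_eq_sum_piAntidiag (Finset.univ : Finset S) c n
    rw [hn] at this
    rw [this]
    exact Finset.single_le_sum (f := fun k : S → ℕ =>
      Nat.multinomial Finset.univ k * ∏ i, c i ^ k i) (fun _ _ => Nat.zero_le _)
      (Finset.mem_piAntidiag.2 ⟨hn, fun _ _ => Finset.mem_univ _⟩)
  have h2 := Nat.multinomial_spec (Finset.univ : Finset S) c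
  rw [hn] at h2
  have h3 : ∏ s, ((c s : ℝ) / n) ^ c s = (∏ s, (c s : ℝ) ^ c s) / n ^ n := by
    simp only [div_pow, Finset.prod_div_distrib]
    rw [Finset.prod_pow_eq_pow_sum, hn]
  have hf : (0 : ℝ) < ∏ s, ((c s).factorial : ℝ) := Finset.prod_pos fun s _ => by positivity
  have hnn : (0 : ℝ) < (n : ℝ) ^ n := by positivity
  have h4 : (∏ s, (c s : ℝ) ^ c s) / n ^ n ≤ (∏ s, ((c s).factorial : ℝ)) / n.factorial := by
    rw [div_le_div_iff₀ hnn (by positivity)]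
    have h1' : (Nat.multinomial Finset.univ c : ℝ) * ∏ s, (c s : ℝ) ^ c s ≤ (n : ℝ) ^ n := by
      exact_mod_cast h1
    have h2' : (∏ s, ((c s).factorial : ℝ)) * Nat.multinomial Finset.univ c = n.factorial := by
      exact_mod_cast h2
    rw [← h2']
    calc _ = (∏ s, ((c s).factorial : ℝ)) *
          ((Nat.multinomial Finset.univ c : ℝ) * ∏ s, (c s : ℝ) ^ c s) := by ring
      _ ≤ _ := by gcongr
  rw [h3]
  refine h4.trans ?_
  have h5 : (((n + (Fintype.card S - 1)).factorial : ℕ) : ℝ) ≤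
      (n + 1) ^ (Fintype.card S - 1) * ((Fintype.card S - 1).factorial * n.factorial) := by
    exact_mod_cast factorial_add_le n (Fintype.card S - 1)
  rw [mixtureProb, hn, div_mul_eq_mul_div, div_le_div_iff₀ (by positivity) (by positivity)]
  calc _ ≤ (∏ s, ((c s).factorial : ℝ)) *
        ((n + 1) ^ (Fintype.card S - 1) * ((Fintype.card S - 1).factorial * n.factorial)) := by
        gcongr
    _ = _ := by ring

/-- Relative entropy dominates the squared Hellinger distance, in multiplicative form: p/q =
(√p/√q)² ≤ exp (2(√p/√q - 1)), and the exponents sum to minus n times `hel`. Symbols with zero count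
only contribute factors 1, so no logarithm of zero arises. -/
theorem prod_pow_le_exp_hel (hp : p ∈ stdSimplex ℝ S) (c : S → ℕ) {n : ℕ} (hn : ∑ s, c s = n)
    (h0 : 0 < n) : ∏ s, p s ^ c s ≤ (∏ s, ((c s : ℝ) / n) ^ c s) *
      Real.exp (-(n * hel (fun s => (c s : ℝ) / n) p)) := by
  have hn0 : (n : ℝ) ≠ 0 := by positivity
  have hs : ∀ s, p s ^ c s ≤ ((c s : ℝ) / n) ^ c s *
      Real.exp (2 * n * (√((c s : ℝ) / n) * √(p s) - (c s : ℝ) / n)) := by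
    intro s
    rcases Nat.eq_zero_or_pos (c s) with h | h
    · simp [h]
    · have hq : (0 : ℝ) < (c s : ℝ) / n := by positivity
      have h1 : p s ≤ (c s : ℝ) / n * Real.exp (2 * (√(p s) / √((c s : ℝ) / n) - 1)) := by
        have h2 : √(p s) / √((c s : ℝ) / n) ≤ Real.exp (√(p s) / √((c s : ℝ) / n) - 1) := by
          have := Real.add_one_le_exp (√(p s) / √((c s : ℝ) / n) - 1)
          linarith
        have h3 := pow_le_pow_left₀ (by positivity) h2 2
        rw [div_pow, Real.sq_sqrt (hp.1 s), Real.sq_sqrt hq.le, ← Real.exp_nat_mul,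
          div_le_iff₀ hq] at h3
        rw [mul_comm]
        exact_mod_cast h3
      refine (pow_le_pow_left₀ (hp.1 s) h1 _).trans_eq ?_
      rw [mul_pow, ← Real.exp_nat_mul]
      congr 2
      have h4 : (c s : ℝ) = n * (√((c s : ℝ) / n) * √((c s : ℝ) / n)) := by
        rw [Real.mul_self_sqrt hq.le]
        field_simp
      have h5 : √((c s : ℝ) / n) ≠ 0 := (Real.sqrt_pos.2 hq).ne'
      have h6 : (c s : ℝ) / n = √((c s : ℝ) / n) * √((c s : ℝ) / n) :=
        (Real.mul_self_sqrt hq.le).symm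
      calc (c s : ℝ) * (2 * (√(p s) / √((c s : ℝ) / n) - 1))
          = n * (√((c s : ℝ) / n) * √((c s : ℝ) / n)) *
            (2 * (√(p s) / √((c s : ℝ) / n) - 1)) := by rw [← h4]
        _ = 2 * n * (√((c s : ℝ) / n) * √(p s) - √((c s : ℝ) / n) * √((c s : ℝ) / n)) := by
            field_simp
        _ = _ := by rw [← h6]
  refine (Finset.prod_le_prod (fun s _ => pow_nonneg (hp.1 s) _) fun s _ => hs s).trans_eq ?_
  rw [Finset.prod_mul_distrib, ← Real.exp_sum, ← Finset.mul_sum]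
  congr 2
  have hq : ∑ s, (c s : ℝ) / n = 1 := by
    rw [← Finset.sum_div, ← hn]
    push_cast
    rw [div_self]
    rw [← hn] at hn0
    exact_mod_cast hn0
  have h7 : ∀ s, (√((c s : ℝ) / n) - √(p s)) ^ 2 =
      (c s : ℝ) / n + p s - 2 * (√((c s : ℝ) / n) * √(p s)) := by
    intro s
    rw [sub_sq, Real.sq_sqrt (by positivity), Real.sq_sqrt (hp.1 s)]
    ring
  simp only [hel, h7, Finset.sum_sub_distrib, Finset.sum_add_distrib, hq, hp.2, ← Finset.mul_sum]
  ring

/-- Chaining the last two bounds gives n · hel ≤ log (1/d) + (card S - 1) log (n + 1), uniformly in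
n without a union bound; this is relaxed to the form of `betaKL`. -/
theorem hel_le_of_likelihoodRatio_lt (hp : p ∈ stdSimplex ℝ S) {d : ℝ} (hd : 0 < d) (c : S → ℕ)
    {n : ℕ} (hn : ∑ s, c s = n) (h0 : 0 < n) (h : likelihoodRatio p d c < 1) :
    hel (fun s => (c s : ℝ) / n) p ≤
      (Real.log (1 / d) + Fintype.card S * Real.log (Real.exp 1 * (1 + n))) / n := by
  rw [likelihoodRatio] at h
  split_ifs at h with hw
  · exact absurd h (lt_irrefl _)
  have hw' : 0 < ∏ s, p s ^ c s :=
    lt_of_le_of_ne (Finset.prod_nonneg fun s _ => pow_nonneg (hp.1 s) _) (Ne.symm hw)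
  rw [div_lt_one hw'] at h
  have h1 := (prod_pow_le_exp_hel hp c hn h0).trans
    (mul_le_mul_of_nonneg_right (prod_empirical_pow_le c hn h0) (Real.exp_pos _).le)
  have hm := mixtureProb_pos c
  have h2 : d < (n + 1) ^ (Fintype.card S - 1) *
      Real.exp (-(n * hel (fun s => (c s : ℝ) / n) p)) := by
    have := h.trans_le h1
    rw [mul_assoc, mul_comm d] at this
    exact lt_of_mul_lt_mul_left this hm.le
  have h3 := Real.log_lt_log hd h2
  rw [Real.log_mul (by positivity) (Real.exp_pos _).ne', Real.log_exp, Real.log_pow] at h3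
  rw [le_div_iff₀ (by positivity), one_div, Real.log_inv]
  have h4 : ((Fintype.card S - 1 : ℕ) : ℝ) * Real.log (n + 1) ≤
      Fintype.card S * Real.log (Real.exp 1 * (1 + n)) := by
    have h5 : (1 : ℝ) ≤ Real.exp 1 := Real.one_le_exp zero_le_one
    have h6 : Real.log ((n : ℝ) + 1) ≤ Real.log (Real.exp 1 * (1 + n)) :=
      Real.log_le_log (by positivity) (by nlinarith [(Nat.cast_nonneg n : (0 : ℝ) ≤ n)])
    have h7 : 0 ≤ Real.log ((n : ℝ) + 1) := Real.log_nonneg (by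
      linarith [(Nat.cast_nonneg n : (0 : ℝ) ≤ n)])
    exact mul_le_mul (Nat.cast_le.2 (Nat.sub_le _ _)) h6 h7 (Nat.cast_nonneg _)
  linarith

end counts

section counts

variable {S : Type u} [Fintype S] [DecidableEq S] {p : S → ℝ}

/-! #### Bernstein's inequality -/

/-- The Taylor remainder after the square is at most x² u / 2, and (1 + u)/2 ≤ 1/(2(1 - u)). -/
theorem exp_le_bernstein {x u : ℝ} (hx : |x| ≤ u) (hu : u < 1) :
    Real.exp x ≤ 1 + x + x ^ 2 / (2 * (1 - u)) := by
  have h1 := Real.exp_bound (hx.trans hu.le) (n := 3) (by norm_num)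
  have h2 := (abs_sub_le_iff.1 h1).1
  simp only [Finset.sum_range_succ, Finset.sum_range_zero, Nat.factorial] at h2
  norm_num at h2
  have h3 : x ^ 2 / 2 * (1 + u) ≤ x ^ 2 / (2 * (1 - u)) := by
    rw [le_div_iff₀ (by linarith)]
    have : 0 ≤ x ^ 2 * u ^ 2 := by positivity
    nlinarith
  have h4 : |x| ^ 3 ≤ x ^ 2 * u := by
    rw [pow_succ, sq_abs]
    exact mul_le_mul_of_nonneg_left hx (sq_nonneg x)
  have h5 : 0 ≤ x ^ 2 * u := mul_nonneg (sq_nonneg x) ((abs_nonneg x).trans hx)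
  nlinarith

/-- Exponential supermartingale of a sum of `n` independent terms, stopped after `n` terms. -/
def expSum (Y : S → ℝ) (l ψ β : ℝ) (n : ℕ) (c : S → ℕ) : ℝ :=
  -- The tilt is tuned to n observations, and the bound is read off only when the total is exactly
  -- n; dropping to 0 afterwards keeps the supermartingale property.
  if ∑ s, c s ≤ n then Real.exp (l * ∑ s, c s * Y s - (∑ s, c s : ℕ) * ψ - β) else 0

theorem isCountSupermartingale_expSum {Y : S → ℝ} {l ψ : ℝ}
    (h : mean p (fun s => Real.exp (l * Y s)) ≤ Real.exp ψ) (β : ℝ) (n : ℕ) :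
    IsCountSupermartingale p (expSum Y l ψ β n) := by
  refine ⟨fun c => ?_, fun c => ?_⟩
  · rw [expSum]; split_ifs <;> positivity
  · rcases lt_or_ge (∑ s, c s) n with hn | hn
    · have h1 : ∀ x, expSum Y l ψ β n (incr c x) =
          (expSum Y l ψ β n c * Real.exp (-ψ)) * Real.exp (l * Y x) := by
        intro x
        rw [expSum, expSum, sum_incr, if_pos (Nat.succ_le_of_lt hn), if_pos hn.le,
          ← Real.exp_add, ← Real.exp_add]
        congr 1
        have : ∑ s, (incr c x s : ℝ) * Y s = ∑ s, c s * Y s + Y x := by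
          simp [incr, add_mul, Finset.sum_add_distrib]
        rw [this]
        push_cast
        ring
      simp only [h1, mean_mul_left]
      have h2 : 0 ≤ expSum Y l ψ β n c := by rw [expSum]; split_ifs <;> positivity
      calc _ ≤ expSum Y l ψ β n c * Real.exp (-ψ) * Real.exp ψ := by gcongr
        _ = _ := by rw [mul_assoc, ← Real.exp_add]; simp
    · have h1 : ∀ x, expSum Y l ψ β n (incr c x) = 0 := by
        intro x
        rw [expSum, sum_incr, if_neg (by omega)]
      simp only [h1, mean_zero]
      rw [expSum]; split_ifs <;> positivity

theorem expSum_zero (Y : S → ℝ) (l ψ β : ℝ) (n : ℕ) :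
    expSum Y l ψ β n 0 = Real.exp (-β) := by
  simp [expSum]

theorem mean_exp_le (hp : p ∈ stdSimplex ℝ S) {Y : S → ℝ} {b l : ℝ} (hl : 0 ≤ l)
    (hlb : l * b < 1) (hY : ∀ s, |Y s| ≤ b) (h0 : mean p Y = 0) :
    mean p (fun s => Real.exp (l * Y s)) ≤
      Real.exp (l ^ 2 * mean p (fun s => Y s ^ 2) / (2 * (1 - l * b))) := by
  have h1 : ∀ s, Real.exp (l * Y s) ≤ 1 + l * Y s + (l ^ 2 / (2 * (1 - l * b))) * Y s ^ 2 := by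
    intro s
    have := exp_le_bernstein (x := l * Y s) (u := l * b) (by
      rw [abs_mul, abs_of_nonneg hl]; exact mul_le_mul_of_nonneg_left (hY s) hl) hlb
    refine this.trans_eq ?_
    ring
  refine (mean_mono hp h1).trans ?_
  rw [mean_add, mean_add, mean_const hp, mean_mul_left, mean_mul_left, h0]
  have := Real.add_one_le_exp (l ^ 2 * mean p (fun s => Y s ^ 2) / (2 * (1 - l * b)))
  refine le_trans (le_of_eq ?_) this
  ring

/-- The tilting parameter in Bernstein's inequality. -/
def bernsteinTilt (v b β : ℝ) (n : ℕ) : ℝ := √(2 * β / n) / (√v + b * √(2 * β / n))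

/-- The bound on the logarithmic moment generating function at `bernsteinTilt`. -/
def bernsteinRate (v b β : ℝ) (n : ℕ) : ℝ :=
  2 * β / n * √v / (2 * (√v + b * √(2 * β / n)))

/-- For l = `bernsteinTilt` the factor 1 - l b equals √v / (√v + b y) with y = √(2β/n), so
`mean_exp_le` gives exactly `bernsteinRate`. -/
theorem mean_exp_bernsteinTilt_le (hp : p ∈ stdSimplex ℝ S) {Y : S → ℝ} {b β : ℝ} {n : ℕ}
    (hb : 0 < b) (hβ : 0 < β) (hn : 0 < n) (hY : ∀ s, |Y s| ≤ b) (h0 : mean p Y = 0) :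
    mean p (fun s => Real.exp (bernsteinTilt (mean p fun s => Y s ^ 2) b β n * Y s)) ≤
      Real.exp (bernsteinRate (mean p fun s => Y s ^ 2) b β n) := by
  set v := mean p fun s => Y s ^ 2 with hv
  have hv0 : 0 ≤ v := mean_nonneg hp fun s => sq_nonneg _
  have hy : 0 < √(2 * β / n) := Real.sqrt_pos.2 (by positivity)
  set y := √(2 * β / n) with hyd
  have hy2 : y ^ 2 = 2 * β / n := Real.sq_sqrt (by positivity)
  rcases hv0.eq_or_lt with hz | hpos
  -- For v = 0 the tilt is 1 / b, which `mean_exp_le` excludes; but then Y vanishes wherever p is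
  -- positive.
  · have hs : ∀ s, p s * Real.exp (bernsteinTilt v b β n * Y s) = p s * 1 := by
      intro s
      have h1 : p s * Y s ^ 2 = 0 := by
        have := (Finset.sum_eq_zero_iff_of_nonneg
          (fun s _ => mul_nonneg (hp.1 s) (sq_nonneg (Y s)))).1 (hv.symm.trans hz.symm)
        exact this s (Finset.mem_univ s)
      rcases mul_eq_zero.1 h1 with h | h
      · simp [h]
      · simp [pow_eq_zero_iff two_ne_zero |>.1 h]
    rw [mean, Finset.sum_congr rfl fun s _ => hs s]
    simp only [mul_one, hp.2]
    apply Real.one_le_exp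
    rw [bernsteinRate, ← hyd]
    positivity
  · have hσ : 0 < √v := Real.sqrt_pos.2 hpos
    have h1 : 1 - y / (√v + b * y) * b = √v / (√v + b * y) := by
      field_simp
      ring
    have h2 : 0 < √v / (√v + b * y) := by positivity
    refine (mean_exp_le hp (l := bernsteinTilt v b β n) ?_ ?_ hY h0).trans_eq ?_
    · rw [bernsteinTilt, ← hyd]; positivity
    · rw [bernsteinTilt, ← hyd]; linarith
    · rw [← hv, bernsteinRate, bernsteinTilt, ← hyd, h1, ← hy2]
      congr 1
      have h3 : v = √v * √v := (Real.mul_self_sqrt hv0).symm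
      nth_rewrite 2 [h3]
      field_simp

/-- With β = n y² / 2 the exponent factors as the tilt times (sum - n (√v y + b y² / 2)), so its
sign is Bernstein's inequality without loss. -/
theorem lt_of_expSum_lt_one {Y : S → ℝ} {v b β : ℝ} {n : ℕ} (hb : 0 < b)
    (hβ : 0 < β) (hn : 0 < n) (c : S → ℕ) (hc : ∑ s, c s = n)
    (h : expSum Y (bernsteinTilt v b β n) (bernsteinRate v b β n) β n c < 1) :
    ∑ s, (c s : ℝ) / n * Y s ≤ √(2 * v * (β / n)) + b * (β / n) := by
  rw [expSum, if_pos hc.le, Real.exp_lt_one_iff, hc] at h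
  have hn' : (0 : ℝ) < n := by positivity
  have hy : 0 < √(2 * β / n) := Real.sqrt_pos.2 (by positivity)
  have hsq : √(2 * v * (β / n)) = √v * √(2 * β / n) := by
    rw [mul_comm √v, ← Real.sqrt_mul (by positivity)]
    congr 1
    ring
  have hy2 : √(2 * β / n) ^ 2 = 2 * β / n := Real.sq_sqrt (by positivity)
  rw [bernsteinTilt, bernsteinRate, ← hy2] at h
  rw [hsq]
  have hβ' : β = n * √(2 * β / n) ^ 2 / 2 := by rw [hy2]; field_simp
  have hβn : β / n = √(2 * β / n) ^ 2 / 2 := by rw [hy2]; ring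
  rw [hβn]
  set y := √(2 * β / n) with hyd
  rw [hβ'] at h
  have hσ : 0 ≤ √v := Real.sqrt_nonneg v
  have hd : 0 < √v + b * y := by positivity
  have hsum : ∑ s, (c s : ℝ) / n * Y s = (∑ s, (c s : ℝ) * Y s) / n := by
    rw [Finset.sum_div]
    exact Finset.sum_congr rfl fun s _ => by ring
  rw [hsum, div_le_iff₀ hn']
  set Z := ∑ s, (c s : ℝ) * Y s
  have h2 : y / (√v + b * y) * Z - n * (y ^ 2 * √v / (2 * (√v + b * y))) - n * y ^ 2 / 2 =
      y / (√v + b * y) * (Z - (√v * y + b * (y ^ 2 / 2)) * n) := by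
    field_simp
    ring
  rw [Real.sqrt_sq hy.le, h2] at h
  have h3 : 0 < y / (√v + b * y) := by positivity
  have h4 : Z - (√v * y + b * (y ^ 2 / 2)) * n < 0 := by
    by_contra hcon
    exact absurd h (not_lt.2 (mul_nonneg h3.le (not_lt.1 hcon)))
  linarith

/-! #### McDiarmid's inequality for the empirical entropy -/

/-- Expectation of `φ` after `k` more observations. -/
def doob (p : S → ℝ) (φ : (S → ℕ) → ℝ) : ℕ → (S → ℕ) → ℝ
  | 0, c => φ c
  | k + 1, c => mean p fun x => doob p φ k (incr c x)

theorem doob_mono (hp : p ∈ stdSimplex ℝ S) {φ ψ : (S → ℕ) → ℝ} (k : ℕ) (c : S → ℕ)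
    (h : ∀ c' : S → ℕ, ∑ s, c' s = ∑ s, c s + k → φ c' ≤ ψ c') :
    doob p φ k c ≤ doob p ψ k c := by
  induction k generalizing c with
  | zero => exact h c rfl
  | succ k ih =>
    refine mean_mono hp fun x => ih _ fun c' hc' => h c' ?_
    rw [hc', sum_incr]
    ring

/-- Mathlib's Hoeffding lemma for the discrete measure with weights p; an interval of radius a gives
the variance proxy a². -/
theorem mean_exp_hoeffding (hp : p ∈ stdSimplex ℝ S) {Y : S → ℝ} {B a : ℝ}
    (hY : ∀ s, |Y s - B| ≤ a) (ha : 0 ≤ a) (l : ℝ) :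
    mean p (fun s => Real.exp (l * (Y s - mean p Y))) ≤ Real.exp (l ^ 2 * a ^ 2 / 2) := by
  let _ : MeasurableSpace S := ⊤
  have : MeasurableSingletonClass S := ⟨fun _ => trivial⟩
  let μ : MeasureTheory.Measure S := ∑ s, ENNReal.ofReal (p s) • MeasureTheory.Measure.dirac s
  have hμ : MeasureTheory.IsProbabilityMeasure μ := by
    constructor
    simp only [μ, MeasureTheory.Measure.finsetSum_apply, MeasureTheory.Measure.smul_apply,
      MeasureTheory.measure_univ, smul_eq_mul, mul_one]
    rw [← ENNReal.ofReal_sum_of_nonneg fun s _ => hp.1 s, hp.2, ENNReal.ofReal_one]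
  have hint : ∀ f : S → ℝ, ∫ s, f s ∂μ = mean p f := by
    intro f
    rw [MeasureTheory.integral_fintype (MeasureTheory.Integrable.of_finite)]
    refine Finset.sum_congr rfl fun s _ => ?_
    rw [smul_eq_mul]
    congr 1
    rw [MeasureTheory.Measure.real]
    simp only [μ, MeasureTheory.Measure.finsetSum_apply, MeasureTheory.Measure.smul_apply,
      smul_eq_mul]
    rw [Finset.sum_eq_single s]
    · simp [hp.1 s]
    · intro b _ hb
      simp [hb]
    · simp
  have h1 := ProbabilityTheory.hasSubgaussianMGF_of_mem_Icc (μ := μ) (X := Y) (a := B - a)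
    (b := B + a) (measurable_from_top.aemeasurable) (Filter.Eventually.of_forall fun s => by
      have := abs_le.1 (hY s)
      exact ⟨by linarith, by linarith⟩)
  have h2 := h1.mgf_le l
  rw [ProbabilityTheory.mgf, hint, hint] at h2
  refine h2.trans_eq ?_
  congr 1
  have : (((‖B + a - (B - a)‖₊ / 2) ^ 2 : NNReal) : ℝ) = a ^ 2 := by
    have h3 : B + a - (B - a) = 2 * a := by ring
    rw [h3]
    push_cast
    rw [Real.norm_eq_abs, abs_of_nonneg (by positivity)]
    ring
  rw [this]
  ring

/-- Exponential Doob supermartingale, stopped after `n` observations. -/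
def expDoob (p : S → ℝ) (φ : (S → ℕ) → ℝ) (l a β : ℝ) (n : ℕ) (c : S → ℕ) : ℝ :=
  -- The cumulant bound of all n steps is paid in advance, and each observation uses up one unit of
  -- l² a² / 2.
  if ∑ s, c s ≤ n then Real.exp (l * (doob p φ (n - ∑ s, c s) c - doob p φ n 0) +
    (n - ∑ s, c s : ℕ) * (l ^ 2 * a ^ 2 / 2) - β) else 0

/-- Observations commute, so the effect of one extra observation at the end survives averaging over
the later ones. The comparison is with a missing observation, not with a different one. -/
theorem abs_doob_incr_sub_le (hp : p ∈ stdSimplex ℝ S) {φ : (S → ℕ) → ℝ} {a : ℝ} {n : ℕ}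
    (hφ : ∀ c x, ∑ s, c s + 1 = n → |φ (incr c x) - φ c| ≤ a) (k : ℕ) (c : S → ℕ) (x : S)
    (hc : ∑ s, c s + k + 1 = n) : |doob p φ k (incr c x) - doob p φ k c| ≤ a := by
  induction k generalizing c with
  | zero => exact hφ c x hc
  | succ k ih =>
    have hcomm : ∀ y, incr (incr c x) y = incr (incr c y) x := fun y => by
      funext s
      simp only [incr]
      ring
    have h1 : doob p φ (k + 1) (incr c x) - doob p φ (k + 1) c =
        mean p fun y => doob p φ k (incr (incr c y) x) - doob p φ k (incr c y) := by
      rw [mean_sub]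
      simp only [doob, hcomm]
    have h2 : ∀ y, |doob p φ k (incr (incr c y) x) - doob p φ k (incr c y)| ≤ a := fun y =>
      ih _ (by rw [sum_incr]; omega)
    rw [h1, abs_le]
    exact ⟨le_mean hp fun y => (abs_le.1 (h2 y)).1, mean_le hp fun y => (abs_le.1 (h2 y)).2⟩

theorem isCountSupermartingale_expDoob (hp : p ∈ stdSimplex ℝ S) {φ : (S → ℕ) → ℝ} {a : ℝ} {n : ℕ}
    (hφ : ∀ c x, ∑ s, c s + 1 = n → |φ (incr c x) - φ c| ≤ a) (ha : 0 ≤ a) (l β : ℝ) :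
    IsCountSupermartingale p (expDoob p φ l a β n) := by
  have h0 : ∀ c, 0 ≤ expDoob p φ l a β n c := fun c => by
    rw [expDoob]; split_ifs <;> positivity
  refine ⟨h0, fun c => ?_⟩
  rcases lt_or_ge (∑ s, c s) n with hn | hn
  · obtain ⟨k, hk⟩ : ∃ k, n = ∑ s, c s + k + 1 := ⟨n - ∑ s, c s - 1, by omega⟩
    have e1 : n - ∑ s, c s = k + 1 := by omega
    have e2 : n - (∑ s, c s + 1) = k := by omega
    set Y : S → ℝ := fun x => doob p φ k (incr c x) with hY
    have h1 : ∀ x, expDoob p φ l a β n (incr c x) =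
        (expDoob p φ l a β n c * Real.exp (-(l ^ 2 * a ^ 2 / 2))) *
          Real.exp (l * (Y x - mean p Y)) := by
      intro x
      rw [expDoob, expDoob, sum_incr, if_pos (by omega), if_pos hn.le, e1, e2,
        ← Real.exp_add, ← Real.exp_add]
      congr 1
      rw [show doob p φ (k + 1) c = mean p Y from rfl]
      simp only [hY]
      push_cast
      ring
    simp only [h1, mean_mul_left]
    -- All outcomes of the next observation lie within a of the value computed with that observation
    -- left out, which serves as centre.
    have h2 := mean_exp_hoeffding hp (Y := Y) (B := doob p φ k c) (a := a)
      (fun x => abs_doob_incr_sub_le hp hφ k c x hk.symm) ha l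
    have := h0 c
    calc _ ≤ expDoob p φ l a β n c * Real.exp (-(l ^ 2 * a ^ 2 / 2)) *
          Real.exp (l ^ 2 * a ^ 2 / 2) := by gcongr
      _ = _ := by rw [mul_assoc, ← Real.exp_add]; simp
  · have h1 : ∀ x, expDoob p φ l a β n (incr c x) = 0 := by
      intro x
      rw [expDoob, sum_incr, if_neg (by omega)]
    simp only [h1, mean_zero]
    exact h0 c

theorem expDoob_zero (φ : (S → ℕ) → ℝ) (l a β : ℝ) (n : ℕ) :
    expDoob p φ l a β n 0 = Real.exp (n * (l ^ 2 * a ^ 2 / 2) - β) := by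
  simp [expDoob]

end counts

/-! ### Bounded differences and bias of the empirical entropy -/

section counts

variable {S : Type u} [Fintype S] [DecidableEq S] {p : S → ℝ}

/-- Times n, the difference is log n minus (k + 1) log (k + 1) - k log k. The latter lies between 0
and 2 log (k + 1) because k log (1 + 1/k) ≤ log (k + 1): an equality at k = 1, and for k ≥ 2 a
consequence of k log (1 + 1/k) ≤ 1 ≤ log 3. -/
theorem abs_negMulLog_step_le {k n : ℕ} (hk : k + 1 ≤ n) :
    |Real.negMulLog ((k + 1 : ℕ) / (n : ℝ)) - Real.negMulLog (k / (n : ℝ))| ≤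
      Real.log n / n := by
  have hn : (0 : ℝ) < n := by exact_mod_cast (Nat.succ_pos k).trans_le hk
  have hf : ∀ j : ℕ, Real.negMulLog (j / (n : ℝ)) = (j * Real.log n - j * Real.log j) / n := by
    intro j
    rcases Nat.eq_zero_or_pos j with h | h
    · simp [h]
    · have : (0 : ℝ) < j := by exact_mod_cast h
      rw [Real.negMulLog, Real.log_div this.ne' hn.ne']
      ring
  have hlog : Real.log ((k + 1 : ℕ) : ℝ) ≤ Real.log n :=
    Real.log_le_log (by positivity) (by exact_mod_cast hk)
  have h0 : 0 ≤ Real.log ((k + 1 : ℕ) : ℝ) := Real.log_natCast_nonneg _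
  have key : (k : ℝ) * Real.log ((k + 1 : ℕ) : ℝ) - k * Real.log k ≤
      Real.log ((k + 1 : ℕ) : ℝ) ∧ 0 ≤ (k : ℝ) * Real.log ((k + 1 : ℕ) : ℝ) - k * Real.log k := by
    rcases Nat.eq_zero_or_pos k with h | h
    · simp [h]
    · have hk0 : (0 : ℝ) < k := by exact_mod_cast h
      have hmono : Real.log k ≤ Real.log ((k + 1 : ℕ) : ℝ) :=
        Real.log_le_log hk0 (by push_cast; linarith)
      refine ⟨?_, by nlinarith⟩
      rcases Nat.lt_or_ge k 2 with h2 | h2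
      · obtain rfl : k = 1 := by omega
        simp
      · have h3 : Real.log ((k + 1 : ℕ) : ℝ) - Real.log k ≤ 1 / k := by
          rw [← Real.log_div (by positivity) hk0.ne']
          refine (Real.log_le_sub_one_of_pos (by positivity)).trans_eq ?_
          push_cast
          field_simp
          ring
        have h4 : (1 : ℝ) ≤ Real.log ((k + 1 : ℕ) : ℝ) := by
          rw [Real.le_log_iff_exp_le (by positivity)]
          have : (3 : ℝ) ≤ ((k + 1 : ℕ) : ℝ) := by exact_mod_cast Nat.succ_le_succ h2
          linarith [Real.exp_one_lt_d9]
        have h5 := mul_le_mul_of_nonneg_left h3 hk0.le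
        rw [mul_one_div_cancel hk0.ne'] at h5
        linarith
  rw [hf, hf, ← sub_div, abs_div, abs_of_pos hn]
  refine div_le_div_of_nonneg_right ?_ hn.le
  push_cast at *
  rw [abs_le]
  constructor <;> linarith [key.1, key.2]

/-- Entropy of the counts `c`, normalised by `n`. -/
def countEntropy (n : ℕ) (c : S → ℕ) : ℝ := entropy fun s => (c s : ℝ) / n

theorem le_of_sum_add_one_eq {n : ℕ} {c : S → ℕ} (hc : ∑ s, c s + 1 = n) (x : S) :
    c x + 1 ≤ n :=
  hc ▸ Nat.succ_le_succ (Finset.single_le_sum (fun _ _ => Nat.zero_le _) (Finset.mem_univ x))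

/-- Since the normaliser n is held fixed, an extra observation changes a single summand of the
entropy. -/
theorem abs_countEntropy_incr_sub_le {n : ℕ} (c : S → ℕ) (x : S) (hc : ∑ s, c s + 1 = n) :
    |countEntropy n (incr c x) - countEntropy n c| ≤ Real.log n / n := by
  refine le_trans (le_of_eq ?_) (abs_negMulLog_step_le (le_of_sum_add_one_eq hc x))
  rw [countEntropy, countEntropy, entropy, entropy, ← Finset.sum_sub_distrib,
    Finset.sum_eq_single x]
  · simp [incr]
  · intro b _ hb
    simp [incr, hb]
  · simp

theorem mean_sum_incr (hp : p ∈ stdSimplex ℝ S) (c : S → ℕ) (F : S → ℕ → ℝ) :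
    mean p (fun x => ∑ s, F s (incr c x s)) =
      ∑ s, (p s * F s (c s + 1) + (1 - p s) * F s (c s)) := by
  simp only [← mean_coordinate hp c _ (F _)]
  simp only [mean, Finset.mul_sum]
  exact Finset.sum_comm

/-- For a function that separates over the symbols, the future expectation reduces to a
one-dimensional binomial recursion per symbol, and a supersolution F bounds it. -/
theorem doob_le_sum (hp : p ∈ stdSimplex ℝ S) (F : ℕ → S → ℕ → ℝ)
    (hF : ∀ k s y, p s * F k s (y + 1) + (1 - p s) * F k s y ≤ F (k + 1) s y) (k : ℕ)
    (c : S → ℕ) : doob p (fun c => ∑ s, F 0 s (c s)) k c ≤ ∑ s, F k s (c s) := by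
  induction k generalizing c with
  | zero => exact le_rfl
  | succ k ih =>
    refine (mean_mono hp fun x => ih _).trans ?_
    rw [mean_sum_incr hp c (F k)]
    exact Finset.sum_le_sum fun s _ => hF k s (c s)

theorem sum_le_doob (hp : p ∈ stdSimplex ℝ S) (F : ℕ → S → ℕ → ℝ)
    (hF : ∀ k s y, F (k + 1) s y ≤ p s * F k s (y + 1) + (1 - p s) * F k s y) (k : ℕ)
    (c : S → ℕ) : ∑ s, F k s (c s) ≤ doob p (fun c => ∑ s, F 0 s (c s)) k c := by
  induction k generalizing c with
  | zero => exact le_rfl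
  | succ k ih =>
    refine le_trans ?_ (mean_mono hp fun x => ih _)
    rw [mean_sum_incr hp c (F k)]
    exact Finset.sum_le_sum fun s _ => hF k s (c s)

theorem le_one_of_mem (hp : p ∈ stdSimplex ℝ S) (s : S) : p s ≤ 1 :=
  hp.2 ▸ Finset.single_le_sum (fun j _ => hp.1 j) (Finset.mem_univ s)

/-- The empirical entropy underestimates the entropy in expectation. -/
theorem doob_countEntropy_le (hp : p ∈ stdSimplex ℝ S) {n : ℕ} (hn : 0 < n) :
    doob p (countEntropy n) n 0 ≤ entropy p := by
  have hn' : (0 : ℝ) < n := by exact_mod_cast hn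
  -- The supersolution replaces the k observations to come by their mean; the recursion inequality
  -- is Jensen's for the concave `negMulLog`.
  have h := doob_le_sum hp (fun k s y => Real.negMulLog ((y + k * p s) / n)) (fun k s y => by
    have h1 : (0 : ℝ) ≤ k * p s := mul_nonneg (Nat.cast_nonneg k) (hp.1 s)
    have h2 := Real.concaveOn_negMulLog.2 (x := (((y + 1 : ℕ) : ℝ) + k * p s) / n)
      (y := ((y : ℝ) + k * p s) / n) (Set.mem_Ici.2 (by positivity)) (Set.mem_Ici.2 (by positivity))
      (hp.1 s) (sub_nonneg.2 (le_one_of_mem hp s)) (by ring)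
    simp only [smul_eq_mul] at h2
    refine h2.trans_eq ?_
    congr 1
    push_cast
    field_simp
    ring) n 0
  have e1 : (fun c : S → ℕ => ∑ s, Real.negMulLog (((c s : ℝ) + (0 : ℕ) * p s) / n)) =
      countEntropy n := by
    funext c
    simp [countEntropy, entropy]
  rw [e1] at h
  refine h.trans_eq ?_
  rw [entropy]
  refine Finset.sum_congr rfl fun s _ => ?_
  congr 1
  simp [mul_div_cancel_left₀ _ hn'.ne']

/-- The bias of the empirical entropy. -/
theorem entropy_sub_le_doob_countEntropy (hp : p ∈ stdSimplex ℝ S) {n : ℕ} (hn : 0 < n) :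
    entropy p - Fintype.card S / n ≤ doob p (countEntropy n) n 0 := by
  have hn' : (0 : ℝ) < n := by exact_mod_cast hn
  -- Coefficients of a quadratic minorant: log (x/p) ≤ x/p - 1 gives -x log x ≥ x(1 - log p) - x²/p,
  -- here with x = y / n.
  let u : S → ℝ := fun s => if 0 < p s then (1 - Real.log (p s)) / n else 0
  let d : S → ℝ := fun s => if 0 < p s then -(1 / (n ^ 2 * p s)) else 0
  -- The exact expectation of the quadratic after k Bernoulli trials, which have mean k p and
  -- variance k p (1 - p). At k = n each symbol with positive p loses (1 - p)/n, hence the bias card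
  -- S / n.
  have h := sum_le_doob hp (fun k s y => u s * (y + k * p s) +
    d s * ((y + k * p s) ^ 2 + k * p s * (1 - p s))) (fun k s y => by
      push_cast
      apply le_of_eq
      ring) n 0
  refine le_trans ?_ (h.trans (doob_mono hp n 0 fun c hc => ?_))
  · rw [entropy, show (Fintype.card S : ℝ) / n = ∑ _s : S, 1 / (n : ℝ) by simp; ring,
      ← Finset.sum_sub_distrib]
    refine Finset.sum_le_sum fun s _ => ?_
    rcases (hp.1 s).eq_or_lt with h0 | h0
    · have : (0 : ℝ) ≤ (n : ℝ)⁻¹ := by positivity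
      simp [u, d, ← h0, this]
    · simp only [u, d, if_pos h0, Real.negMulLog, Pi.zero_apply, Nat.cast_zero, zero_add]
      have : (1 - Real.log (p s)) / n * (n * p s) +
          -(1 / (n ^ 2 * p s)) * ((n * p s) ^ 2 + n * p s * (1 - p s)) =
          -p s * Real.log (p s) - (1 - p s) / n := by
        field_simp
        ring
      rw [this]
      have : (1 - p s) / n ≤ 1 / n := by gcongr; linarith
      linarith
  · rw [countEntropy, entropy]
    refine Finset.sum_le_sum fun s _ => ?_
    simp only [Nat.cast_zero, zero_mul, add_zero]
    have hcs : c s ≤ n := by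
      have := Finset.single_le_sum (fun i _ => Nat.zero_le (c i)) (Finset.mem_univ s)
      simp at hc
      omega
    have hx0 : (0 : ℝ) ≤ (c s : ℝ) / n := by positivity
    have hx1 : (c s : ℝ) / n ≤ 1 := (div_le_one hn').2 (by exact_mod_cast hcs)
    rcases (hp.1 s).eq_or_lt with h0 | h0
    · simp only [u, d, ← h0, lt_irrefl, if_false, zero_mul, add_zero]
      exact Real.negMulLog_nonneg hx0 hx1
    · simp only [u, d, if_pos h0]
      rcases Nat.eq_zero_or_pos (c s) with hz | hpos
      · simp [hz]
      · have hx : (0 : ℝ) < (c s : ℝ) / n := by positivity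
        have h1 := Real.log_le_sub_one_of_pos (div_pos hx h0)
        rw [Real.log_div hx.ne' h0.ne'] at h1
        have h2 := mul_le_mul_of_nonneg_left h1 hx.le
        rw [Real.negMulLog]
        have h3 : (1 - Real.log (p s)) / n * (c s : ℝ) + -(1 / (n ^ 2 * p s)) * (c s : ℝ) ^ 2 =
            (c s : ℝ) / n * (1 - Real.log (p s)) - (c s : ℝ) / n * ((c s : ℝ) / n / p s) := by
          field_simp
          ring
        rw [h3]
        linarith

theorem doob_countEntropy_nonneg (hp : p ∈ stdSimplex ℝ S) {n : ℕ} (hn : 0 < n) :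
    0 ≤ doob p (countEntropy n) n 0 := by
  have h := sum_le_doob hp (fun _ _ _ => 0) (fun _ _ _ => by simp) n 0
  simp only [Finset.sum_const_zero] at h
  refine h.trans (doob_mono hp n 0 fun c hc => ?_)
  refine Finset.sum_nonneg fun s _ => Real.negMulLog_nonneg (by positivity) ?_
  rw [div_le_one (by exact_mod_cast hn)]
  have := Finset.single_le_sum (fun i _ => Nat.zero_le (c i)) (Finset.mem_univ s)
  simp at hc
  exact_mod_cast (by omega : c s ≤ n)

/-- The tilting parameter in the concentration of the empirical entropy. -/
def entropyTilt (β : ℝ) (n : ℕ) : ℝ := √(2 * β * n) / Real.log n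

theorem isCountSupermartingale_expDoob_countEntropy (hp : p ∈ stdSimplex ℝ S) (l β : ℝ) (n : ℕ) :
    IsCountSupermartingale p (expDoob p (countEntropy n) l (Real.log n / n) β n) :=
  isCountSupermartingale_expDoob hp (fun c x hc => abs_countEntropy_incr_sub_le c x hc)
    (div_nonneg (Real.log_natCast_nonneg n) (Nat.cast_nonneg n)) l β

/-- The tilt makes the prepaid cumulant equal to β, so level 2β leaves exp (-β). If log n = 0 the
tilt is 0 by division by zero and the bound still holds. -/
theorem expDoob_entropyTilt_zero_le (p : S → ℝ) {β : ℝ} (hβ : 0 ≤ β) {n : ℕ} (hn : 0 < n) {l : ℝ}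
    (hl : l ^ 2 = entropyTilt β n ^ 2) :
    expDoob p (countEntropy n) l (Real.log n / n) (2 * β) n 0 ≤ Real.exp (-β) := by
  have hn' : (0 : ℝ) < n := by exact_mod_cast hn
  rw [expDoob_zero, Real.exp_le_exp, hl, entropyTilt, div_pow, Real.sq_sqrt (by positivity)]
  rcases eq_or_ne (Real.log n) 0 with h | h
  · simp [h]; linarith
  · apply le_of_eq
    field_simp
    ring

theorem abs_entropy_sub_le [Nonempty S] (hp : p ∈ stdSimplex ℝ S) {β : ℝ} (hβ : 0 < β) {n : ℕ}
    (hn : 0 < n) (c : S → ℕ) (hc : ∑ s, c s = n)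
    (h1 : expDoob p (countEntropy n) (entropyTilt β n) (Real.log n / n) (2 * β) n c < 1)
    (h2 : expDoob p (countEntropy n) (-entropyTilt β n) (Real.log n / n) (2 * β) n c < 1) :
    |countEntropy n c - entropy p| ≤ √(2 * (Real.log n ^ 2 * β) / n) +
      min ((Fintype.card S : ℝ) / n) (Real.log (Fintype.card S)) := by
  have hn' : (0 : ℝ) < n := by exact_mod_cast hn
  have hH := entropy_nonneg hp
  have hHl := entropy_le_log_card hp
  have hcard : (0 : ℝ) < Fintype.card S := by exact_mod_cast Fintype.card_pos
  rcases Nat.lt_or_ge n 2 with hn2 | hn2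
  -- The tilt degenerates at n = 1, but the empirical entropy is then 0 and log (card S) ≤ card S
  -- bounds the error.
  · obtain rfl : n = 1 := by omega
    have h0 : countEntropy 1 c = 0 := by
      refine Finset.sum_eq_zero fun s _ => ?_
      have := Finset.single_le_sum (fun i _ => Nat.zero_le (c i)) (Finset.mem_univ s)
      have h01 : c s = 0 ∨ c s = 1 := by omega
      rcases h01 with h | h <;> simp [h]
    rw [h0, zero_sub, abs_neg, abs_of_nonneg hH]
    simp only [Nat.cast_one, Real.log_one, div_one]
    refine le_add_of_nonneg_of_le (Real.sqrt_nonneg _) (le_min ?_ hHl)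
    exact hHl.trans ((Real.log_le_sub_one_of_pos hcard).trans (by linarith))
  · have hlog : 0 < Real.log n := Real.log_pos (by exact_mod_cast hn2)
    have hb1 := doob_countEntropy_le hp hn
    have hb2 := entropy_sub_le_doob_countEntropy hp hn
    have hb3 := doob_countEntropy_nonneg hp hn
    have hmin : entropy p - doob p (countEntropy n) n 0 ≤
        min ((Fintype.card S : ℝ) / n) (Real.log (Fintype.card S)) :=
      le_min (by linarith) (by linarith)
    have hmin0 : 0 ≤ min ((Fintype.card S : ℝ) / n) (Real.log (Fintype.card S)) :=
      le_min (by positivity) (log_card_nonneg S)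
    have hε : √(2 * (Real.log n ^ 2 * β) / n) = 2 * β / entropyTilt β n := by
      have hpos : 0 < √(2 * β * n) := Real.sqrt_pos.2 (by positivity)
      rw [entropyTilt, Real.sqrt_eq_iff_mul_self_eq (by positivity) (by positivity)]
      have h3 : √(2 * β * n) * √(2 * β * n) = 2 * β * n := Real.mul_self_sqrt (by positivity)
      field_simp
      rw [sq √(2 * β * n), h3]
    have hl : 0 < entropyTilt β n := div_pos (Real.sqrt_pos.2 (by positivity)) hlog
    rw [expDoob, if_pos hc.le, Real.exp_lt_one_iff, hc, Nat.sub_self] at h1 h2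
    simp only [doob, Nat.cast_zero, zero_mul, add_zero] at h1 h2
    have h1' : countEntropy n c - doob p (countEntropy n) n 0 ≤ 2 * β / entropyTilt β n := by
      rw [le_div_iff₀ hl]; linarith
    have h2' : doob p (countEntropy n) n 0 - countEntropy n c ≤ 2 * β / entropyTilt β n := by
      rw [le_div_iff₀ hl]; linarith
    rw [hε, abs_le]
    constructor <;> linarith

end counts

section

variable {S : Type u} {A : Type v} [Fintype S] [DecidableEq S] [Fintype A] [DecidableEq A]
  {H : ℕ} {s₁ : S}

/-! ### Bounds on the value functions -/

theorem log_card_mul_card [Nonempty S] [Nonempty A] :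
    Real.log (Fintype.card S * Fintype.card A) =
      Real.log (Fintype.card S) + Real.log (Fintype.card A) :=
  Real.log_mul (Nat.cast_ne_zero.2 Fintype.card_ne_zero) (Nat.cast_ne_zero.2 Fintype.card_ne_zero)

theorem log_card_mul_card_nonneg (S : Type u) (A : Type v) [Fintype S] [Fintype A] :
    0 ≤ Real.log (Fintype.card S * Fintype.card A) := by
  have := Real.log_natCast_nonneg (Fintype.card S * Fintype.card A)
  rwa [Nat.cast_mul] at this

theorem maxVal_nonneg (S : Type u) (A : Type v) [Fintype S] [Fintype A] (H : ℕ) :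
    0 ≤ maxVal S A H :=
  mul_nonneg (Nat.cast_nonneg _) (log_card_mul_card_nonneg S A)

theorem MDP.backup_nonneg (M : MDP S A H s₁) (h : Fin H) {V : S → ℝ} (hV : ∀ s, 0 ≤ V s) (s : S)
    (a : A) : 0 ≤ M.backup h V s a :=
  add_nonneg (entropy_nonneg (M.p_mem h s a)) (mean_nonneg (M.p_mem h s a) hV)

theorem MDP.backup_le (M : MDP S A H s₁) (h : Fin H) {V : S → ℝ} {c : ℝ} (hV : ∀ s, V s ≤ c) (s : S)
    (a : A) : M.backup h V s a ≤ Real.log (Fintype.card S) + c :=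
  have : Nonempty S := ⟨s⟩
  add_le_add (entropy_le_log_card (M.p_mem h s a)) (mean_le (M.p_mem h s a) hV)

theorem MDP.backup_mono (M : MDP S A H s₁) (h : Fin H) {V W : S → ℝ} (hV : ∀ s, V s ≤ W s) (s : S)
    (a : A) : M.backup h V s a ≤ M.backup h W s a :=
  add_le_add_right (mean_mono (M.p_mem h s a) hV) _

/-- Backward induction on the step. -/
theorem backward_induction {H : ℕ} {P : ℕ → Prop} (last : P H)
    (step : ∀ h : Fin H, P (h.val + 1) → P h.val) {h : ℕ} (hh : h ≤ H) : P h :=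
  Nat.decreasingInduction (motive := fun n _ => P n) (fun k hk ih => step ⟨k, hk⟩ ih) last hh

theorem MDP.optV_mem [Nonempty A] (M : MDP S A H s₁) {h : ℕ} (hh : h ≤ H) :
    ∀ s, 0 ≤ M.optV h s ∧
      M.optV h s ≤ (H - h) * Real.log (Fintype.card S * Fintype.card A) := by
  refine backward_induction (P := fun h => ∀ s, 0 ≤ M.optV h s ∧
      M.optV h s ≤ (H - h) * Real.log (Fintype.card S * Fintype.card A)) ?_ ?_ hh
  · intro s
    rw [M.optV_last]
    simp
  · intro h ih s
    have : Nonempty S := ⟨s⟩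
    rw [M.optV_of_lt]
    refine ⟨(log_card_nonneg A).trans
      (log_card_le_lse fun a => M.backup_nonneg h (fun s => (ih s).1) s a), ?_⟩
    refine (lse_le fun a => M.backup_le h (fun s => (ih s).2) s a).trans_eq ?_
    rw [log_card_mul_card]
    push_cast
    ring

theorem MDP.polV_nonneg (M : MDP S A H s₁) {f : Fin H → S → A → ℝ}
    (hf : ∀ h s, f h s ∈ stdSimplex ℝ A) {h : ℕ} (hh : h ≤ H) : ∀ s, 0 ≤ M.polV f h s := by
  refine backward_induction (P := fun h => ∀ s, 0 ≤ M.polV f h s) ?_ ?_ hh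
  · intro s
    rw [M.polV_last]
  · intro h ih s
    rw [M.polV_of_lt]
    exact add_nonneg (mean_nonneg (hf h s) fun a => M.backup_nonneg h ih s a)
      (entropy_nonneg (hf h s))

theorem MDP.polV_le_optV [Nonempty A] (M : MDP S A H s₁) {f : Fin H → S → A → ℝ}
    (hf : ∀ h s, f h s ∈ stdSimplex ℝ A) {h : ℕ} (hh : h ≤ H) :
    ∀ s, M.polV f h s ≤ M.optV h s := by
  refine backward_induction (P := fun h => ∀ s, M.polV f h s ≤ M.optV h s) ?_ ?_ hh
  · intro s
    rw [M.polV_last, M.optV_last]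
  · intro h ih s
    rw [M.polV_of_lt, M.optV_of_lt]
    refine le_trans ?_ (mean_add_entropy_le_lse (hf h s) _)
    gcongr
    exact mean_mono (hf h s) fun a => M.backup_mono h ih s a

theorem MDP.optV_le_maxVal [Nonempty A] (M : MDP S A H s₁) {h : ℕ} (hh : h ≤ H) (s : S) :
    M.optV h s ≤ maxVal S A H := by
  refine (M.optV_mem hh s).2.trans ?_
  have := log_card_mul_card_nonneg S A
  have h0 : (0 : ℝ) ≤ h := Nat.cast_nonneg h
  rw [maxVal]
  gcongr
  linarith

/-! ### Counts along the interaction -/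

theorem countNext_snoc {t : ℕ} (D : Fin t → Episode S A H) (e : Episode S A H) (h : Fin H) (s : S)
    (a : A) :
    countNext (Fin.snoc D e : Fin (t + 1) → Episode S A H) h s a =
      if e.1 h.castSucc = s ∧ e.2 h = a then incr (countNext D h s a) (e.1 h.succ)
      else countNext D h s a := by
  have h1 : ∀ (i : Fin t), (Fin.snoc D e : Fin (t + 1) → Episode S A H) i.castSucc = D i :=
    fun i => Fin.snoc_castSucc (α := fun _ => Episode S A H) e D i
  have h2 : (Fin.snoc D e : Fin (t + 1) → Episode S A H) (Fin.last t) = e :=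
    Fin.snoc_last (α := fun _ => Episode S A H) e D
  funext s'
  rw [countNext, Finset.card_filter, Fin.sum_univ_castSucc]
  simp only [h1, h2]
  rw [← Finset.card_filter, ← countNext]
  by_cases hc : e.1 h.castSucc = s ∧ e.2 h = a
  · by_cases h3 : s' = e.1 h.succ
    · simp [incr, hc.1, hc.2, h3]
    · simp [incr, hc.1, hc.2, h3, Ne.symm h3]
  · rw [if_neg hc, if_neg fun h3 => hc ⟨h3.1, h3.2.1⟩, add_zero]

theorem sum_countNext {t : ℕ} (D : Fin t → Episode S A H) (h : Fin H) (s : S) (a : A) :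
    ∑ s', countNext D h s a s' = count D h s a := by
  simp only [countNext, count, Finset.card_filter]
  rw [Finset.sum_comm]
  refine Finset.sum_congr rfl fun i _ => ?_
  simp only [← and_assoc, ite_and]
  simp

theorem countNext_empty (D : Fin 0 → Episode S A H) (h : Fin H) (s : S) (a : A) :
    countNext D h s a = 0 := by
  funext s'
  simp [countNext]

theorem pHat_eq {t : ℕ} {D : Fin t → Episode S A H} {h : Fin H} {s : S} {a : A}
    (hn : count D h s a ≠ 0) :
    pHat D h s a = fun s' => (countNext D h s a s' : ℝ) / count D h s a := by
  funext s'
  rw [pHat, if_neg hn]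

theorem pHat_mem {t : ℕ} (D : Fin t → Episode S A H) (h : Fin H) (s : S) (a : A) :
    pHat D h s a ∈ stdSimplex ℝ S := by
  by_cases hn : count D h s a = 0
  · have : Nonempty S := ⟨s⟩
    have h1 : pHat D h s a = fun _ => 1 / (Fintype.card S : ℝ) := by
      funext s'
      rw [pHat, if_pos hn]
    rw [h1]
    exact ⟨fun _ => by positivity, by simp⟩
  · rw [pHat_eq hn]
    refine ⟨fun _ => by positivity, ?_⟩
    rw [← Finset.sum_div, ← sum_countNext]
    push_cast
    rw [div_self]
    rw [← sum_countNext] at hn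
    exact_mod_cast hn

theorem optimistic_mem [Nonempty A] {t : ℕ} (D : Fin t → Episode S A H) (δ : ℝ) (h : Fin H) (s : S) :
    optimistic D δ h s ∈ stdSimplex ℝ A := gibbs_mem _

theorem optimisticPolicy_eq [Nonempty A] (δ : ℝ) (t : ℕ) (D : Fin t → Episode S A H) :
    optimisticPolicy δ t D = Policy.markov (optimistic D δ) (optimistic_mem D δ) := rfl

/-- Expected number of visits of `(s, a)` at step `h` given the policies that were played. -/
def cumOcc [Nonempty A] (M : MDP S A H s₁) (δ : ℝ) (t : ℕ) (D : Fin t → Episode S A H) (h : Fin H)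
    (s : S) (a : A) : ℝ :=
  ∑ i : Fin t, M.occ (optimisticPolicy δ i fun j => D ⟨j, j.2.trans i.2⟩) h s a

theorem cumOcc_snoc [Nonempty A] (M : MDP S A H s₁) (δ : ℝ) (t : ℕ) (D : Fin t → Episode S A H)
    (e : Episode S A H) (h : Fin H) (s : S) (a : A) :
    cumOcc M δ (t + 1) (Fin.snoc D e) h s a =
      cumOcc M δ t D h s a + M.occ (optimisticPolicy δ t D) h s a := by
  have h1 : ∀ (i : Fin t), (Fin.snoc D e : Fin (t + 1) → Episode S A H) i.castSucc = D i :=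
    fun i => Fin.snoc_castSucc (α := fun _ => Episode S A H) e D i
  rw [cumOcc, Fin.sum_univ_castSucc]
  congr 1
  · refine Finset.sum_congr rfl fun i _ => ?_
    congr 2
    funext j
    exact h1 ⟨j, j.2.trans i.2⟩
  · congr 2
    funext j
    exact h1 j

/-- Nonnegative supermartingales along the interaction of UCBVI-Ent with `M`. -/
structure IsSupermartingale [Nonempty A] (M : MDP S A H s₁) (δ : ℝ)
    (F : (t : ℕ) → (Fin t → Episode S A H) → ℝ) : Prop where
  nonneg : ∀ t D, 0 ≤ F t D
  step : ∀ t D, M.expect (optimisticPolicy δ t D) (fun e => F (t + 1) (Fin.snoc D e)) ≤ F t D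

theorem IsSupermartingale.add [Nonempty A] {M : MDP S A H s₁} {δ : ℝ}
    {F G : (t : ℕ) → (Fin t → Episode S A H) → ℝ} (hF : IsSupermartingale M δ F)
    (hG : IsSupermartingale M δ G) : IsSupermartingale M δ (fun t D => F t D + G t D) where
  nonneg t D := add_nonneg (hF.nonneg t D) (hG.nonneg t D)
  step t D := by
    rw [MDP.expect, mean_add]
    exact add_le_add (hF.step t D) (hG.step t D)

theorem mean_sum {ι κ : Type*} [Fintype ι] (p : ι → ℝ) (s : Finset κ) (F : κ → ι → ℝ) :
    mean p (fun i => ∑ k ∈ s, F k i) = ∑ k ∈ s, mean p (F k) := by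
  simp only [mean, Finset.mul_sum]
  exact Finset.sum_comm

theorem IsSupermartingale.sum [Nonempty A] {M : MDP S A H s₁} {δ : ℝ} {κ : Type*} (s : Finset κ)
    {F : κ → (t : ℕ) → (Fin t → Episode S A H) → ℝ} (hF : ∀ k ∈ s, IsSupermartingale M δ (F k)) :
    IsSupermartingale M δ (fun t D => ∑ k ∈ s, F k t D) where
  nonneg t D := Finset.sum_nonneg fun k hk => (hF k hk).nonneg t D
  step t D := by
    rw [MDP.expect, mean_sum]
    exact Finset.sum_le_sum fun k hk => (hF k hk).step t D

/-- An episode leaves the counts of (h, s, a) unchanged or adds one draw from `M.p h s a`, so i.i.d.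
supermartingales carry over to adaptively chosen visits. -/
theorem IsCountSupermartingale.isSupermartingale [Nonempty A] (M : MDP S A H s₁) (δ : ℝ)
    {h : Fin H} {s : S} {a : A} {g : (S → ℕ) → ℝ} (hg : IsCountSupermartingale (M.p h s a) g) :
    IsSupermartingale M δ (fun _ D => g (countNext D h s a)) where
  nonneg _ _ := hg.nonneg _
  step t D := by
    have h1 : (fun e : Episode S A H => g (countNext (Fin.snoc D e : Fin (t + 1) → _) h s a)) =
        fun e => if e.1 h.castSucc = s ∧ e.2 h = a then
          (fun x => g (incr (countNext D h s a) x)) (e.1 h.succ) else g (countNext D h s a) := by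
      funext e
      rw [countNext_snoc]
      split_ifs <;> rfl
    rw [h1]
    refine (M.expect_visit_next (optimistic D δ) (optimistic_mem D δ)
      (fun x => g (incr (countNext D h s a) x)) _ h s a).trans_le ?_
    have h2 := M.occ_nonneg (optimistic D δ) (fun _ _ => gibbs_mem _) h s a
    have h3 := hg.step (countNext D h s a)
    nlinarith

/-- If the visit has probability q, the factor exp (-1_visit) has mean 1 - q(1 - 1/e) ≤ 1 - q/2 ≤
exp (-q/2), which the growth of `cumOcc / 2` compensates. -/
theorem isSupermartingale_visits [Nonempty A] (M : MDP S A H s₁) (δ : ℝ) {d : ℝ} (hd : 0 ≤ d)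
    (h : Fin H) (s : S) (a : A) :
    IsSupermartingale M δ (fun t D =>
      d * Real.exp (cumOcc M δ t D h s a / 2 - count D h s a)) where
  nonneg _ _ := by positivity
  step t D := by
    set q := M.occ (optimisticPolicy δ t D) h s a with hq
    set c := d * Real.exp (cumOcc M δ t D h s a / 2 - count D h s a) with hc
    have hc0 : 0 ≤ c := by positivity
    have h1 : (fun e : Episode S A H => d * Real.exp (cumOcc M δ (t + 1) (Fin.snoc D e) h s a / 2 -
        count (Fin.snoc D e : Fin (t + 1) → Episode S A H) h s a)) =
        fun e => if e.1 h.castSucc = s ∧ e.2 h = a then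
          (fun _ => c * Real.exp (q / 2) * Real.exp (-1)) (e.1 h.succ)
          else c * Real.exp (q / 2) := by
      funext e
      rw [cumOcc_snoc, ← hq, ← sum_countNext, countNext_snoc]
      split_ifs
      · rw [sum_incr, sum_countNext, hc, mul_assoc, mul_assoc, ← Real.exp_add, ← Real.exp_add]
        congr 2
        push_cast
        ring
      · rw [sum_countNext, hc, mul_assoc, ← Real.exp_add]
        congr 2
        ring
    rw [h1]
    refine (M.expect_visit_next (optimistic D δ) (optimistic_mem D δ)
      (fun _ => c * Real.exp (q / 2) * Real.exp (-1)) _ h s a).trans_le ?_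
    rw [mean_const (M.p_mem h s a)]
    have hq0 : 0 ≤ q := M.occ_nonneg (optimistic D δ) (fun _ _ => gibbs_mem _) h s a
    rw [← optimisticPolicy_eq, ← hq]
    have he : Real.exp (-1) ≤ 1 / 2 := by
      rw [Real.exp_neg, ← one_div]
      exact one_div_le_one_div_of_le two_pos (by
        have := Real.add_one_le_exp 1
        linarith)
    have h2 : 1 - q / 2 ≤ Real.exp (-(q / 2)) := by
      have := Real.add_one_le_exp (-(q / 2))
      linarith
    have hE : 0 ≤ c * Real.exp (q / 2) := by positivity
    calc q * (c * Real.exp (q / 2) * Real.exp (-1)) + (1 - q) * (c * Real.exp (q / 2))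
        = c * Real.exp (q / 2) * (1 - q * (1 - Real.exp (-1))) := by ring
      _ ≤ c * Real.exp (q / 2) * Real.exp (-(q / 2)) := by
          refine mul_le_mul_of_nonneg_left (le_trans ?_ h2) hE
          nlinarith
      _ = c := by rw [mul_assoc, ← Real.exp_add]; simp

end

section

variable {S : Type u} {A : Type v} [Fintype S] [DecidableEq S] [Fintype A] [DecidableEq A]
  {H : ℕ} {s₁ : S}

/-! ### The concentration event -/

/-- The event on which the estimates of UCBVI-Ent are accurate. -/
structure IsGood [Nonempty A] (M : MDP S A H s₁) (δ : ℝ) (t : ℕ) (D : Fin t → Episode S A H) :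
    Prop where
  hel_le : ∀ h s a, count D h s a ≠ 0 → hel (pHat D h s a) (M.p h s a) ≤ rateKL D δ h s a
  abs_mean_sub_le : ∀ h s a, count D h s a ≠ 0 →
    |mean (pHat D h s a) (M.optV (h.val + 1)) - mean (M.p h s a) (M.optV (h.val + 1))| ≤
      √(2 * variance (M.p h s a) (M.optV (h.val + 1)) * rateConc D δ h s a) +
        maxVal S A H * rateConc D δ h s a
  abs_entropy_sub_le : ∀ h s a, count D h s a ≠ 0 →
    |entropy (pHat D h s a) - entropy (M.p h s a)| ≤ bonusEnt D δ h s a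
  cumOcc_le : ∀ h s a, cumOcc M δ t D h s a / 2 ≤
    count D h s a + Real.log (16 * Fintype.card S * Fintype.card A * H / δ)

/-- The confidence parameter of a single triple `(h, s, a)`. -/
def pairDelta (S : Type u) (A : Type v) [Fintype S] [Fintype A] (H : ℕ) (δ : ℝ) : ℝ :=
  δ / (4 * Fintype.card S * Fintype.card A * H)

/-- `β^ℋ(δ, n)` without the factor `log² n`. -/
def betaEntLevel (S A H : ℕ) (δ : ℝ) (n : ℕ) : ℝ :=
  Real.log (4 * S * A * H / δ) + Real.log (n * (n + 1))

section pair

variable [Nonempty A] (M : MDP S A H s₁) (δ : ℝ) (h : Fin H) (s : S) (a : A)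

/-- A positive bound on the optimal value function. -/
def valueRange (S : Type u) (A : Type v) [Fintype S] [Fintype A] (H : ℕ) : ℝ :=
  -- `maxVal` vanishes when SA = 1, whereas the Bernstein tilt needs a positive range.
  if maxVal S A H = 0 then 1 else maxVal S A H

/-- The centred optimal value of the next state. -/
def MDP.centredV (s' : S) : ℝ := M.optV (h.val + 1) s' - mean (M.p h s a) (M.optV (h.val + 1))

/-- The supermartingales for the deviation of the mean value after `n` visits. -/
def valueFailure (n : ℕ) (c : S → ℕ) : ℝ :=
  let v := mean (M.p h s a) fun s' => M.centredV h s a s' ^ 2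
  let β := betaConc (Fintype.card S) (Fintype.card A) H δ n
  let b := valueRange S A H
  expSum (M.centredV h s a) (bernsteinTilt v b β n) (bernsteinRate v b β n) β n c +
    expSum (fun s' => -M.centredV h s a s') (bernsteinTilt v b β n) (bernsteinRate v b β n) β n c

/-- The supermartingales for the deviation of the entropy after `n` visits. -/
def entropyFailure (n : ℕ) (c : S → ℕ) : ℝ :=
  let β := betaEntLevel (Fintype.card S) (Fintype.card A) H δ n
  expDoob (M.p h s a) (countEntropy n) (entropyTilt β n) (Real.log n / n) (2 * β) n c +
    expDoob (M.p h s a) (countEntropy n) (-entropyTilt β n) (Real.log n / n) (2 * β) n c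

/-- The supermartingale for all deviations at `(h, s, a)` within the first `T` visits. -/
def pairFailure (T : ℕ) (c : S → ℕ) : ℝ :=
  likelihoodRatio (M.p h s a) (pairDelta S A H δ) c +
    -- These supermartingales are tuned to a number n of visits, so n is summed over; the mixture
    -- ratio above is already uniform in n. Cutting at T keeps the sum finite, and its initial value
    -- is bounded independently of T.
    ∑ n ∈ Finset.Icc 1 T, (valueFailure M δ h s a n c + entropyFailure M δ h s a n c)

end pair

theorem IsCountSupermartingale.add {p : S → ℝ} {g g' : (S → ℕ) → ℝ}
    (hg : IsCountSupermartingale p g) (hg' : IsCountSupermartingale p g') :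
    IsCountSupermartingale p fun c => g c + g' c where
  nonneg c := add_nonneg (hg.nonneg c) (hg'.nonneg c)
  step c := by
    rw [mean_add]
    exact add_le_add (hg.step c) (hg'.step c)

theorem IsCountSupermartingale.sum {p : S → ℝ} {κ : Type*} (s : Finset κ) {g : κ → (S → ℕ) → ℝ}
    (hg : ∀ k ∈ s, IsCountSupermartingale p (g k)) :
    IsCountSupermartingale p fun c => ∑ k ∈ s, g k c where
  nonneg c := Finset.sum_nonneg fun k hk => (hg k hk).nonneg c
  step c := by
    rw [mean_sum]
    exact Finset.sum_le_sum fun k hk => (hg k hk).step c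

theorem valueRange_pos (S : Type u) (A : Type v) [Fintype S] [Fintype A] (H : ℕ) :
    0 < valueRange S A H := by
  rw [valueRange]
  split_ifs with h
  · exact one_pos
  · exact lt_of_le_of_ne (maxVal_nonneg S A H) (Ne.symm h)

section pair

variable [Nonempty A] (M : MDP S A H s₁) {δ : ℝ} (hδ : 0 < δ) (hδ1 : δ < 1) (h : Fin H) (s : S)
  (a : A)

theorem mean_centredV : mean (M.p h s a) (M.centredV h s a) = 0 := by
  unfold MDP.centredV
  rw [mean_sub, mean_const (M.p_mem h s a), sub_self]

theorem mean_centredV_sq : mean (M.p h s a) (fun s' => M.centredV h s a s' ^ 2) =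
    variance (M.p h s a) (M.optV (h.val + 1)) := rfl

theorem abs_centredV_le (s' : S) : |M.centredV h s a s'| ≤ valueRange S A H := by
  have h1 : ∀ s, 0 ≤ M.optV (h.val + 1) s := fun s => (M.optV_mem h.isLt s).1
  have h2 : ∀ s, M.optV (h.val + 1) s ≤ maxVal S A H := M.optV_le_maxVal h.isLt
  have h3 : maxVal S A H ≤ valueRange S A H := by
    rw [valueRange]
    split_ifs with h
    · rw [h]; exact zero_le_one
    · exact le_rfl
  have h4 := mean_nonneg (M.p_mem h s a) h1
  have h5 := mean_le (M.p_mem h s a) h2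
  have h6 := h1 s'
  have h7 := h2 s'
  rw [MDP.centredV, abs_le]
  constructor <;> linarith

theorem log_pos_of_delta (h : Fin H) (s : S) (hδ : 0 < δ) (hδ1 : δ < 1) :
    0 < Real.log (4 * Fintype.card S * Fintype.card A * H / δ) := by
  have h1 : 1 ≤ Fintype.card S := Fintype.card_pos_iff.2 ⟨s⟩
  have h2 : 1 ≤ Fintype.card A := Fintype.card_pos
  have h3 : 1 ≤ H := h.pos
  have h4 : (1 : ℝ) ≤ ((4 * Fintype.card S * Fintype.card A * H : ℕ) : ℝ) := by
    exact_mod_cast Nat.one_le_iff_ne_zero.2 (by positivity)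
  refine Real.log_pos ((one_lt_div hδ).2 (hδ1.trans_le ?_))
  push_cast at h4
  exact h4

theorem pairDelta_pos (h : Fin H) (s : S) (hδ : 0 < δ) : 0 < pairDelta S A H δ := by
  have h1 : 0 < Fintype.card S := Fintype.card_pos_iff.2 ⟨s⟩
  have h2 : 0 < Fintype.card A := Fintype.card_pos
  have h3 : 0 < H := h.pos
  rw [pairDelta]
  positivity

theorem one_div_pairDelta :
    1 / pairDelta S A H δ = 4 * Fintype.card S * Fintype.card A * H / δ := by
  rw [pairDelta, one_div_div]

theorem exp_neg_log (h : Fin H) (s : S) (hδ : 0 < δ) :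
    Real.exp (-Real.log (4 * Fintype.card S * Fintype.card A * H / δ)) = pairDelta S A H δ := by
  rw [← one_div_pairDelta, Real.exp_neg, Real.exp_log (by
    have := pairDelta_pos (A := A) h s hδ
    positivity), one_div, inv_inv]

theorem betaConc_pos (h : Fin H) (s : S) (hδ : 0 < δ) (hδ1 : δ < 1) {n : ℕ} (hn : 0 < n) :
    0 < betaConc (Fintype.card S) (Fintype.card A) H δ n := by
  have h1 := log_pos_of_delta (A := A) h s hδ hδ1
  have hn1 : (1 : ℝ) ≤ n := by exact_mod_cast hn
  have h2 : 0 ≤ Real.log (4 * Real.exp 1 * n * (2 * n + 1)) := Real.log_nonneg (by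
    have := Real.add_one_le_exp 1
    exact one_le_mul_of_one_le_of_one_le
      (one_le_mul_of_one_le_of_one_le (by linarith) hn1) (by linarith))
  exact add_pos_of_pos_of_nonneg h1 h2

theorem betaEntLevel_pos (h : Fin H) (s : S) (hδ : 0 < δ) (hδ1 : δ < 1) {n : ℕ} (hn : 0 < n) :
    0 < betaEntLevel (Fintype.card S) (Fintype.card A) H δ n := by
  have h1 := log_pos_of_delta (A := A) h s hδ hδ1
  have hn1 : (1 : ℝ) ≤ n := by exact_mod_cast hn
  have h2 : 0 ≤ Real.log ((n : ℝ) * (n + 1)) := Real.log_nonneg (by nlinarith)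
  exact add_pos_of_pos_of_nonneg h1 h2

theorem isCountSupermartingale_valueFailure (hδ : 0 < δ) (hδ1 : δ < 1) {n : ℕ} (hn : 0 < n) :
    IsCountSupermartingale (M.p h s a) (valueFailure M δ h s a n) := by
  have hβ := betaConc_pos (A := A) h s hδ hδ1 hn
  have hb := valueRange_pos S A H
  refine .add (isCountSupermartingale_expSum (mean_exp_bernsteinTilt_le (M.p_mem h s a) hb hβ hn
    (abs_centredV_le M h s a) (mean_centredV M h s a)) _ _)
    (isCountSupermartingale_expSum ?_ _ _)
  have := mean_exp_bernsteinTilt_le (Y := fun s' => -M.centredV h s a s') (M.p_mem h s a) hb hβ hn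
    (fun s' => by rw [abs_neg]; exact abs_centredV_le M h s a s')
    (by
      have := mean_centredV M h s a
      simp only [mean, mul_neg, Finset.sum_neg_distrib] at this ⊢
      rw [this, neg_zero])
  simpa only [neg_sq] using this

theorem isCountSupermartingale_pairFailure (hδ : 0 < δ) (hδ1 : δ < 1) (T : ℕ) :
    IsCountSupermartingale (M.p h s a) (pairFailure M δ h s a T) :=
  .add (isCountSupermartingale_likelihoodRatio (M.p_mem h s a) (pairDelta_pos h s hδ).le)
    (.sum _ fun _ hn => .add
      (isCountSupermartingale_valueFailure M h s a hδ hδ1 (Finset.mem_Icc.1 hn).1)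
      (.add (isCountSupermartingale_expDoob_countEntropy (M.p_mem h s a) _ _ _)
        (isCountSupermartingale_expDoob_countEntropy (M.p_mem h s a) _ _ _)))

theorem sum_one_div_mul_succ_le (T : ℕ) : ∑ n ∈ Finset.Icc 1 T, 1 / ((n : ℝ) * (n + 1)) ≤ 1 := by
  have : ∑ n ∈ Finset.Icc 1 T, 1 / ((n : ℝ) * (n + 1)) = 1 - 1 / (T + 1) := by
    induction T with
    | zero => simp
    | succ T ih =>
      rw [Finset.sum_Icc_succ_top (by omega), ih]
      push_cast
      field_simp
      ring
  rw [this]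
  have : (0 : ℝ) ≤ 1 / ((T : ℝ) + 1) := by positivity
  linarith

/-- Budget in units of `pairDelta`: 1 for the likelihood ratio, and per n the weight 1/(n(n + 1))
times 1/4 for the two Bernstein tails and 2 for the two entropy tails. The weights sum to at most 1.
-/
theorem pairFailure_zero_le (hδ : 0 < δ) (hδ1 : δ < 1) (T : ℕ) :
    pairFailure M δ h s a T 0 ≤ (13 / 4) * pairDelta S A H δ := by
  have hd := pairDelta_pos (A := A) h s hδ
  have h1 : likelihoodRatio (M.p h s a) (pairDelta S A H δ) 0 = pairDelta S A H δ := by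
    simp [likelihoodRatio, mixtureProb_zero]
  have h2 : ∀ n ∈ Finset.Icc 1 T, valueFailure M δ h s a n 0 + entropyFailure M δ h s a n 0 ≤
      (9 / 4) * pairDelta S A H δ * (1 / ((n : ℝ) * (n + 1))) := by
    intro n hn
    have hn0 : 0 < n := (Finset.mem_Icc.1 hn).1
    have hn' : (0 : ℝ) < n := by exact_mod_cast hn0
    have hv : valueFailure M δ h s a n 0 ≤ pairDelta S A H δ * (1 / ((n : ℝ) * (n + 1))) / 4 := by
      rw [valueFailure, expSum_zero, expSum_zero, betaConc, neg_add, Real.exp_add,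
        exp_neg_log h s hδ, Real.exp_neg, Real.exp_log (by positivity)]
      have h3 : (4 * Real.exp 1 * n * (2 * n + 1))⁻¹ ≤ 1 / ((n : ℝ) * (n + 1)) / 8 := by
        rw [div_div, ← one_div]
        apply one_div_le_one_div_of_le (by positivity)
        have := Real.add_one_le_exp 1
        have h4 : (n : ℝ) * (n + 1) ≤ n * (2 * n + 1) := by nlinarith
        have h5 : (8 : ℝ) ≤ 4 * Real.exp 1 := by linarith
        calc (n : ℝ) * (n + 1) * 8 ≤ n * (2 * n + 1) * (4 * Real.exp 1) := by gcongr
          _ = _ := by ring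
      have := mul_le_mul_of_nonneg_left h3 hd.le
      linarith
    have he : entropyFailure M δ h s a n 0 ≤ 2 * (pairDelta S A H δ * (1 / ((n : ℝ) * (n + 1)))) := by
      have hβ := betaEntLevel_pos (A := A) h s hδ hδ1 hn0
      have h3 := expDoob_entropyTilt_zero_le (M.p h s a) hβ.le hn0 rfl
      have h4 := expDoob_entropyTilt_zero_le (M.p h s a) hβ.le hn0
        (neg_sq (entropyTilt (betaEntLevel (Fintype.card S) (Fintype.card A) H δ n) n))
      have h5 : Real.exp (-betaEntLevel (Fintype.card S) (Fintype.card A) H δ n) =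
          pairDelta S A H δ * (1 / ((n : ℝ) * (n + 1))) := by
        rw [betaEntLevel, neg_add, Real.exp_add, exp_neg_log h s hδ, Real.exp_neg,
          Real.exp_log (by positivity), one_div]
      rw [h5] at h3 h4
      rw [entropyFailure]
      linarith
    linarith
  rw [pairFailure, h1]
  have h3 := Finset.sum_le_sum h2
  rw [← Finset.mul_sum] at h3
  have h4 := mul_le_mul_of_nonneg_left (sum_one_div_mul_succ_le T)
    (by positivity : 0 ≤ (9 / 4) * pairDelta S A H δ)
  linarith

end pair

/-- The supermartingale for all deviations within the first `T` episodes. -/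
def totalFailure [Nonempty A] (M : MDP S A H s₁) (δ : ℝ) (T t : ℕ) (D : Fin t → Episode S A H) : ℝ :=
  ∑ x : Fin H × S × A, (pairFailure M δ x.1 x.2.1 x.2.2 T (countNext D x.1 x.2.1 x.2.2) +
    pairDelta S A H δ / 4 *
      Real.exp (cumOcc M δ t D x.1 x.2.1 x.2.2 / 2 - count D x.1 x.2.1 x.2.2))

section good

variable [Nonempty A] (M : MDP S A H s₁) {δ : ℝ}

theorem isSupermartingale_totalFailure (hδ : 0 < δ) (hδ1 : δ < 1) (T : ℕ) :
    IsSupermartingale M δ (totalFailure M δ T) :=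
  .sum _ fun x _ => .add
    ((isCountSupermartingale_pairFailure M x.1 x.2.1 x.2.2 hδ hδ1 T).isSupermartingale M δ)
    (isSupermartingale_visits M δ
      (div_nonneg (pairDelta_pos x.1 x.2.1 hδ).le (by norm_num)) x.1 x.2.1 x.2.2)

/-- Each triple costs at most 13/4 + 1/4 ≤ 4 times `pairDelta`, and there are S A H triples. -/
theorem totalFailure_zero_le (hH : 1 ≤ H) (hδ : 0 < δ) (hδ1 : δ < 1) (T : ℕ)
    (D : Fin 0 → Episode S A H) : totalFailure M δ T 0 D ≤ δ := by
  have h1 : ∀ x : Fin H × S × A, pairFailure M δ x.1 x.2.1 x.2.2 T (countNext D x.1 x.2.1 x.2.2) +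
      pairDelta S A H δ / 4 * Real.exp (cumOcc M δ 0 D x.1 x.2.1 x.2.2 / 2 -
        count D x.1 x.2.1 x.2.2) ≤ 4 * pairDelta S A H δ := by
    intro x
    have h2 := pairFailure_zero_le M x.1 x.2.1 x.2.2 hδ hδ1 T
    have h3 := pairDelta_pos (A := A) x.1 x.2.1 hδ
    rw [countNext_empty]
    have h4 : cumOcc M δ 0 D x.1 x.2.1 x.2.2 / 2 - count D x.1 x.2.1 x.2.2 = 0 := by
      simp [cumOcc, count]
    rw [h4, Real.exp_zero]
    linarith
  refine (Finset.sum_le_sum fun x _ => h1 x).trans_eq ?_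
  have h3 : (0 : ℝ) < Fintype.card S := Nat.cast_pos.2 (Fintype.card_pos_iff.2 ⟨s₁⟩)
  have h4 : (0 : ℝ) < Fintype.card A := Nat.cast_pos.2 Fintype.card_pos
  have h5 : (0 : ℝ) < H := Nat.cast_pos.2 hH
  simp only [Finset.sum_const, Finset.card_univ, Fintype.card_prod, Fintype.card_fin, nsmul_eq_mul,
    pairDelta]
  push_cast
  field_simp

theorem count_le {t : ℕ} (D : Fin t → Episode S A H) (h : Fin H) (s : S) (a : A) :
    count D h s a ≤ t :=
  (Finset.card_le_univ _).trans_eq (Fintype.card_fin t)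

/-- Absorbs the bias card S / n of the empirical entropy into the term that `bonusEnt` contains. -/
theorem le_rateKL_of_le {t : ℕ} {D : Fin t → Episode S A H} (hδ : 0 < δ) (hδ1 : δ < 1) (h : Fin H)
    (s : S) (a : A) :
    (Fintype.card S : ℝ) / count D h s a ≤ rateKL D δ h s a := by
  refine div_le_div_of_nonneg_right ?_ (Nat.cast_nonneg _)
  rw [betaKL]
  have h1 := log_pos_of_delta (A := A) h s hδ hδ1
  have h2 : (1 : ℝ) ≤ Real.log (Real.exp 1 * (1 + count D h s a)) := by
    rw [Real.log_mul (Real.exp_pos 1).ne' (by positivity), Real.log_exp]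
    have : 0 ≤ Real.log (1 + (count D h s a : ℝ)) := Real.log_nonneg (by
      linarith [(Nat.cast_nonneg _ : (0 : ℝ) ≤ count D h s a)])
    linarith
  have h3 := mul_le_mul_of_nonneg_left h2 (Nat.cast_nonneg (Fintype.card S) : (0 : ℝ) ≤ _)
  linarith

/-- A sum of nonnegative terms below 1 has every term below 1, and a positive number of visits,
being at most t ≤ T, indexes one of the summands. -/
theorem isGood_of_totalFailure_lt {t T : ℕ} (D : Fin t → Episode S A H) (hδ : 0 < δ) (hδ1 : δ < 1)
    (ht : t ≤ T) (hF : totalFailure M δ T t D < 1) : IsGood M δ t D := by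
  have hpair : ∀ h s a, pairFailure M δ h s a T (countNext D h s a) < 1 ∧
      pairDelta S A H δ / 4 * Real.exp (cumOcc M δ t D h s a / 2 - count D h s a) < 1 := by
    intro h s a
    have hnn : ∀ x : Fin H × S × A,
        0 ≤ pairFailure M δ x.1 x.2.1 x.2.2 T (countNext D x.1 x.2.1 x.2.2) ∧
        0 ≤ pairDelta S A H δ / 4 *
          Real.exp (cumOcc M δ t D x.1 x.2.1 x.2.2 / 2 - count D x.1 x.2.1 x.2.2) := fun x =>
      ⟨(isCountSupermartingale_pairFailure M x.1 x.2.1 x.2.2 hδ hδ1 T).nonneg _,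
        mul_nonneg (div_nonneg (pairDelta_pos x.1 x.2.1 hδ).le (by norm_num)) (Real.exp_pos _).le⟩
    have h1 := (Finset.single_le_sum (fun x _ => add_nonneg (hnn x).1 (hnn x).2)
      (Finset.mem_univ ((h, s, a) : Fin H × S × A))).trans_lt hF
    have h2 := hnn (h, s, a)
    constructor <;> linarith [h2.1, h2.2]
  have hparts : ∀ h s a, likelihoodRatio (M.p h s a) (pairDelta S A H δ) (countNext D h s a) < 1 ∧
      (count D h s a ≠ 0 → valueFailure M δ h s a (count D h s a) (countNext D h s a) < 1 ∧
        entropyFailure M δ h s a (count D h s a) (countNext D h s a) < 1) := by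
    intro h s a
    have h1 := (hpair h s a).1
    rw [pairFailure] at h1
    have hl := (isCountSupermartingale_likelihoodRatio (M.p_mem h s a)
      (pairDelta_pos (A := A) h s hδ).le).nonneg (countNext D h s a)
    have hv : ∀ n ∈ Finset.Icc 1 T, 0 ≤ valueFailure M δ h s a n (countNext D h s a) := fun n hn =>
      (isCountSupermartingale_valueFailure M h s a hδ hδ1 (Finset.mem_Icc.1 hn).1).nonneg _
    have he : ∀ n, 0 ≤ entropyFailure M δ h s a n (countNext D h s a) := fun n =>
      add_nonneg ((isCountSupermartingale_expDoob_countEntropy (M.p_mem h s a) _ _ _).nonneg _)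
        ((isCountSupermartingale_expDoob_countEntropy (M.p_mem h s a) _ _ _).nonneg _)
    refine ⟨lt_of_le_of_lt (le_add_of_nonneg_right
      (Finset.sum_nonneg fun n hn => add_nonneg (hv n hn) (he n))) h1, fun h0 => ?_⟩
    have hmem : count D h s a ∈ Finset.Icc 1 T :=
      Finset.mem_Icc.2 ⟨Nat.one_le_iff_ne_zero.2 h0, (count_le D h s a).trans ht⟩
    have h2 := Finset.single_le_sum (fun n hn => add_nonneg (hv n hn) (he n)) hmem
    have h3 := hv _ hmem
    have h4 := he (count D h s a)
    constructor <;> linarith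
  refine ⟨fun h s a h0 => ?_, fun h s a h0 => ?_, fun h s a h0 => ?_, fun h s a => ?_⟩
  · have h1 := hel_le_of_likelihoodRatio_lt (M.p_mem h s a) (pairDelta_pos (A := A) h s hδ)
      (countNext D h s a) (sum_countNext D h s a) (Nat.pos_of_ne_zero h0) (hparts h s a).1
    rw [one_div_pairDelta] at h1
    rw [pHat_eq h0]
    exact h1
  · have hn := Nat.pos_of_ne_zero h0
    have hβ := betaConc_pos (A := A) h s hδ hδ1 hn
    have hb := valueRange_pos S A H
    have h1 := ((hparts h s a).2 h0).1
    rw [valueFailure] at h1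
    have hnn : ∀ (Y : S → ℝ) (l ψ β : ℝ) (n : ℕ) (c : S → ℕ), 0 ≤ expSum Y l ψ β n c := by
      intro Y l ψ β n c
      rw [expSum]; split_ifs <;> positivity
    have h2 := lt_of_expSum_lt_one hb hβ hn _ (sum_countNext D h s a)
      (lt_of_le_of_lt (le_add_of_nonneg_right (hnn _ _ _ _ _ _)) h1)
    have h3 := lt_of_expSum_lt_one hb hβ hn _ (sum_countNext D h s a)
      (lt_of_le_of_lt (le_add_of_nonneg_left (hnn _ _ _ _ _ _)) h1)
    have h4 : ∑ s', (countNext D h s a s' : ℝ) / count D h s a * M.centredV h s a s' =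
        mean (pHat D h s a) (M.optV (h.val + 1)) - mean (M.p h s a) (M.optV (h.val + 1)) := by
      have : mean (pHat D h s a) (M.centredV h s a) = mean (pHat D h s a) (M.optV (h.val + 1)) -
          mean (M.p h s a) (M.optV (h.val + 1)) := by
        unfold MDP.centredV
        rw [mean_sub, mean_const (pHat_mem D h s a)]
      rw [← this, pHat_eq h0]
      rfl
    simp only [mul_neg, Finset.sum_neg_distrib] at h3
    rw [h4, mean_centredV_sq] at h2 h3
    -- With zero range the optimal values vanish and the bound is trivial; otherwise `valueRange` is
    -- `maxVal`.
    by_cases hM : maxVal S A H = 0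
    · have h5 : ∀ s', M.optV (h.val + 1) s' = 0 := fun s' =>
        le_antisymm ((M.optV_le_maxVal h.isLt s').trans_eq hM) (M.optV_mem h.isLt s').1
      have h6 : M.optV (h.val + 1) = fun _ => 0 := funext h5
      rw [h6, mean_zero, mean_zero, hM]
      simp
    · rw [valueRange, if_neg hM] at h2 h3
      rw [abs_le]
      have h7 : rateConc D δ h s a =
        betaConc (Fintype.card S) (Fintype.card A) H δ (count D h s a) / count D h s a := rfl
      rw [h7]
      constructor <;> linarith
  · have hn := Nat.pos_of_ne_zero h0
    have : Nonempty S := ⟨s⟩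
    have hβ := betaEntLevel_pos (A := A) h s hδ hδ1 hn
    have h1 := ((hparts h s a).2 h0).2
    rw [entropyFailure] at h1
    have hnn := fun l β => (isCountSupermartingale_expDoob_countEntropy (M.p_mem h s a) l β
      (count D h s a)).nonneg (countNext D h s a)
    have h2 := MTEE.abs_entropy_sub_le (M.p_mem h s a) hβ hn _ (sum_countNext D h s a)
      (lt_of_le_of_lt (le_add_of_nonneg_right (hnn _ _)) h1)
      (lt_of_le_of_lt (le_add_of_nonneg_left (hnn _ _)) h1)
    rw [pHat_eq h0]
    refine h2.trans ?_
    rw [bonusEnt]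
    exact add_le_add le_rfl (min_le_min_right _ (le_rateKL_of_le hδ hδ1 h s a))
  · have h1 := (hpair h s a).2
    have hd := pairDelta_pos (A := A) h s hδ
    have h2 : Real.exp (cumOcc M δ t D h s a / 2 - count D h s a) <
        16 * Fintype.card S * Fintype.card A * H / δ := by
      have h3 : (16 : ℝ) * Fintype.card S * Fintype.card A * H / δ = 4 * (1 / pairDelta S A H δ) := by
        rw [one_div_pairDelta]
        ring
      rw [h3]
      have h4 : pairDelta S A H δ * (1 / pairDelta S A H δ) = 1 := mul_one_div_cancel hd.ne'
      have h5 : 0 < 1 / pairDelta S A H δ := by positivity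
      have h6 := mul_lt_mul_of_pos_right h1 h5
      calc _ = 4 * ((pairDelta S A H δ / 4 *
            Real.exp (cumOcc M δ t D h s a / 2 - count D h s a)) * (1 / pairDelta S A H δ)) := by
            field_simp
        _ < _ := by linarith
    have h3 := Real.log_lt_log (Real.exp_pos _) h2
    rw [Real.log_exp] at h3
    linarith

theorem le_measure_isGood {Ω : Type w} [MeasurableSpace Ω] {μ : MeasureTheory.Measure Ω}
    {X : ℕ → Ω → Episode S A H} {ε : ℝ} (hH : 1 ≤ H) (hδ : 0 < δ) (hδ1 : δ < 1)
    (hI : IsInteraction M (ucbviEnt S A H s₁ ε δ) μ X) :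
    ENNReal.ofReal (1 - δ) ≤ μ {ω | ∀ t, IsGood M δ t (firstEpisodes (fun i => X i ω) t)} := by
  refine hI.le_measure_forall (IsGood M δ) (fun T => ?_) hδ.le
  have hS := isSupermartingale_totalFailure M hδ hδ1 T
  refine le_trans (MeasureTheory.measure_mono ?_) (hI.ville
    (fun t D => M.episodeProb_markov_mem (optimistic D δ) (optimistic_mem D δ))
    (totalFailure M δ T) hS.nonneg hS.step (totalFailure_zero_le M hH hδ hδ1 T) T)
  rintro ω ⟨t, ht, h⟩
  refine ⟨t, ht, ?_⟩
  by_contra hlt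
  exact h (isGood_of_totalFailure_lt M _ hδ hδ1 ht (not_le.1 hlt))

end good

end

section

variable {S : Type u} {A : Type v} [Fintype S] [DecidableEq S] [Fintype A] [DecidableEq A]
  {H : ℕ} {s₁ : S}

/-! ### Optimism and the gap -/

section recursions

variable {t : ℕ} (D : Fin t → Episode S A H) (δ : ℝ)

/-- The upper bound on the optimal value function. -/
def upV (h : ℕ) : S → ℝ := (bounds D δ h).1

/-- The lower bound on the optimal value function. -/
def lowV (h : ℕ) : S → ℝ := (bounds D δ h).2

theorem upV_of_lt (h : Fin H) (s : S) :
    upV D δ h s = lse (stepUp D δ h (upV D δ (h.val + 1)) (lowV D δ (h.val + 1)) s) := by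
  rw [upV, bounds, dif_pos h.isLt]
  rfl

theorem lowV_of_lt (h : Fin H) (s : S) :
    lowV D δ h s = lse (stepLow D δ h (upV D δ (h.val + 1)) (lowV D δ (h.val + 1)) s) := by
  rw [lowV, bounds, dif_pos h.isLt]
  rfl

theorem upV_last (s : S) : upV D δ H s = 0 := by
  rw [upV, bounds, dif_neg (lt_irrefl _)]

theorem lowV_last (s : S) : lowV D δ H s = 0 := by
  rw [lowV, bounds, dif_neg (lt_irrefl _)]

theorem gap_of_lt (h : Fin H) (s : S) :
    gap D δ h s = mean (optimistic D δ h s) (stepGap D δ h (gap D δ (h.val + 1)) s) := by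
  rw [gap, dif_pos h.isLt]

theorem gap_last (s : S) : gap D δ H s = 0 := by
  rw [gap, dif_neg (lt_irrefl _)]

theorem stepUp_mem (h : Fin H) (Vu Vl : S → ℝ) (s : S) (a : A) :
    0 ≤ stepUp D δ h Vu Vl s a ∧ stepUp D δ h Vu Vl s a ≤ maxVal S A H := by
  have := maxVal_nonneg S A H
  rw [stepUp]
  split_ifs
  · exact ⟨this, le_rfl⟩
  · exact ⟨le_clip _ _ _, clip_le _ this⟩

theorem stepLow_mem (h : Fin H) (Vu Vl : S → ℝ) (s : S) (a : A) :
    0 ≤ stepLow D δ h Vu Vl s a ∧ stepLow D δ h Vu Vl s a ≤ maxVal S A H := by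
  have := maxVal_nonneg S A H
  rw [stepLow]
  split_ifs
  · exact ⟨le_rfl, this⟩
  · exact ⟨le_clip _ _ _, clip_le _ this⟩

theorem stepGap_mem (h : Fin H) (g : S → ℝ) (s : S) (a : A) :
    0 ≤ stepGap D δ h g s a ∧ stepGap D δ h g s a ≤ maxVal S A H := by
  have := maxVal_nonneg S A H
  rw [stepGap]
  split_ifs
  · exact ⟨this, le_rfl⟩
  · exact ⟨le_clip _ _ _, clip_le _ this⟩

theorem gap_mem [Nonempty A] {h : ℕ} (hh : h ≤ H) (s : S) :
    0 ≤ gap D δ h s ∧ gap D δ h s ≤ maxVal S A H := by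
  rcases hh.eq_or_lt with rfl | hlt
  · rw [gap_last]
    exact ⟨le_rfl, maxVal_nonneg S A h⟩
  · rw [gap_of_lt D δ ⟨h, hlt⟩]
    exact ⟨mean_nonneg (optimistic_mem D δ _ s) fun a => (stepGap_mem D δ _ _ s a).1,
      mean_le (optimistic_mem D δ _ s) fun a => (stepGap_mem D δ _ _ s a).2⟩

theorem upV_nonneg [Nonempty A] {h : ℕ} (hh : h ≤ H) (s : S) : 0 ≤ upV D δ h s := by
  rcases hh.eq_or_lt with rfl | hlt
  · rw [upV_last]
  · rw [upV_of_lt D δ ⟨h, hlt⟩]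
    exact (log_card_nonneg A).trans (log_card_le_lse fun a => (stepUp_mem D δ _ _ _ s a).1)

theorem upV_le [Nonempty A] {h : ℕ} (hh : h ≤ H) (s : S) :
    upV D δ h s ≤ maxVal S A H + Real.log (Fintype.card A) := by
  rcases hh.eq_or_lt with rfl | hlt
  · rw [upV_last]
    exact add_nonneg (maxVal_nonneg S A h) (log_card_nonneg A)
  · rw [upV_of_lt D δ ⟨h, hlt⟩]
    exact lse_le fun a => (stepUp_mem D δ _ _ _ s a).2

/-- The summand log (card A) in the bound on `upV` cancels, since the optimal value is at least as
large before the last step. -/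
theorem upV_sub_optV_le [Nonempty A] (M : MDP S A H s₁) {h : ℕ} (hh : h ≤ H) (s : S) :
    upV D δ h s - M.optV h s ≤ maxVal S A H := by
  rcases hh.eq_or_lt with rfl | hlt
  · rw [upV_last, M.optV_last, sub_zero]
    exact maxVal_nonneg S A h
  · have h1 := upV_le D δ hh s
    have h2 : Real.log (Fintype.card A) ≤ M.optV h s := by
      rw [M.optV_of_lt ⟨h, hlt⟩]
      exact log_card_le_lse fun a => M.backup_nonneg _ (fun s => (M.optV_mem hlt s).1) s a
    linarith

section rates

variable (h : Fin H) (s : S) (a : A)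

theorem rateKL_nonneg [Nonempty A] (hδ : 0 < δ) (hδ1 : δ < 1) : 0 ≤ rateKL D δ h s a :=
  (by positivity : (0 : ℝ) ≤ (Fintype.card S : ℝ) / count D h s a).trans
    (le_rateKL_of_le hδ hδ1 h s a)

theorem rateConc_nonneg [Nonempty A] (hδ : 0 < δ) (hδ1 : δ < 1) : 0 ≤ rateConc D δ h s a := by
  rcases Nat.eq_zero_or_pos (count D h s a) with h0 | h0
  · simp [rateConc, h0]
  · exact div_nonneg (betaConc_pos h s hδ hδ1 h0).le (Nat.cast_nonneg _)

/-- Since 4en(2n + 1) ≤ 4 (e(1 + n))². This lets the lower-order Bernstein terms merge with the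
Hellinger terms. -/
theorem betaConc_le [Nonempty A] (s : S) (h : Fin H) (hδ : 0 < δ) (hδ1 : δ < 1) {n : ℕ}
    (hn : 0 < n) : betaConc (Fintype.card S) (Fintype.card A) H δ n ≤
      2 * betaKL (Fintype.card S) (Fintype.card A) H δ n := by
  have hn' : (1 : ℝ) ≤ n := by exact_mod_cast hn
  have h1 := log_pos_of_delta (A := A) h s hδ hδ1
  have hS : (1 : ℝ) ≤ Fintype.card S := by exact_mod_cast Fintype.card_pos_iff.2 ⟨s⟩
  have he := Real.add_one_le_exp 1
  have h2 : Real.log 4 ≤ Real.log (4 * Fintype.card S * Fintype.card A * H / δ) := by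
    refine Real.log_le_log (by norm_num) ?_
    have h3 : (1 : ℝ) ≤ ((Fintype.card S * Fintype.card A * H : ℕ) : ℝ) := by
      exact_mod_cast Nat.one_le_iff_ne_zero.2
        (mul_ne_zero (mul_ne_zero (Fintype.card_pos_iff.2 ⟨s⟩).ne' Fintype.card_ne_zero) h.pos.ne')
    push_cast at h3
    rw [le_div_iff₀ hδ]
    nlinarith
  have h4 : 0 ≤ Real.log (Real.exp 1 * (1 + n)) := Real.log_nonneg (by nlinarith)
  have h5 : Real.log (4 * Real.exp 1 * n * (2 * n + 1)) ≤
      Real.log 4 + 2 * Real.log (Real.exp 1 * (1 + n)) := by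
    rw [show (2 : ℝ) * Real.log (Real.exp 1 * (1 + n)) =
        Real.log ((Real.exp 1 * (1 + n)) ^ 2) by rw [Real.log_pow]; norm_num,
      ← Real.log_mul (by norm_num) (by positivity)]
    refine Real.log_le_log (by positivity) ?_
    have h6 : (n : ℝ) * (2 * n + 1) ≤ Real.exp 1 * (1 + n) ^ 2 := by nlinarith
    nlinarith [mul_le_mul_of_nonneg_left h6 (by positivity : (0 : ℝ) ≤ 4 * Real.exp 1)]
  have h7 : Real.log (Real.exp 1 * (1 + n)) ≤
      Fintype.card S * Real.log (Real.exp 1 * (1 + n)) := le_mul_of_one_le_left h4 hS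
  rw [betaConc, betaKL]
  linarith

theorem rateConc_le [Nonempty A] (hδ : 0 < δ) (hδ1 : δ < 1) :
    rateConc D δ h s a ≤ 2 * rateKL D δ h s a := by
  rcases Nat.eq_zero_or_pos (count D h s a) with h0 | h0
  · simp [rateConc, rateKL, h0]
  · rw [rateConc, rateKL, ← mul_div_assoc]
    exact div_le_div_of_nonneg_right (betaConc_le δ s h hδ hδ1 h0) (Nat.cast_nonneg _)

theorem bonusEnt_nonneg [Nonempty A] (hδ : 0 < δ) (hδ1 : δ < 1) : 0 ≤ bonusEnt D δ h s a :=
  add_nonneg (Real.sqrt_nonneg _) (le_min (rateKL_nonneg D δ h s a hδ hδ1) (log_card_nonneg S))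

theorem bonusB_nonneg [Nonempty A] (hδ : 0 < δ) (hδ1 : δ < 1) (V : S → ℝ) :
    0 ≤ bonusB D δ h V s a := by
  have h1 := rateKL_nonneg D δ h s a hδ hδ1
  have h2 := log_card_mul_card_nonneg S A
  rw [bonusB]
  positivity

theorem bonusP_nonneg [Nonempty A] (hδ : 0 < δ) (hδ1 : δ < 1) {Vu Vl : S → ℝ}
    (hV : ∀ s, Vl s ≤ Vu s) : 0 ≤ bonusP D δ h Vu Vl s a :=
  add_nonneg (bonusB_nonneg D δ h s a hδ hδ1 Vu) (mul_nonneg (by positivity)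
    (mean_nonneg (pHat_mem D h s a) fun s => sub_nonneg.2 (hV s)))

end rates

theorem lowV_le_upV [Nonempty A] (hδ : 0 < δ) (hδ1 : δ < 1) {h : ℕ} (hh : h ≤ H) :
    ∀ s, lowV D δ h s ≤ upV D δ h s := by
  refine backward_induction (P := fun h => ∀ s, lowV D δ h s ≤ upV D δ h s) ?_ ?_ hh
  · intro s
    rw [lowV_last, upV_last]
  · intro h ih s
    rw [lowV_of_lt, upV_of_lt]
    refine lse_mono fun a => ?_
    rw [stepLow, stepUp]
    split_ifs
    · exact maxVal_nonneg S A H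
    · refine max_le_max (min_le_min_right _ ?_) le_rfl
      have h1 := bonusP_nonneg D δ h s a hδ hδ1 ih
      have h2 := bonusEnt_nonneg D δ h s a hδ hδ1
      have h3 := mean_mono (pHat_mem D h s a) ih
      linarith

/-- All summands are nonnegative, so the lower clip is never active. -/
theorem stepUp_le [Nonempty A] (hδ : 0 < δ) (hδ1 : δ < 1) (h : Fin H) (s : S) (a : A)
    (h0 : count D h s a ≠ 0) :
    stepUp D δ h (upV D δ (h.val + 1)) (lowV D δ (h.val + 1)) s a ≤
      entropy (pHat D h s a) + bonusEnt D δ h s a + mean (pHat D h s a) (upV D δ (h.val + 1)) +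
        bonusP D δ h (upV D δ (h.val + 1)) (lowV D δ (h.val + 1)) s a := by
  rw [stepUp, if_neg h0]
  have h1 := bonusP_nonneg D δ h s a hδ hδ1 (lowV_le_upV D δ hδ hδ1 h.isLt)
  have h2 := bonusEnt_nonneg D δ h s a hδ hδ1
  have h3 := mean_nonneg (pHat_mem D h s a) (upV_nonneg D δ (h := h.val + 1) h.isLt)
  have h4 := entropy_nonneg (pHat_mem D h s a)
  exact max_le (min_le_left _ _) (by positivity)

theorem le_stepGap {h : Fin H} {g : S → ℝ} {s : S} {a : A} {x : ℝ} (hx : x ≤ maxVal S A H)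
    (hy : count D h s a ≠ 0 → x ≤ 2 * bonusB D δ h (upV D δ (h.val + 1)) s a +
      2 * bonusEnt D δ h s a +
      4 * (H : ℝ) ^ 2 * Real.log (Fintype.card S * Fintype.card A) * rateKL D δ h s a +
      (1 + 3 / (H : ℝ)) * mean (pHat D h s a) g) : x ≤ stepGap D δ h g s a := by
  rw [stepGap]
  split_ifs with h0
  · exact hx
  · exact le_max_of_le_left (le_min (hy h0) hx)

/-- Holds for all data, not only on the good event: the optimistic policy attains the upper maximum
and is a competitor in the lower one. The recursion costs a factor 1 + 2/H, below the 1 + 3/H built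
into the gap. -/
theorem upV_sub_lowV_le_gap [Nonempty A] (hδ : 0 < δ) (hδ1 : δ < 1) {h : ℕ} (hh : h ≤ H) :
    ∀ s, upV D δ h s - lowV D δ h s ≤ gap D δ h s := by
  refine backward_induction (P := fun h => ∀ s, upV D δ h s - lowV D δ h s ≤ gap D δ h s) ?_ ?_ hh
  · intro s
    rw [upV_last, lowV_last, gap_last, sub_zero]
  · intro h ih s
    set Qu := stepUp D δ h (upV D δ (h.val + 1)) (lowV D δ (h.val + 1)) s with hQu
    set Ql := stepLow D δ h (upV D δ (h.val + 1)) (lowV D δ (h.val + 1)) s with hQl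
    have h1 : upV D δ h s - lowV D δ h s ≤ mean (optimistic D δ h s) (fun a => Qu a - Ql a) := by
      rw [upV_of_lt, lowV_of_lt, mean_sub]
      have h2 : mean (optimistic D δ h s) Qu + entropy (optimistic D δ h s) = lse Qu :=
        gibbs_value Qu
      have h3 := mean_add_entropy_le_lse (optimistic_mem D δ h s) Ql
      linarith
    refine h1.trans ?_
    rw [gap_of_lt]
    refine mean_mono (optimistic_mem D δ h s) fun a => ?_
    have hu := stepUp_mem D δ h (upV D δ (h.val + 1)) (lowV D δ (h.val + 1)) s a
    have hl := stepLow_mem D δ h (upV D δ (h.val + 1)) (lowV D δ (h.val + 1)) s a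
    refine le_stepGap D δ (by linarith [hu.2, hl.1]) fun h0 => ?_
    have h2 := stepUp_le D δ hδ hδ1 h s a h0
    have hm := mean_mono (pHat_mem D h s a) ih
    have hm0 := mean_nonneg (pHat_mem D h s a)
      fun s' => (gap_mem D δ (h := h.val + 1) h.isLt s').1
    have hB := bonusB_nonneg D δ h s a hδ hδ1 (upV D δ (h.val + 1))
    have hE := bonusEnt_nonneg D δ h s a hδ hδ1
    have hK := rateKL_nonneg D δ h s a hδ hδ1
    have hR := log_card_mul_card_nonneg S A
    have hK' : 0 ≤ 4 * (H : ℝ) ^ 2 * Real.log (Fintype.card S * Fintype.card A) *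
      rateKL D δ h s a := by positivity
    have hH0 : (0 : ℝ) ≤ 1 / H := by positivity
    have h3H : 3 / (H : ℝ) = 3 * (1 / H) := by ring
    have hHm := mul_nonneg hH0 hm0
    have hHm' := mul_le_mul_of_nonneg_left hm hH0
    rw [h3H]
    have hlow : Ql a = max (min (entropy (pHat D h s a) + mean (pHat D h s a) (lowV D δ (h.val + 1))
        - bonusP D δ h (upV D δ (h.val + 1)) (lowV D δ (h.val + 1)) s a - bonusEnt D δ h s a)
        (maxVal S A H)) 0 := by
      rw [hQl, stepLow, if_neg h0, clip]
    rcases le_total (entropy (pHat D h s a) + mean (pHat D h s a) (lowV D δ (h.val + 1))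
        - bonusP D δ h (upV D δ (h.val + 1)) (lowV D δ (h.val + 1)) s a - bonusEnt D δ h s a)
        (maxVal S A H) with hc | hc
    · rw [min_eq_left hc] at hlow
      have h4 := hlow.symm ▸ le_max_left (entropy (pHat D h s a) +
        mean (pHat D h s a) (lowV D δ (h.val + 1)) - bonusP D δ h (upV D δ (h.val + 1))
        (lowV D δ (h.val + 1)) s a - bonusEnt D δ h s a) 0
      rw [mean_sub] at hm hHm'
      have h5 : bonusP D δ h (upV D δ (h.val + 1)) (lowV D δ (h.val + 1)) s a =
        bonusB D δ h (upV D δ (h.val + 1)) s a + 1 / (H : ℝ) * (mean (pHat D h s a)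
          (upV D δ (h.val + 1)) - mean (pHat D h s a) (lowV D δ (h.val + 1))) := by
        rw [bonusP, mean_sub]
      rw [h5] at h2 h4
      have h6 : Qu a - Ql a ≤ (2 * bonusB D δ h (upV D δ (h.val + 1)) s a +
        2 * bonusEnt D δ h s a) + mean (pHat D h s a) (gap D δ (h.val + 1)) +
        2 * (1 / H * mean (pHat D h s a) (gap D δ (h.val + 1))) := by linarith
      nlinarith
    -- A lower bound clipped at the top leaves no difference to account for.
    · rw [min_eq_right hc] at hlow
      have h4 : maxVal S A H ≤ Ql a := hlow ▸ le_max_left _ _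
      have h5 : 0 ≤ (1 + 3 * (1 / (H : ℝ))) * mean (pHat D h s a) (gap D δ (h.val + 1)) := by
        positivity
      linarith [hu.2]

end recursions

section good

variable [Nonempty A] {M : MDP S A H s₁} {δ : ℝ} {t : ℕ} {D : Fin t → Episode S A H}

/-- The square root is bounded by a sum whose square dominates each part of the variance bound. The
term linear in x is split by 4ab ≤ (a + b)² with a = x / Hr and b = 2 Hr M ρ, so x enters with
weight only 1 / Hr. -/
theorem sqrt_bernstein_le {Hr R κ ρ v x vp : ℝ} (hH : 1 ≤ Hr) (hR : 0 ≤ R) (hρ : 0 ≤ ρ)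
    (hρκ : ρ ≤ 2 * κ) (hv : 0 ≤ v) (hx : 0 ≤ x)
    (hvp : vp ≤ 4 * v + 4 * (Hr * R) * x + 2 * ((Hr * R) ^ 2 * κ)) :
    √(2 * vp * ρ) + Hr * R * ρ ≤ 3 * √(v * ρ) + 9 * Hr ^ 2 * R * κ + 1 / Hr * x := by
  have hκ : 0 ≤ κ := by linarith
  have hH0 : 0 < Hr := by linarith
  set M := Hr * R with hM
  have hM0 : 0 ≤ M := by positivity
  have hs : √(v * ρ) ^ 2 = v * ρ := Real.sq_sqrt (by positivity)
  have h1 : √(2 * vp * ρ) ≤ 3 * √(v * ρ) + (1 / Hr * x + 2 * Hr * M * ρ) + 3 * M * κ := by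
    rw [Real.sqrt_le_left (by positivity)]
    have ha : 0 ≤ 3 * √(v * ρ) := by positivity
    have hb : 0 ≤ 1 / Hr * x + 2 * Hr * M * ρ := by positivity
    have hc : 0 ≤ 3 * M * κ := by positivity
    have h2 : (3 * √(v * ρ)) ^ 2 + (1 / Hr * x + 2 * Hr * M * ρ) ^ 2 + (3 * M * κ) ^ 2 ≤
        (3 * √(v * ρ) + (1 / Hr * x + 2 * Hr * M * ρ) + 3 * M * κ) ^ 2 := by
      nlinarith [mul_nonneg ha hb, mul_nonneg ha hc, mul_nonneg hb hc]
    refine le_trans ?_ h2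
    have h3 : 8 * M * x * ρ ≤ (1 / Hr * x + 2 * Hr * M * ρ) ^ 2 := by
      have h4 : (1 / Hr * x + 2 * Hr * M * ρ) ^ 2 - 8 * M * x * ρ =
          (1 / Hr * x - 2 * Hr * M * ρ) ^ 2 := by field_simp; ring
      nlinarith [sq_nonneg (1 / Hr * x - 2 * Hr * M * ρ)]
    have h5 : 4 * (M ^ 2 * κ * ρ) ≤ 8 * (M ^ 2 * κ * κ) := by
      have := mul_le_mul_of_nonneg_left hρκ (by positivity : 0 ≤ M ^ 2 * κ)
      linarith
    have h6 := mul_le_mul_of_nonneg_right hvp (by positivity : 0 ≤ 2 * ρ)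
    have h7 : (3 * √(v * ρ)) ^ 2 = 9 * (v * ρ) := by rw [mul_pow, hs]; norm_num
    rw [h7]
    have h8 : 0 ≤ v * ρ := by positivity
    have h9 : 0 ≤ M ^ 2 * κ * κ := by positivity
    have h10 : (3 * M * κ) ^ 2 = 9 * (M ^ 2 * κ * κ) := by ring
    rw [h10]
    have h11 : (4 * v + 4 * M * x + 2 * (M ^ 2 * κ)) * (2 * ρ) =
      8 * (v * ρ) + 8 * M * x * ρ + 4 * (M ^ 2 * κ * ρ) := by ring
    linarith
  have h2 : M * ρ ≤ 2 * (M * κ) := by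
    have := mul_le_mul_of_nonneg_left hρκ hM0
    linarith
  have h3 : 2 * Hr * M * ρ ≤ 4 * (Hr * (M * κ)) := by
    have := mul_le_mul_of_nonneg_left hρκ (by positivity : 0 ≤ 2 * Hr * M)
    linarith
  have h4 : M * κ ≤ Hr * (M * κ) := le_mul_of_one_le_left (by positivity) hH
  have h5 : 9 * Hr ^ 2 * R * κ = 9 * (Hr * (M * κ)) := by rw [hM]; ring
  rw [h5]
  linarith

/-- The Bernstein width involves the unknown variance of `optV` under p. Hellinger distance replaces
p by the empirical law, and optimism replaces `optV` by `upV` through (upV - optV)² ≤ maxVal · (upV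
- optV). -/
theorem IsGood.abs_mean_sub_le_bonusB (hG : IsGood M δ t D) (hδ : 0 < δ) (hδ1 : δ < 1) (h : Fin H)
    (s : S) (a : A) (h0 : count D h s a ≠ 0)
    (hV : ∀ s, M.optV (h.val + 1) s ≤ upV D δ (h.val + 1) s) :
    |mean (pHat D h s a) (M.optV (h.val + 1)) - mean (M.p h s a) (M.optV (h.val + 1))| ≤
      bonusB D δ h (upV D δ (h.val + 1)) s a + 1 / (H : ℝ) *
        mean (pHat D h s a) (fun s' => upV D δ (h.val + 1) s' - M.optV (h.val + 1) s') := by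
  refine (hG.abs_mean_sub_le h s a h0).trans ?_
  have hp := pHat_mem D h s a
  have h1 := variance_le_hel hp (M.p_mem h s a) (fun s => (M.optV_mem (h := h.val + 1) h.isLt s).1)
    (M.optV_le_maxVal (h := h.val + 1) h.isLt)
  have h2 := variance_le_add hp (M.optV (h.val + 1)) (upV D δ (h.val + 1))
  have h3 : mean (pHat D h s a)
      (fun s' => (M.optV (h.val + 1) s' - upV D δ (h.val + 1) s') ^ 2) ≤
      maxVal S A H * mean (pHat D h s a)
        (fun s' => upV D δ (h.val + 1) s' - M.optV (h.val + 1) s') := by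
    rw [← mean_mul_left]
    refine mean_mono hp fun s' => ?_
    have h4 := upV_sub_optV_le D δ M (h := h.val + 1) h.isLt s'
    have h5 := sub_nonneg.2 (hV s')
    nlinarith
  have h4 : maxVal S A H ^ 2 * hel (pHat D h s a) (M.p h s a) ≤
      maxVal S A H ^ 2 * rateKL D δ h s a :=
    mul_le_mul_of_nonneg_left (hG.hel_le h s a h0) (sq_nonneg _)
  have hH : (1 : ℝ) ≤ H := by exact_mod_cast h.pos
  exact sqrt_bernstein_le hH (log_card_mul_card_nonneg S A)
    (rateConc_nonneg D δ h s a hδ hδ1) (rateConc_le D δ h s a hδ hδ1)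
    (variance_nonneg hp _) (mean_nonneg hp fun s => sub_nonneg.2 (hV s)) (by
      change _ ≤ 4 * _ + 4 * maxVal S A H * _ + 2 * (maxVal S A H ^ 2 * _)
      linarith)

/-- On the concentration event the bounds are correct. -/
theorem IsGood.optV_mem (hG : IsGood M δ t D) (hδ : 0 < δ) (hδ1 : δ < 1) {h : ℕ} (hh : h ≤ H) :
    ∀ s, lowV D δ h s ≤ M.optV h s ∧ M.optV h s ≤ upV D δ h s := by
  refine backward_induction
    (P := fun h => ∀ s, lowV D δ h s ≤ M.optV h s ∧ M.optV h s ≤ upV D δ h s) ?_ ?_ hh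
  · intro s
    rw [lowV_last, upV_last, M.optV_last]
    exact ⟨le_rfl, le_rfl⟩
  · intro h ih s
    have hb0 : ∀ a, 0 ≤ M.backup h (M.optV (h.val + 1)) s a :=
      M.backup_nonneg h (fun s => (M.optV_mem (h := h.val + 1) h.isLt s).1) s
    have hbM : ∀ a, M.backup h (M.optV (h.val + 1)) s a ≤ maxVal S A H := fun a => by
      have : Nonempty S := ⟨s⟩
      refine (M.backup_le h (fun s => (M.optV_mem (h := h.val + 1) h.isLt s).2) s a).trans ?_
      have h1 := log_card_mul_card_nonneg S A
      have h2 : Real.log (Fintype.card S) ≤ Real.log (Fintype.card S * Fintype.card A) := by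
        rw [log_card_mul_card]
        exact le_add_of_nonneg_right (log_card_nonneg A)
      have h3 : (0 : ℝ) ≤ h.val := Nat.cast_nonneg _
      rw [maxVal]
      push_cast
      nlinarith
    have key : ∀ a, count D h s a ≠ 0 →
        |mean (pHat D h s a) (M.optV (h.val + 1)) - mean (M.p h s a) (M.optV (h.val + 1))| ≤
        bonusP D δ h (upV D δ (h.val + 1)) (lowV D δ (h.val + 1)) s a := fun a h0 => by
      refine (hG.abs_mean_sub_le_bonusB hδ hδ1 h s a h0 fun s => (ih s).2).trans ?_
      rw [bonusP]
      gcongr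
      refine mean_mono (pHat_mem D h s a) fun s' => ?_
      linarith [(ih s').1]
    rw [lowV_of_lt, upV_of_lt, M.optV_of_lt]
    constructor
    · refine lse_mono fun a => ?_
      rw [stepLow]
      split_ifs with h0
      · exact hb0 a
      · refine max_le ((min_le_left _ _).trans ?_) (hb0 a)
        have h1 := abs_le.1 (key a h0)
        have h2 := abs_le.1 (hG.abs_entropy_sub_le h s a h0)
        have h3 := mean_mono (pHat_mem D h s a) fun s => (ih s).1
        rw [MDP.backup]
        linarith [h1.2, h2.2]
    · refine lse_mono fun a => ?_
      rw [stepUp]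
      split_ifs with h0
      · exact hbM a
      · refine le_max_of_le_left (le_min ?_ (hbM a))
        have h1 := abs_le.1 (key a h0)
        have h2 := abs_le.1 (hG.abs_entropy_sub_le h s a h0)
        have h3 := mean_mono (pHat_mem D h s a) fun s => (ih s).2
        rw [MDP.backup]
        linarith [h1.1, h2.1]

/-- On the concentration event the gap bounds the suboptimality of the optimistic policy. -/
theorem IsGood.upV_sub_polV_le_gap (hG : IsGood M δ t D) (hδ : 0 < δ) (hδ1 : δ < 1) {h : ℕ}
    (hh : h ≤ H) : ∀ s, upV D δ h s - M.polV (optimistic D δ) h s ≤ gap D δ h s := by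
  refine backward_induction
    (P := fun h => ∀ s, upV D δ h s - M.polV (optimistic D δ) h s ≤ gap D δ h s) ?_ ?_ hh
  · intro s
    rw [upV_last, M.polV_last, gap_last, sub_zero]
  · intro h ih s
    set Qu := stepUp D δ h (upV D δ (h.val + 1)) (lowV D δ (h.val + 1)) s with hQu
    set W := M.polV (optimistic D δ) (h.val + 1) with hW
    have hW0 : ∀ s, 0 ≤ W s := M.polV_nonneg (optimistic_mem D δ) h.isLt
    have hWV : ∀ s, W s ≤ M.optV (h.val + 1) s := M.polV_le_optV (optimistic_mem D δ) h.isLt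
    have h1 : upV D δ h s - M.polV (optimistic D δ) h s =
        mean (optimistic D δ h s) (fun a => Qu a - M.backup h W s a) := by
      rw [upV_of_lt, M.polV_of_lt, mean_sub]
      have h2 : mean (optimistic D δ h s) Qu + entropy (optimistic D δ h s) = lse Qu :=
        gibbs_value Qu
      linarith
    rw [h1, gap_of_lt]
    refine mean_mono (optimistic_mem D δ h s) fun a => ?_
    have hu := stepUp_mem D δ h (upV D δ (h.val + 1)) (lowV D δ (h.val + 1)) s a
    refine le_stepGap D δ (by linarith [hu.2, M.backup_nonneg h hW0 s a]) fun h0 => ?_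
    have hp := pHat_mem D h s a
    have h2 := stepUp_le D δ hδ hδ1 h s a h0
    have hV := fun s => hG.optV_mem hδ hδ1 (h := h.val + 1) h.isLt s
    have h3 := (abs_le.1 (hG.abs_mean_sub_le_bonusB hδ hδ1 h s a h0 fun s => (hV s).2)).2
    have h4 := (abs_le.1 (hG.abs_entropy_sub_le h s a h0)).2
    have hH : (1 : ℝ) ≤ H := by exact_mod_cast h.pos
    have hH0 : (0 : ℝ) < H := by linarith
    -- The difference of the next values splits into p̂ (upV - V*), (p̂ - p) V* and p (V* - W). Only
    -- the fixed function V* is concentrated; the last term is a nonnegative function and returns to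
    -- p̂ at the cost 1 + 1/H.
    have h5 := mean_le_hel (f := fun s => M.optV (h.val + 1) s - W s) (c := maxVal S A H)
      (η := 1 / (H : ℝ)) hp (M.p_mem h s a) (by positivity) (fun s => sub_nonneg.2 (hWV s))
      (fun s => by linarith [M.optV_le_maxVal (h := h.val + 1) h.isLt s, hW0 s])
    rw [one_div_one_div] at h5
    have hR := log_card_mul_card_nonneg S A
    have hK := rateKL_nonneg D δ h s a hδ hδ1
    have h6 : (1 + (H : ℝ)) * (maxVal S A H * hel (pHat D h s a) (M.p h s a)) ≤
        4 * (H : ℝ) ^ 2 * Real.log (Fintype.card S * Fintype.card A) * rateKL D δ h s a := by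
      have h7 := mul_le_mul_of_nonneg_left (hG.hel_le h s a h0) (maxVal_nonneg S A H)
      have h8 := mul_le_mul_of_nonneg_left h7 (by linarith : (0 : ℝ) ≤ 1 + H)
      refine h8.trans ?_
      rw [maxVal]
      have h9 : 0 ≤ (H : ℝ) * Real.log (Fintype.card S * Fintype.card A) * rateKL D δ h s a := by
        positivity
      nlinarith
    have hgap := mean_mono hp ih
    have hgap' := mean_mono hp (upV_sub_lowV_le_gap D δ hδ hδ1 (h := h.val + 1) h.isLt)
    have hgap0 := mean_nonneg hp fun s' => (gap_mem D δ (h := h.val + 1) h.isLt s').1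
    have hHi : (0 : ℝ) ≤ 1 / H := by positivity
    have h3H : 3 / (H : ℝ) = 3 * (1 / H) := by ring
    rw [h3H]
    rw [bonusP] at h2
    rw [mean_sub] at h3 h5 hgap hgap'
    rw [mean_sub] at h5 h2
    rw [MDP.backup]
    have e1 := mul_le_mul_of_nonneg_left hgap hHi
    have e2 := mul_le_mul_of_nonneg_left hgap' hHi
    have e3 := mul_nonneg hHi hgap0
    nlinarith

theorem IsGood.suboptimality_le (hG : IsGood M δ t D) (hH : 1 ≤ H) (hδ : 0 < δ) (hδ1 : δ < 1)
    (π : Policy S A H) : M.TE π - M.TE (optimisticPolicy δ t D) ≤ gap D δ 0 s₁ := by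
  have h1 := M.TE_le_optV hH π
  have h2 := M.TE_markov hH (optimistic D δ) (optimistic_mem D δ)
  have h3 := (hG.optV_mem hδ hδ1 (Nat.zero_le H) s₁).2
  have h4 := hG.upV_sub_polV_le_gap hδ hδ1 (Nat.zero_le H) s₁
  rw [optimisticPolicy_eq, h2]
  linarith

end good

end

section

variable {S : Type u} {A : Type v} [Fintype S] [DecidableEq S] [Fintype A] [DecidableEq A]
  {H : ℕ} {s₁ : S}

/-! ### Unrolling recursions along the episodes of a policy -/

section unroll

variable (M : MDP S A H s₁) (f : Fin H → S → A → ℝ) (hf : ∀ h s, f h s ∈ stdSimplex ℝ A)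

theorem MDP.expect_mono {F G : Episode S A H → ℝ} (h : ∀ e, F e ≤ G e) :
    M.expect (Policy.markov f hf) F ≤ M.expect (Policy.markov f hf) G :=
  mean_mono (M.episodeProb_markov_mem f hf) h

theorem MDP.expect_step (h : Fin H) (r : S → A → ℝ) (ψ : S → ℝ) (c : ℝ) :
    M.expect (Policy.markov f hf) (fun e => mean (f h (e.1 h.castSucc)) fun a =>
        r (e.1 h.castSucc) a + c * mean (M.p h (e.1 h.castSucc) a) ψ) =
      ∑ s, ∑ a, M.occ (Policy.markov f hf) h s a * r s a +
        c * M.expect (Policy.markov f hf) (fun e => ψ (e.1 h.succ)) := by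
  rw [← M.expect_eq_sum_occ, M.expect_next f hf (fun _ _ s' => ψ s') h,
    ← M.expect_action f hf (fun s a => r s a + c * mean (M.p h s a) ψ) h]
  simp only [MDP.expect, mean_add, mean_mul_left]

theorem sum_filter_lt_succ {H k : ℕ} (hk : k < H) (φ : Fin H → ℝ) :
    ∑ h ∈ Finset.univ.filter (fun h : Fin H => h.val < k + 1), φ h =
      φ ⟨k, hk⟩ + ∑ h ∈ Finset.univ.filter (fun h : Fin H => h.val < k), φ h := by
  have : Finset.univ.filter (fun h : Fin H => h.val < k + 1) =
      insert ⟨k, hk⟩ (Finset.univ.filter fun h : Fin H => h.val < k) := by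
    ext h
    simp only [Finset.mem_filter, Finset.mem_univ, true_and, Finset.mem_insert, Fin.ext_iff]
    omega
  rw [this, Finset.sum_insert (by simp)]

/-- The expected total reward is at most any solution of the Bellman inequality. -/
theorem MDP.sum_occ_le_of_bellman {r : Fin H → S → A → ℝ} {U : ℕ → S → ℝ}
    (hU : ∀ (h : Fin H) s, mean (f h s) (fun a => r h s a + mean (M.p h s a) (U (h.val + 1))) ≤
      U h.val s) (h0 : ∀ s, 0 ≤ U H s) :
    ∑ h, ∑ s, ∑ a, M.occ (Policy.markov f hf) h s a * r h s a ≤ U 0 s₁ := by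
  have key : ∀ k (hk : k ≤ H), ∑ h ∈ Finset.univ.filter (fun h : Fin H => h.val < k),
      (∑ s, ∑ a, M.occ (Policy.markov f hf) h s a * r h s a) +
        M.expect (Policy.markov f hf) (fun e => U k (e.1 ⟨k, Nat.lt_succ_of_le hk⟩)) ≤ U 0 s₁ := by
    intro k
    induction k with
    | zero =>
      intro _
      simp only [Nat.not_lt_zero, Finset.filter_false, Finset.sum_empty, zero_add]
      exact (M.expect_start f hf (U 0)).le
    | succ k ih =>
      intro hk
      refine le_trans ?_ (ih (Nat.le_of_succ_le hk))
      rw [sum_filter_lt_succ hk]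
      have h1 := M.expect_mono f hf fun e => hU ⟨k, hk⟩ (e.1 (Fin.castSucc ⟨k, hk⟩))
      have h2 := M.expect_step f hf ⟨k, hk⟩ (r ⟨k, hk⟩) (U (k + 1)) 1
      simp only [one_mul] at h2
      rw [h2] at h1
      have h3 : (⟨k + 1, Nat.lt_succ_of_le hk⟩ : Fin (H + 1)) = Fin.succ ⟨k, hk⟩ := rfl
      have h4 : (⟨k, Nat.lt_succ_of_le (Nat.le_of_succ_le hk)⟩ : Fin (H + 1)) =
        Fin.castSucc ⟨k, hk⟩ := rfl
      rw [h3, h4]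
      linarith
  have h1 := key H le_rfl
  have h2 : Finset.univ.filter (fun h : Fin H => h.val < H) = Finset.univ :=
    Finset.filter_true_of_mem fun h _ => h.isLt
  rw [h2] at h1
  have h3 : 0 ≤ M.expect (Policy.markov f hf) (fun e => U H (e.1 ⟨H, Nat.lt_succ_of_le le_rfl⟩)) :=
    mean_nonneg (M.episodeProb_markov_mem f hf) fun e => h0 _
  linarith

/-- Each unrolled step multiplies the remainder by c ≥ 1, and nonnegative rewards may be inflated to
the common factor c ^ H. -/
theorem MDP.le_sum_occ_of_bellman {r : Fin H → S → A → ℝ} {g : ℕ → S → ℝ} {c : ℝ} (hc : 1 ≤ c)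
    (hr : ∀ h s a, 0 ≤ r h s a)
    (hg : ∀ (h : Fin H) s, g h.val s ≤
      mean (f h s) (fun a => r h s a + c * mean (M.p h s a) (g (h.val + 1))))
    (h0 : ∀ s, g H s ≤ 0) :
    g 0 s₁ ≤ c ^ H * ∑ h, ∑ s, ∑ a, M.occ (Policy.markov f hf) h s a * r h s a := by
  have hc0 : 0 ≤ c := zero_le_one.trans hc
  have hpos : ∀ h, 0 ≤ ∑ s, ∑ a, M.occ (Policy.markov f hf) h s a * r h s a := fun h =>
    Finset.sum_nonneg fun s _ => Finset.sum_nonneg fun a _ =>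
      mul_nonneg (M.occ_nonneg f hf h s a) (hr h s a)
  have key : ∀ k (hk : k ≤ H), g 0 s₁ ≤ c ^ k *
      (M.expect (Policy.markov f hf) (fun e => g k (e.1 ⟨k, Nat.lt_succ_of_le hk⟩)) +
        ∑ h ∈ Finset.univ.filter (fun h : Fin H => h.val < k),
          (∑ s, ∑ a, M.occ (Policy.markov f hf) h s a * r h s a)) := by
    intro k
    induction k with
    | zero =>
      intro _
      simp only [Nat.not_lt_zero, Finset.filter_false, Finset.sum_empty, add_zero, pow_zero, one_mul]
      exact (M.expect_start f hf (g 0)).ge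
    | succ k ih =>
      intro hk
      refine (ih (Nat.le_of_succ_le hk)).trans ?_
      rw [sum_filter_lt_succ hk, pow_succ, mul_assoc]
      refine mul_le_mul_of_nonneg_left ?_ (pow_nonneg hc0 k)
      have h1 := M.expect_mono f hf fun e => hg ⟨k, hk⟩ (e.1 (Fin.castSucc ⟨k, hk⟩))
      rw [M.expect_step f hf ⟨k, hk⟩ (r ⟨k, hk⟩) (g (k + 1)) c] at h1
      have h3 : (⟨k + 1, Nat.lt_succ_of_le hk⟩ : Fin (H + 1)) = Fin.succ ⟨k, hk⟩ := rfl
      have h4 : (⟨k, Nat.lt_succ_of_le (Nat.le_of_succ_le hk)⟩ : Fin (H + 1)) =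
        Fin.castSucc ⟨k, hk⟩ := rfl
      rw [h3, h4]
      have h5 := hpos ⟨k, hk⟩
      have h6 : 0 ≤ ∑ h ∈ Finset.univ.filter (fun h : Fin H => h.val < k),
          (∑ s, ∑ a, M.occ (Policy.markov f hf) h s a * r h s a) :=
        Finset.sum_nonneg fun h _ => hpos h
      have h7 := le_mul_of_one_le_left h5 hc
      have h8 := le_mul_of_one_le_left h6 hc
      linarith
  have h1 := key H le_rfl
  have h2 : Finset.univ.filter (fun h : Fin H => h.val < H) = Finset.univ :=
    Finset.filter_true_of_mem fun h _ => h.isLt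
  rw [h2] at h1
  refine h1.trans (mul_le_mul_of_nonneg_left ?_ (pow_nonneg hc0 H))
  have h3 : M.expect (Policy.markov f hf) (fun e => g H (e.1 ⟨H, Nat.lt_succ_of_le le_rfl⟩)) ≤ 0 :=
    mean_le (M.episodeProb_markov_mem f hf) fun e => h0 _
  linarith

/-- Law of total variance: the expected sum of the variances of the next value is at most the
square of the range of the return. -/
theorem MDP.sum_occ_variance_le [Nonempty A] :
    ∑ h : Fin H, ∑ s, ∑ a, M.occ (Policy.markov f hf) h s a *
      variance (M.p h s a) (M.polV f (h.val + 1)) ≤ maxVal S A H ^ 2 := by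
  have : Nonempty S := ⟨s₁⟩
  set R := Real.log (Fintype.card S * Fintype.card A) with hR
  have hR0 : 0 ≤ R := log_card_mul_card_nonneg S A
  have h1 := M.sum_occ_le_of_bellman f hf
    (r := fun h s a => variance (M.p h s a) (M.polV f (h.val + 1)))
    -- Variance plus p (K²R² - V²) equals K²R² - (p V)², where K steps remain after this one. The
    -- value squared grows by at most (2K + 1) R² in a step, and K² + 2K + 1 = (K + 1)².
    (U := fun h s => ((H - h : ℝ) * R) ^ 2 - M.polV f h s ^ 2) (fun h s => ?_) (fun s => by
      rw [M.polV_last]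
      simp)
  · refine h1.trans ?_
    simp only [Nat.cast_zero, sub_zero]
    rw [maxVal]
    exact sub_le_self _ (sq_nonneg _)
  · set K : ℝ := (H : ℝ) - ((h.val + 1 : ℕ) : ℝ) with hK
    have hK0 : 0 ≤ K := sub_nonneg.2 (Nat.cast_le.2 h.isLt)
    have hKs : (H : ℝ) - (h.val : ℝ) = K + 1 := by rw [hK]; push_cast; ring
    have hV0 : ∀ s, 0 ≤ M.polV f (h.val + 1) s := M.polV_nonneg hf h.isLt
    have hVK : ∀ s, M.polV f (h.val + 1) s ≤ K * R := fun s =>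
      (M.polV_le_optV hf (h := h.val + 1) h.isLt s).trans (M.optV_mem (h := h.val + 1) h.isLt s).2
    have e1 : ∀ a, variance (M.p h s a) (M.polV f (h.val + 1)) + mean (M.p h s a)
        (fun s => (K * R) ^ 2 - M.polV f (h.val + 1) s ^ 2) =
        (K * R) ^ 2 - mean (M.p h s a) (M.polV f (h.val + 1)) ^ 2 := by
      intro a
      rw [mean_sub, mean_const (M.p_mem h s a), mean_sq (M.p_mem h s a)]
      ring
    have e2 : M.polV f h.val s = mean (f h s) (fun a => M.backup h (M.polV f (h.val + 1)) s a +
        entropy (f h s)) := by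
      rw [mean_add, mean_const (hf h s), M.polV_of_lt]
    have e3 : M.polV f h.val s ^ 2 ≤ mean (f h s) (fun a =>
        (mean (M.p h s a) (M.polV f (h.val + 1)) ^ 2 + (2 * K + 1) * R ^ 2)) := by
      rw [e2]
      refine (sq_mean_le (hf h s) _).trans (mean_mono (hf h s) fun a => ?_)
      set y := mean (M.p h s a) (M.polV f (h.val + 1)) with hy
      have hy0 : 0 ≤ y := mean_nonneg (M.p_mem h s a) hV0
      have hyK : y ≤ K * R := mean_le (M.p_mem h s a) hVK
      set r := entropy (M.p h s a) + entropy (f h s) with hr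
      have hr0 : 0 ≤ r := add_nonneg (entropy_nonneg (M.p_mem h s a)) (entropy_nonneg (hf h s))
      have hrR : r ≤ R := by
        rw [hR, log_card_mul_card]
        exact add_le_add (entropy_le_log_card (M.p_mem h s a)) (entropy_le_log_card (hf h s))
      have e4 : M.backup h (M.polV f (h.val + 1)) s a + entropy (f h s) = r + y := by
        rw [MDP.backup, hr]
        ring
      rw [e4]
      have e5 : r * y ≤ R * (K * R) := mul_le_mul hrR hyK hy0 hR0
      have e6 : r ^ 2 ≤ R ^ 2 := pow_le_pow_left₀ hr0 hrR 2
      nlinarith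
    simp only [e1, hKs]
    rw [mean_sub, mean_const (hf h s)]
    rw [mean_add, mean_const (hf h s)] at e3
    nlinarith

end unroll

/-! ### The gap through the occupancies -/

section good

variable [Nonempty A] {M : MDP S A H s₁} {δ : ℝ} {t : ℕ} {D : Fin t → Episode S A H}

/-- The contribution of a well-explored pair to the gap. -/
def pairBonus (M : MDP S A H s₁) (δ : ℝ) {t : ℕ} (D : Fin t → Episode S A H) (h : Fin H) (s : S)
    (a : A) : ℝ :=
  12 * √(variance (M.p h s a) (M.polV (optimistic D δ) (h.val + 1)) * rateConc D δ h s a) +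
    2 * √(2 * betaEnt (Fintype.card S) (Fintype.card A) H δ (count D h s a) / count D h s a) +
    2 * rateKL D δ h s a +
    200 * ((H : ℝ) ^ 2 * Real.log (Fintype.card S * Fintype.card A) * rateKL D δ h s a)

/-- The same splitting as in `sqrt_bernstein_le`: 288 M x ρ = 4ab with a = x / Hr and b = 72 Hr M ρ.
-/
theorem sqrt_empirical_variance_le {Hr M κ ρ v x w : ℝ} (hH : 1 ≤ Hr) (hM : 0 ≤ M) (hρ : 0 ≤ ρ)
    (hρκ : ρ ≤ 2 * κ) (hv : 0 ≤ v) (hx : 0 ≤ x)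
    (hw : w ≤ 4 * v + 8 * M * x + 8 * (M ^ 2 * κ)) :
    6 * √(w * ρ) ≤ 12 * √(v * ρ) + 1 / Hr * x + 168 * (Hr * (M * κ)) := by
  have hκ : 0 ≤ κ := by linarith
  have hH0 : 0 < Hr := by linarith
  have hs : √(v * ρ) ^ 2 = v * ρ := Real.sq_sqrt (by positivity)
  have h1 : 6 * √(w * ρ) ≤ 12 * √(v * ρ) + (1 / Hr * x + 72 * Hr * M * ρ) + 24 * (M * κ) := by
    have ha : 0 ≤ 12 * √(v * ρ) := by positivity
    have hb : 0 ≤ 1 / Hr * x + 72 * Hr * M * ρ := by positivity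
    have hc : 0 ≤ 24 * (M * κ) := by positivity
    have h0 : 6 * √(w * ρ) = √(36 * (w * ρ)) := by
      rw [show (36 : ℝ) = 6 ^ 2 by norm_num, Real.sqrt_mul (by norm_num : (0 : ℝ) ≤ 6 ^ 2),
        Real.sqrt_sq (by norm_num)]
    rw [h0, Real.sqrt_le_left (by positivity)]
    have h2 : (12 * √(v * ρ)) ^ 2 + (1 / Hr * x + 72 * Hr * M * ρ) ^ 2 + (24 * (M * κ)) ^ 2 ≤
        (12 * √(v * ρ) + (1 / Hr * x + 72 * Hr * M * ρ) + 24 * (M * κ)) ^ 2 := by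
      nlinarith [mul_nonneg ha hb, mul_nonneg ha hc, mul_nonneg hb hc]
    refine le_trans ?_ h2
    have h3 : 288 * M * x * ρ ≤ (1 / Hr * x + 72 * Hr * M * ρ) ^ 2 := by
      have h4 : (1 / Hr * x + 72 * Hr * M * ρ) ^ 2 - 288 * M * x * ρ =
          (1 / Hr * x - 72 * Hr * M * ρ) ^ 2 := by field_simp; ring
      nlinarith [sq_nonneg (1 / Hr * x - 72 * Hr * M * ρ)]
    have h5 : M ^ 2 * κ * ρ ≤ 2 * (M ^ 2 * κ * κ) := by
      have := mul_le_mul_of_nonneg_left hρκ (by positivity : 0 ≤ M ^ 2 * κ)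
      linarith
    have h6 := mul_le_mul_of_nonneg_right hw hρ
    have h7 : (12 * √(v * ρ)) ^ 2 = 144 * (v * ρ) := by rw [mul_pow, hs]; norm_num
    have h10 : (24 * (M * κ)) ^ 2 = 576 * (M ^ 2 * κ * κ) := by ring
    rw [h7, h10]
    have h11 : (4 * v + 8 * M * x + 8 * (M ^ 2 * κ)) * ρ =
      4 * (v * ρ) + 8 * M * x * ρ + 8 * (M ^ 2 * κ * ρ) := by ring
    linarith
  have h3 : 72 * Hr * M * ρ ≤ 144 * (Hr * (M * κ)) := by
    have := mul_le_mul_of_nonneg_left hρκ (by positivity : 0 ≤ 72 * Hr * M)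
    linarith
  have h4 : M * κ ≤ Hr * (M * κ) := le_mul_of_one_le_left (by positivity) hH
  linarith

/-- Empirical quantities are moved to the true kernel and `upV` to the value of the played policy,
their difference being bounded by the gap itself. The factors (1 + 3/H)(1 + 1/H) ≤ 1 + 7/H and a
further 1/H from the variance give 1 + 8/H. -/
theorem IsGood.stepGap_le (hG : IsGood M δ t D) (hδ : 0 < δ) (hδ1 : δ < 1) (h : Fin H) (s : S)
    (a : A) (h0 : count D h s a ≠ 0) :
    stepGap D δ h (gap D δ (h.val + 1)) s a ≤
      pairBonus M δ D h s a + (1 + 8 / (H : ℝ)) * mean (M.p h s a) (gap D δ (h.val + 1)) := by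
  have : Nonempty S := ⟨s⟩
  set g := gap D δ (h.val + 1) with hg
  set Vu := upV D δ (h.val + 1) with hVu
  set W := M.polV (optimistic D δ) (h.val + 1) with hW
  set R := Real.log (Fintype.card S * Fintype.card A) with hR
  set κ := rateKL D δ h s a with hκ
  have hH : (1 : ℝ) ≤ H := by exact_mod_cast h.pos
  have hH0 : (0 : ℝ) < H := by linarith
  have hR0 : 0 ≤ R := log_card_mul_card_nonneg S A
  have hM : maxVal S A H = H * R := rfl
  have hM0 := maxVal_nonneg S A H
  have hκ0 : 0 ≤ κ := rateKL_nonneg D δ h s a hδ hδ1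
  have hp := pHat_mem D h s a
  have hq := M.p_mem h s a
  have hg0 : ∀ s, 0 ≤ g s := fun s => (gap_mem D δ (h := h.val + 1) h.isLt s).1
  have hgM : ∀ s, g s ≤ maxVal S A H := fun s => (gap_mem D δ (h := h.val + 1) h.isLt s).2
  have hx0 := mean_nonneg hq hg0
  have hel1 : hel (M.p h s a) (pHat D h s a) ≤ κ := by
    rw [hel_comm]
    exact hG.hel_le h s a h0
  have hA : Real.log (Fintype.card A) ≤ maxVal S A H := by
    have h1 : Real.log (Fintype.card A) ≤ R := by
      rw [hR, log_card_mul_card]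
      exact le_add_of_nonneg_left (log_card_nonneg S)
    rw [hM]
    exact h1.trans (le_mul_of_one_le_left hR0 hH)
  have hV0 : ∀ s, 0 ≤ Vu s := upV_nonneg D δ h.isLt
  have hV2 : ∀ s, Vu s ≤ 2 * maxVal S A H := fun s => by
    linarith [upV_le D δ (h := h.val + 1) h.isLt s]
  -- transfer of the gap to the true transitions
  have e1 := mean_le_hel (f := g) (c := maxVal S A H) (η := 1 / (H : ℝ)) hq hp (by positivity)
    hg0 hgM
  rw [one_div_one_div] at e1
  have e2 : (1 + (H : ℝ)) * (maxVal S A H * hel (M.p h s a) (pHat D h s a)) ≤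
      2 * (H ^ 2 * R * κ) := by
    have h1 := mul_le_mul_of_nonneg_left hel1 hM0
    have h2 := mul_le_mul_of_nonneg_left h1 (by linarith : (0 : ℝ) ≤ 1 + H)
    refine h2.trans ?_
    rw [hM]
    have h3 : 0 ≤ (H : ℝ) * R * κ := by positivity
    nlinarith
  have e3 : (1 + 3 / (H : ℝ)) * mean (pHat D h s a) g ≤
      (1 + 7 / (H : ℝ)) * mean (M.p h s a) g + 8 * (H ^ 2 * R * κ) := by
    have h1 : (1 + 3 / (H : ℝ)) * mean (pHat D h s a) g ≤ (1 + 3 / (H : ℝ)) *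
        ((1 + 1 / (H : ℝ)) * mean (M.p h s a) g + 2 * (H ^ 2 * R * κ)) :=
      mul_le_mul_of_nonneg_left (e1.trans (add_le_add le_rfl e2)) (by positivity)
    have hi : 1 / (H : ℝ) ≤ 1 := (div_le_one hH0).2 hH
    have hi0 : 0 ≤ 1 / (H : ℝ) := by positivity
    have e4 : (1 + 3 / (H : ℝ)) * (1 + 1 / (H : ℝ)) ≤ 1 + 7 / (H : ℝ) := by
      rw [show 3 / (H : ℝ) = 3 * (1 / H) by ring, show 7 / (H : ℝ) = 7 * (1 / H) by ring]
      nlinarith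
    have e5 := mul_le_mul_of_nonneg_right e4 hx0
    have e6 : 0 ≤ (H : ℝ) ^ 2 * R * κ := by positivity
    have e7 : 3 / (H : ℝ) ≤ 3 := by rw [show 3 / (H : ℝ) = 3 * (1 / H) by ring]; linarith
    have e8 := mul_le_mul_of_nonneg_right e7 e6
    nlinarith
  -- transfer of the variance
  have f1 := variance_le_hel (f := Vu) hq hp hV0 hV2
  have f2 := variance_le_add hq Vu W
  have hsub : ∀ s, 0 ≤ Vu s - W s ∧ Vu s - W s ≤ g s := fun s =>
    ⟨sub_nonneg.2 ((M.polV_le_optV (optimistic_mem D δ) (h := h.val + 1) h.isLt s).trans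
      (hG.optV_mem hδ hδ1 (h := h.val + 1) h.isLt s).2),
      hG.upV_sub_polV_le_gap hδ hδ1 (h := h.val + 1) h.isLt s⟩
  have f3 : mean (M.p h s a) (fun s' => (Vu s' - W s') ^ 2) ≤
      2 * maxVal S A H * mean (M.p h s a) g := by
    rw [← mean_mul_left]
    refine mean_mono hq fun s' => ?_
    have h1 := hsub s'
    have h2 : Vu s' - W s' ≤ 2 * maxVal S A H := by linarith [hgM s']
    rw [sq]
    exact mul_le_mul h2 h1.2 h1.1 (by linarith)
  have f4 : (2 * maxVal S A H) ^ 2 * hel (M.p h s a) (pHat D h s a) ≤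
      4 * (maxVal S A H ^ 2 * κ) := by
    have h1 := mul_le_mul_of_nonneg_left hel1 (sq_nonneg (maxVal S A H))
    linarith
  have f5 := sqrt_empirical_variance_le (w := variance (pHat D h s a) Vu) hH hM0
    (rateConc_nonneg D δ h s a hδ hδ1) (rateConc_le D δ h s a hδ hδ1) (variance_nonneg hq W) hx0
    (by linarith)
  rw [← hκ, hM, show (H : ℝ) * (H * R * κ) = H ^ 2 * R * κ by ring] at f5
  rw [stepGap, if_neg h0]
  have hpos : 0 ≤ (H : ℝ) ^ 2 * R * κ := by positivity
  have hb0 : 0 ≤ pairBonus M δ D h s a := by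
    rw [pairBonus]
    positivity
  refine max_le ((min_le_left _ _).trans ?_) (by positivity)
  have hmin := min_le_left (rateKL D δ h s a) (Real.log (Fintype.card S))
  change 2 * bonusB D δ h Vu s a + 2 * bonusEnt D δ h s a + _ + _ ≤ _
  have e9 : (1 + 8 / (H : ℝ)) * mean (M.p h s a) g =
      (1 + 7 / (H : ℝ)) * mean (M.p h s a) g + 1 / (H : ℝ) * mean (M.p h s a) g := by ring
  rw [bonusB, bonusEnt, pairBonus, e9, ← hR, ← hκ, ← hW]
  rw [← hκ] at hmin
  nlinarith

/-- The cost of a pair: the maximal value as long as it is not well explored. -/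
def pairCost (M : MDP S A H s₁) (δ : ℝ) (t : ℕ) (D : Fin t → Episode S A H) (h : Fin H) (s : S)
    (a : A) : ℝ :=
  if cumOcc M δ t D h s a < 4 * Real.log (16 * Fintype.card S * Fintype.card A * H / δ) then
    maxVal S A H else pairBonus M δ D h s a

theorem pairBonus_nonneg (M : MDP S A H s₁) {δ : ℝ} (hδ : 0 < δ) (hδ1 : δ < 1) {t : ℕ}
    (D : Fin t → Episode S A H) (h : Fin H) (s : S) (a : A) : 0 ≤ pairBonus M δ D h s a := by
  have h1 := rateKL_nonneg D δ h s a hδ hδ1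
  have h2 := log_card_mul_card_nonneg S A
  rw [pairBonus]
  positivity

theorem one_le_log_sixteen (h : Fin H) (s : S) (hδ : 0 < δ) (hδ1 : δ < 1) :
    1 ≤ Real.log (16 * Fintype.card S * Fintype.card A * H / δ) := by
  have h3 : (1 : ℝ) ≤ ((Fintype.card S * Fintype.card A * H : ℕ) : ℝ) := by
    exact_mod_cast Nat.one_le_iff_ne_zero.2
      (mul_ne_zero (mul_ne_zero (Fintype.card_pos_iff.2 ⟨s⟩).ne' Fintype.card_ne_zero) h.pos.ne')
  push_cast at h3
  have h4 : (16 : ℝ) ≤ 16 * Fintype.card S * Fintype.card A * H / δ := by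
    rw [le_div_iff₀ hδ]
    nlinarith
  rw [Real.le_log_iff_exp_le (by linarith)]
  linarith [Real.exp_one_lt_d9]

/-- Past the threshold in `pairCost` the logarithm in `cumOcc_le` is at most a quarter of `cumOcc`,
so true and expected visits are comparable. -/
theorem IsGood.cumOcc_div_four_le (hG : IsGood M δ t D) (h : Fin H) (s : S) (a : A)
    (hc : 4 * Real.log (16 * Fintype.card S * Fintype.card A * H / δ) ≤ cumOcc M δ t D h s a) :
    cumOcc M δ t D h s a / 4 ≤ count D h s a := by
  have := hG.cumOcc_le h s a
  linarith

/-- The recursion is unrolled with factor 1 + 8/H, and (1 + 8/H)^H ≤ exp 8. Pairs that are not yet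
well explored are charged the maximal value. -/
theorem IsGood.gap_le (hG : IsGood M δ t D) (hδ : 0 < δ) (hδ1 : δ < 1) :
    gap D δ 0 s₁ ≤ Real.exp 8 * ∑ h, ∑ s, ∑ a,
      M.occ (optimisticPolicy δ t D) h s a * pairCost M δ t D h s a := by
  rcases Nat.eq_zero_or_pos H with rfl | hH
  · rw [gap_last]
    simp
  have hH0 : (0 : ℝ) < H := by exact_mod_cast hH
  have hr : ∀ h s a, 0 ≤ pairCost M δ t D h s a := fun h s a => by
    rw [pairCost]
    split_ifs
    · exact maxVal_nonneg S A H
    · exact pairBonus_nonneg M hδ hδ1 D h s a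
  have h1 := M.le_sum_occ_of_bellman (optimistic D δ) (optimistic_mem D δ)
    (r := pairCost M δ t D) (g := gap D δ) (c := 1 + 8 / (H : ℝ))
    (le_add_of_nonneg_right (by positivity)) hr (fun h s => by
      rw [gap_of_lt]
      refine mean_mono (optimistic_mem D δ h s) fun a => ?_
      have hx0 := mean_nonneg (M.p_mem h s a)
        fun s => (gap_mem D δ (h := h.val + 1) h.isLt s).1
      rw [pairCost]
      split_ifs with hc
      · refine (stepGap_mem D δ h _ s a).2.trans (le_add_of_nonneg_right ?_)
        positivity
      · refine hG.stepGap_le hδ hδ1 h s a fun h0 => ?_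
        have h2 := hG.cumOcc_div_four_le h s a (not_lt.1 hc)
        have h3 := one_le_log_sixteen (A := A) h s hδ hδ1
        rw [h0, Nat.cast_zero] at h2
        linarith [not_lt.1 hc]) (fun s => (gap_last D δ s).le)
  refine h1.trans (mul_le_mul_of_nonneg_right ?_ ?_)
  · have h2 : 1 + 8 / (H : ℝ) ≤ Real.exp (8 / H) := by
      have := Real.add_one_le_exp (8 / (H : ℝ))
      linarith
    refine (pow_le_pow_left₀ (by positivity) h2 H).trans_eq ?_
    rw [← Real.exp_nat_mul, mul_div_cancel₀ _ hH0.ne']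
  · exact Finset.sum_nonneg fun h _ => Finset.sum_nonneg fun s _ => Finset.sum_nonneg fun a _ =>
      mul_nonneg (M.occ_nonneg _ (optimistic_mem D δ) h s a) (hr h s a)

end good

end

section

variable {S : Type u} {A : Type v} [Fintype S] [DecidableEq S] [Fintype A] [DecidableEq A]
  {H : ℕ} {s₁ : S}

/-! ### Sums along a run of the algorithm -/

section potentials

variable {q : ℕ → ℝ}

/-- Potential argument: with N the current sum and x = q / (1 + N), the summand is at most 2x ≤ 4
log (1 + x), an increment of 4 log (1 + N). -/
theorem sum_range_div_max_le (h0 : ∀ t, 0 ≤ q t) (h1 : ∀ t, q t ≤ 1) (T : ℕ) :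
    ∑ t ∈ Finset.range T, q t * (1 / max 1 (∑ i ∈ Finset.range t, q i)) ≤
      4 * Real.log (1 + T) := by
  have hN : ∀ t, 0 ≤ ∑ i ∈ Finset.range t, q i := fun t => Finset.sum_nonneg fun i _ => h0 i
  have key : ∑ t ∈ Finset.range T, q t * (1 / max 1 (∑ i ∈ Finset.range t, q i)) ≤
      4 * Real.log (1 + ∑ i ∈ Finset.range T, q i) := by
    induction T with
    | zero => simp
    | succ T ih =>
      rw [Finset.sum_range_succ, Finset.sum_range_succ]
      set N := ∑ i ∈ Finset.range T, q i with hNd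
      have hN0 : 0 ≤ N := hN T
      set x := q T / (1 + N) with hx
      have hq0 := h0 T
      have hq1 := h1 T
      have hx0 : 0 ≤ x := by positivity
      have hx1 : x ≤ 1 := (div_le_one (by positivity)).2 (by linarith)
      have e1 : Real.log (1 + (N + q T)) = Real.log (1 + N) + Real.log (1 + x) := by
        rw [← Real.log_mul (by positivity) (by positivity), hx]
        congr 1
        field_simp
        ring
      have e2 : x / 2 ≤ Real.log (1 + x) := by
        have h2 := Real.one_sub_inv_le_log_of_pos (by positivity : 0 < 1 + x)
        refine le_trans ?_ h2
        have : 1 - (1 + x)⁻¹ = x / (1 + x) := by field_simp; ring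
        rw [this]
        exact div_le_div_of_nonneg_left hx0 (by positivity) (by linarith)
      have e3 : q T * (1 / max 1 N) ≤ 2 * x := by
        have h3 : (1 + N) / 2 ≤ max 1 N := by
          rcases le_total 1 N with h | h
          · rw [max_eq_right h]; linarith
          · rw [max_eq_left h]; linarith
        have h4 : 1 / max 1 N ≤ 1 / ((1 + N) / 2) := one_div_le_one_div_of_le (by positivity) h3
        refine (mul_le_mul_of_nonneg_left h4 hq0).trans_eq ?_
        rw [hx]
        field_simp
      rw [e1]
      linarith
  refine key.trans ?_
  have hT : ∑ i ∈ Finset.range T, q i ≤ T := by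
    refine (Finset.sum_le_sum fun i _ => h1 i).trans_eq ?_
    simp
  have := hN T
  gcongr

/-- Terms are counted only until the running sum reaches c, with an overshoot of at most one term;
the induction also carries the comparison with the full sum. -/
theorem sum_range_ite_lt_le (h0 : ∀ t, 0 ≤ q t) (h1 : ∀ t, q t ≤ 1) {c : ℝ} (hc : 0 ≤ c) (T : ℕ) :
    ∑ t ∈ Finset.range T, (if ∑ i ∈ Finset.range t, q i < c then q t else 0) ≤ c + 1 := by
  suffices h : ∑ t ∈ Finset.range T, (if ∑ i ∈ Finset.range t, q i < c then q t else 0) ≤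
      ∑ i ∈ Finset.range T, q i ∧
      ∑ t ∈ Finset.range T, (if ∑ i ∈ Finset.range t, q i < c then q t else 0) ≤ c + 1 from h.2
  induction T with
  | zero => simp; linarith
  | succ T ih =>
    rw [Finset.sum_range_succ, Finset.sum_range_succ]
    have := h0 T
    have := h1 T
    split_ifs with h
    · constructor <;> linarith [ih.1]
    · constructor <;> linarith [ih.1, ih.2]

end potentials

/-- The quantity `log(SAH/δ)`. -/
def logConf (S A H : ℕ) (δ : ℝ) : ℝ := Real.log (S * A * H / δ)

/-! ### Confidence levels in terms of log(SAH/δ) and log(1+T) -/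

section betas

variable {s a H : ℕ} {δ : ℝ}

theorem log_two_le_logConf (hsa : 2 ≤ s * a) (hH : 1 ≤ H) (hδ : 0 < δ) (hδ1 : δ < 1) :
    Real.log 2 ≤ logConf s a H δ := by
  refine Real.log_le_log two_pos ?_
  have h1 : (2 : ℝ) ≤ ((s * a * H : ℕ) : ℝ) := by exact_mod_cast hsa.trans (Nat.le_mul_of_pos_right _ hH)
  push_cast at h1
  rw [le_div_iff₀ hδ]
  nlinarith

theorem log_mul_logConf (hsa : 2 ≤ s * a) (hH : 1 ≤ H) (hδ : 0 < δ) {c : ℝ} (hc : 0 < c) :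
    Real.log (c * s * a * H / δ) = Real.log c + logConf s a H δ := by
  have h1 : (0 : ℝ) < (s * a : ℕ) := by exact_mod_cast (by omega : 0 < s * a)
  have h2 : (0 : ℝ) < H := by exact_mod_cast hH
  push_cast at h1
  rw [logConf, ← Real.log_mul hc.ne' (by positivity)]
  congr 1
  ring

/-- Lets additive constants be absorbed into logarithms that are at least log 2. -/
theorem one_le_log_two : 1 ≤ 1.45 * Real.log 2 := by
  have := Real.log_two_gt_d9
  norm_num at this ⊢
  linarith

theorem log_four : Real.log 4 = 2 * Real.log 2 := by
  rw [show (4 : ℝ) = 2 ^ 2 by norm_num, Real.log_pow]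
  norm_num

variable {n T : ℕ}
  (hnT : n ≤ T)

theorem log_two_le_log_one_add (hT : 1 ≤ T) : Real.log 2 ≤ Real.log (1 + T) :=
  Real.log_le_log two_pos (by
    have : (1 : ℝ) ≤ T := by exact_mod_cast hT
    linarith)

theorem betaConc_le_logs (hsa : 2 ≤ s * a) (hH : 1 ≤ H) (hδ : 0 < δ) (hδ1 : δ < 1) (hn : 1 ≤ n)
    (hnT : n ≤ T) :
    betaConc s a H δ n ≤ 7 * (logConf s a H δ + Real.log (1 + T)) := by
  have hn' : (1 : ℝ) ≤ n := by exact_mod_cast hn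
  have hnT' : (n : ℝ) ≤ T := by exact_mod_cast hnT
  have h1 := log_two_le_logConf hsa hH hδ hδ1
  have h2 := log_two_le_log_one_add (hn.trans hnT)
  have h3 : Real.log (4 * Real.exp 1 * n * (2 * n + 1)) ≤
      3 * Real.log 2 + 1 + 2 * Real.log (1 + T) := by
    have e1 : 3 * Real.log 2 + 1 + 2 * Real.log (1 + T) =
        Real.log (2 ^ 3 * Real.exp 1 * (1 + T) ^ 2) := by
      rw [Real.log_mul (by positivity) (by positivity), Real.log_mul (by positivity)
        (by positivity), Real.log_exp, Real.log_pow, Real.log_pow]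
      norm_num
    rw [e1]
    refine Real.log_le_log (by positivity) ?_
    have h5 : (n : ℝ) * (2 * n + 1) ≤ 2 * (1 + T) ^ 2 := by nlinarith
    have h6 : 0 < Real.exp 1 := Real.exp_pos 1
    nlinarith
  have h7 := one_le_log_two
  rw [betaConc, log_mul_logConf hsa hH hδ (by norm_num), log_four]
  linarith

theorem betaEnt_le_logs (hsa : 2 ≤ s * a) (hH : 1 ≤ H) (hδ : 0 < δ) (hδ1 : δ < 1) (hn : 1 ≤ n)
    (hnT : n ≤ T) :
    betaEnt s a H δ n ≤ 3 * (Real.log (1 + T) ^ 2 * (logConf s a H δ + Real.log (1 + T))) := by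
  have hn' : (1 : ℝ) ≤ n := by exact_mod_cast hn
  have hnT' : (n : ℝ) ≤ T := by exact_mod_cast hnT
  have h1 := log_two_le_logConf hsa hH hδ hδ1
  have h0 : 0 < Real.log 2 := Real.log_pos one_lt_two
  have h2 := log_two_le_log_one_add (hn.trans hnT)
  have h3 : Real.log n ≤ Real.log (1 + T) := Real.log_le_log (by linarith) (by linarith)
  have h4 : Real.log ((n : ℝ) + 1) ≤ Real.log (1 + T) :=
    Real.log_le_log (by linarith) (by linarith)
  have h5 : 0 ≤ Real.log n := Real.log_nonneg hn'
  have h6 : Real.log n ^ 2 ≤ Real.log (1 + T) ^ 2 := pow_le_pow_left₀ h5 h3 2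
  rw [betaEnt, log_mul_logConf hsa hH hδ (by norm_num), log_four,
    Real.log_mul (by positivity) (by positivity)]
  calc _ ≤ Real.log (1 + T) ^ 2 * (3 * (logConf s a H δ + Real.log (1 + T))) := by
        have h8 : 0 ≤ Real.log ((n : ℝ) + 1) := Real.log_nonneg (by linarith)
        refine mul_le_mul h6 ?_ ?_ (sq_nonneg _)
        · linarith
        · linarith
    _ = _ := by ring

theorem betaKL_le_logs (hsa : 2 ≤ s * a) (hH : 1 ≤ H) (hδ : 0 < δ) (hδ1 : δ < 1) (hn : 1 ≤ n)
    (hnT : n ≤ T) :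
    betaKL s a H δ n ≤ 3 * (logConf s a H δ + s * Real.log (1 + T)) := by
  have hnT' : (n : ℝ) ≤ T := by exact_mod_cast hnT
  have h1 := log_two_le_logConf hsa hH hδ hδ1
  have h2 := log_two_le_log_one_add (hn.trans hnT)
  have h7 := one_le_log_two
  have h3 : Real.log (Real.exp 1 * (1 + n)) ≤ 3 * Real.log (1 + T) := by
    rw [Real.log_mul (Real.exp_pos 1).ne' (by positivity), Real.log_exp]
    have : Real.log (1 + (n : ℝ)) ≤ Real.log (1 + T) :=
      Real.log_le_log (by positivity) (by linarith)
    linarith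
  have h4 := mul_le_mul_of_nonneg_left h3 (Nat.cast_nonneg s : (0 : ℝ) ≤ s)
  rw [betaKL, log_mul_logConf hsa hH hδ (by norm_num), log_four]
  linarith

end betas

theorem log_two_le_log_card_mul_card (hsa : 2 ≤ Fintype.card S * Fintype.card A) :
    Real.log 2 ≤ Real.log (Fintype.card S * Fintype.card A) :=
  Real.log_le_log two_pos (by exact_mod_cast hsa)

section run

variable [Nonempty A] {M : MDP S A H s₁} {δ : ℝ}

/-- The cost of a well-explored pair in terms of the expected number of visits. -/
theorem IsGood.pairBonus_le {t T : ℕ} {D : Fin t → Episode S A H} (hG : IsGood M δ t D)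
    (hsa : 2 ≤ Fintype.card S * Fintype.card A) (hδ : 0 < δ) (hδ1 : δ < 1) (ht : t ≤ T) (h : Fin H)
    (s : S) (a : A)
    (hc : 4 * Real.log (16 * Fintype.card S * Fintype.card A * H / δ) ≤ cumOcc M δ t D h s a) :
    pairBonus M δ D h s a ≤
      64 * √(logConf (Fintype.card S) (Fintype.card A) H δ + Real.log (1 + T)) *
        √(variance (M.p h s a) (M.polV (optimistic D δ) (h.val + 1)) *
          (1 / max 1 (cumOcc M δ t D h s a))) +
      10 * √(Real.log (1 + T) ^ 2 *
          (logConf (Fintype.card S) (Fintype.card A) H δ + Real.log (1 + T))) *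
        √(1 / max 1 (cumOcc M δ t D h s a)) +
      2436 * ((H : ℝ) ^ 2 * Real.log (Fintype.card S * Fintype.card A) *
        (logConf (Fintype.card S) (Fintype.card A) H δ + Fintype.card S * Real.log (1 + T))) *
        (1 / max 1 (cumOcc M δ t D h s a)) := by
  have hH : 1 ≤ H := h.pos
  have hH' : (1 : ℝ) ≤ H := by exact_mod_cast hH
  have hl16 := one_le_log_sixteen (A := A) h s hδ hδ1
  have hcount := hG.cumOcc_div_four_le h s a hc
  set N := cumOcc M δ t D h s a with hN
  set n := count D h s a with hn
  have hN4 : 4 ≤ N := by linarith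
  have hn1 : (1 : ℝ) ≤ n := by linarith
  have hn1' : 1 ≤ n := by exact_mod_cast hn1
  have hnT : n ≤ T := (count_le D h s a).trans ht
  have hmax : max 1 N = N := max_eq_right (by linarith)
  rw [hmax]
  have hn0 : (0 : ℝ) < n := by linarith
  have hN0 : (0 : ℝ) < N := by linarith
  have hinv : 1 / (n : ℝ) ≤ 4 * (1 / N) := by
    rw [div_le_iff₀ hn0]
    have : 4 * (1 / N) * (N / 4) ≤ 4 * (1 / N) * n := by gcongr
    have e : 4 * (1 / N) * (N / 4) = 1 := by field_simp
    linarith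
  set ℓ := logConf (Fintype.card S) (Fintype.card A) H δ with hℓ
  set Λ := Real.log (1 + (T : ℝ)) with hΛ
  set R := Real.log (Fintype.card S * Fintype.card A) with hR
  have hℓ2 : Real.log 2 ≤ ℓ := log_two_le_logConf hsa hH hδ hδ1
  have hΛ2 : Real.log 2 ≤ Λ := log_two_le_log_one_add (hn1'.trans hnT)
  have hR2 : Real.log 2 ≤ R := log_two_le_log_card_mul_card hsa
  have h02 : 0 < Real.log 2 := Real.log_pos one_lt_two
  have h12 := one_le_log_two
  have hρ : rateConc D δ h s a ≤ 28 * (ℓ + Λ) * (1 / N) := by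
    rw [rateConc, div_eq_mul_one_div]
    have h1 := betaConc_le_logs hsa hH hδ hδ1 hn1' hnT
    calc _ ≤ 7 * (ℓ + Λ) * (4 * (1 / N)) := mul_le_mul h1 hinv (by positivity) (by linarith)
      _ = _ := by ring
  have hκ : rateKL D δ h s a ≤ 12 * ((ℓ + Fintype.card S * Λ) * (1 / N)) := by
    rw [rateKL, div_eq_mul_one_div]
    have h1 := betaKL_le_logs hsa hH hδ hδ1 hn1' hnT
    have h2 : 0 ≤ (Fintype.card S : ℝ) * Λ := mul_nonneg (Nat.cast_nonneg _) (by linarith)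
    calc _ ≤ 3 * (ℓ + Fintype.card S * Λ) * (4 * (1 / N)) :=
          mul_le_mul h1 hinv (by positivity) (by linarith)
      _ = _ := by ring
  have hE : 2 * betaEnt (Fintype.card S) (Fintype.card A) H δ n / n ≤
      25 * ((Λ ^ 2 * (ℓ + Λ)) * (1 / N)) := by
    rw [div_eq_mul_one_div]
    have h1 := betaEnt_le_logs hsa hH hδ hδ1 hn1' hnT
    have h2 : 0 ≤ Λ ^ 2 * (ℓ + Λ) := mul_nonneg (sq_nonneg _) (by linarith)
    calc _ ≤ 2 * (3 * (Λ ^ 2 * (ℓ + Λ))) * (4 * (1 / N)) :=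
          mul_le_mul (by linarith) hinv (by positivity) (by linarith)
      _ ≤ _ := by nlinarith [mul_nonneg h2 (by positivity : 0 ≤ 1 / N)]
  set v := variance (M.p h s a) (M.polV (optimistic D δ) (h.val + 1)) with hv
  have hv0 : 0 ≤ v := variance_nonneg (M.p_mem h s a) _
  have t1 : 12 * √(v * rateConc D δ h s a) ≤ 64 * √(ℓ + Λ) * √(v * (1 / N)) := by
    -- 28 ≤ (16/3)², and 12 · 16/3 = 64.
    have h1 : v * rateConc D δ h s a ≤ (16 / 3) ^ 2 * ((ℓ + Λ) * (v * (1 / N))) := by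
      have h2 := mul_le_mul_of_nonneg_left hρ hv0
      have h3 : 0 ≤ (ℓ + Λ) * (v * (1 / N)) :=
        mul_nonneg (by linarith) (mul_nonneg hv0 (by positivity))
      nlinarith
    have h2 := Real.sqrt_le_sqrt h1
    rw [Real.sqrt_mul (by norm_num : (0 : ℝ) ≤ (16 / 3) ^ 2), Real.sqrt_sq (by norm_num),
      Real.sqrt_mul (by linarith : 0 ≤ ℓ + Λ)] at h2
    linarith
  have t2 : 2 * √(2 * betaEnt (Fintype.card S) (Fintype.card A) H δ n / n) ≤
      10 * √(Λ ^ 2 * (ℓ + Λ)) * √(1 / N) := by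
    have h2 := Real.sqrt_le_sqrt hE
    rw [show (25 : ℝ) = 5 ^ 2 by norm_num, Real.sqrt_mul (by norm_num : (0 : ℝ) ≤ 5 ^ 2),
      Real.sqrt_sq (by norm_num), Real.sqrt_mul (mul_nonneg (sq_nonneg Λ) (by linarith) : 0 ≤ Λ ^ 2 * (ℓ + Λ))] at h2
    linarith
  have t3 : 2 * rateKL D δ h s a + 200 * ((H : ℝ) ^ 2 * R * rateKL D δ h s a) ≤
      2436 * ((H : ℝ) ^ 2 * R * (ℓ + Fintype.card S * Λ)) * (1 / N) := by
    -- Turns 2κ into 3 H² R κ; together with the 200 and the factor 12 of `hκ` this makes 203 · 12 =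
    -- 2436.
    have h1 : 1 ≤ 1.5 * ((H : ℝ) ^ 2 * R) := by
      have : R ≤ (H : ℝ) ^ 2 * R := le_mul_of_one_le_left (by linarith) (one_le_pow₀ hH')
      linarith
    have h2 := rateKL_nonneg D δ h s a hδ hδ1
    have h3 : 2 * rateKL D δ h s a ≤ 3 * ((H : ℝ) ^ 2 * R * rateKL D δ h s a) := by
      have := mul_le_mul_of_nonneg_right h1 h2
      linarith
    have h4 := mul_le_mul_of_nonneg_left hκ
      (mul_nonneg (sq_nonneg (H : ℝ)) (by linarith : (0 : ℝ) ≤ R))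
    calc _ ≤ 203 * ((H : ℝ) ^ 2 * R * rateKL D δ h s a) := by linarith
      _ ≤ 203 * ((H : ℝ) ^ 2 * R * (12 * ((ℓ + Fintype.card S * Λ) * (1 / N)))) := by linarith
      _ = _ := by ring
  rw [pairBonus, ← hv, ← hR, ← hn]
  linarith

theorem cumOcc_firstEpisodes (M : MDP S A H s₁) (δ : ℝ) (D : ℕ → Episode S A H) (t : ℕ) (h : Fin H)
    (s : S) (a : A) :
    cumOcc M δ t (firstEpisodes D t) h s a =
      ∑ i ∈ Finset.range t, M.occ (optimisticPolicy δ i (firstEpisodes D i)) h s a := by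
  rw [Finset.sum_range]
  rfl

/-- As long as UCBVI-Ent does not stop, the number of episodes satisfies this inequality. -/
theorem mul_le_of_forall_isGood (D : ℕ → Episode S A H) {T : ℕ} {ε : ℝ}
    (hsa : 2 ≤ Fintype.card S * Fintype.card A) (hH : 1 ≤ H) (hδ : 0 < δ) (hδ1 : δ < 1)
    (hG : ∀ t, IsGood M δ t (firstEpisodes D t))
    (hgap : ∀ t < T, ε ≤ gap (firstEpisodes D t) δ 0 s₁) :
    ε * T ≤ Real.exp 8 *
      (maxVal S A H * (H * (Fintype.card S * Fintype.card A) *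
        (4 * Real.log (16 * Fintype.card S * Fintype.card A * H / δ) + 1)) +
      64 * √(logConf (Fintype.card S) (Fintype.card A) H δ + Real.log (1 + T)) *
        (√(T * maxVal S A H ^ 2) *
          √(H * (Fintype.card S * Fintype.card A) * (4 * Real.log (1 + T)))) +
      10 * √(Real.log (1 + T) ^ 2 *
          (logConf (Fintype.card S) (Fintype.card A) H δ + Real.log (1 + T))) *
        (√(T * H) * √(H * (Fintype.card S * Fintype.card A) * (4 * Real.log (1 + T)))) +
      2436 * ((H : ℝ) ^ 2 * Real.log (Fintype.card S * Fintype.card A) *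
        (logConf (Fintype.card S) (Fintype.card A) H δ + Fintype.card S * Real.log (1 + T))) *
        (H * (Fintype.card S * Fintype.card A) * (4 * Real.log (1 + T)))) := by
  set ℓ := logConf (Fintype.card S) (Fintype.card A) H δ with hℓ
  set Λ := Real.log (1 + (T : ℝ)) with hΛ
  set R := Real.log (Fintype.card S * Fintype.card A) with hR
  set c := 4 * Real.log (16 * Fintype.card S * Fintype.card A * H / δ) with hc
  let q : ℕ → Fin H × S × A → ℝ :=
    fun t x => M.occ (optimisticPolicy δ t (firstEpisodes D t)) x.1 x.2.1 x.2.2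
  let N : ℕ → Fin H × S × A → ℝ := fun t x => ∑ i ∈ Finset.range t, q i x
  let V : ℕ → Fin H × S × A → ℝ := fun t x =>
    variance (M.p x.1 x.2.1 x.2.2) (M.polV (optimistic (firstEpisodes D t) δ) (x.1.val + 1))
  let U : ℕ → Fin H × S × A → ℝ := fun t x => 1 / max 1 (N t x)
  have hq0 : ∀ t x, 0 ≤ q t x := fun t x => M.occ_nonneg _ (optimistic_mem _ δ) _ _ _
  have hq1 : ∀ t x, q t x ≤ 1 := fun t x => M.occ_le_one _ (optimistic_mem _ δ) _ _ _
  have hV0 : ∀ t x, 0 ≤ V t x := fun t x => variance_nonneg (M.p_mem _ _ _) _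
  have hU0 : ∀ t x, 0 ≤ U t x := fun t x => by
    have : 0 < max 1 (N t x) := zero_lt_one.trans_le (le_max_left _ _)
    positivity
  have hN : ∀ t x, cumOcc M δ t (firstEpisodes D t) x.1 x.2.1 x.2.2 = N t x :=
    fun t x => cumOcc_firstEpisodes M δ D t _ _ _
  have hM0 := maxVal_nonneg S A H
  -- The occupancy q is written as √q · √q, so that the square-root bonuses become products suited
  -- to Cauchy-Schwarz over episodes and triples.
  have hpt : ∀ t ∈ Finset.range T, ∀ x, q t x *
      pairCost M δ t (firstEpisodes D t) x.1 x.2.1 x.2.2 ≤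
      maxVal S A H * (if N t x < c then q t x else 0) +
      64 * √(ℓ + Λ) * (√(q t x * V t x) * √(q t x * U t x)) +
      10 * √(Λ ^ 2 * (ℓ + Λ)) * (√(q t x) * √(q t x * U t x)) +
      2436 * ((H : ℝ) ^ 2 * R * (ℓ + Fintype.card S * Λ)) * (q t x * U t x) := by
    intro t ht x
    have hℓ0 : 0 ≤ ℓ := (Real.log_pos one_lt_two).le.trans (log_two_le_logConf hsa hH hδ hδ1)
    have hΛ0 : 0 ≤ Λ := Real.log_nonneg (by linarith [(Nat.cast_nonneg T : (0 : ℝ) ≤ T)])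
    have hR0 : 0 ≤ R := log_card_mul_card_nonneg S A
    have p1 := hq0 t x
    have p2 := hU0 t x
    rw [pairCost, hN, ← hc]
    split_ifs with hlt
    · have : 0 ≤ 64 * √(ℓ + Λ) * (√(q t x * V t x) * √(q t x * U t x)) +
        10 * √(Λ ^ 2 * (ℓ + Λ)) * (√(q t x) * √(q t x * U t x)) +
        2436 * ((H : ℝ) ^ 2 * R * (ℓ + Fintype.card S * Λ)) * (q t x * U t x) := by positivity
      linarith
    · have h1 := (hG t).pairBonus_le hsa hδ hδ1 (Finset.mem_range.1 ht).le x.1 x.2.1 x.2.2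
        (by rw [hN]; exact not_lt.1 hlt)
      rw [hN] at h1
      have h2 := mul_le_mul_of_nonneg_left h1 p1
      have e1 : √(q t x * V t x) * √(q t x * U t x) = q t x * √(V t x * U t x) := by
        rw [← Real.sqrt_mul (mul_nonneg p1 (hV0 t x)),
          show q t x * V t x * (q t x * U t x) = q t x ^ 2 * (V t x * U t x) by ring,
          Real.sqrt_mul (sq_nonneg _), Real.sqrt_sq p1]
      have e2 : √(q t x) * √(q t x * U t x) = q t x * √(U t x) := by
        rw [← Real.sqrt_mul p1, ← mul_assoc, Real.sqrt_mul (mul_self_nonneg _),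
          Real.sqrt_mul_self p1]
      rw [e1, e2, mul_zero, zero_add]
      refine h2.trans_eq ?_
      change q t x * (64 * √(ℓ + Λ) * √(V t x * U t x) + 10 * √(Λ ^ 2 * (ℓ + Λ)) * √(U t x) +
        2436 * ((H : ℝ) ^ 2 * R * (ℓ + Fintype.card S * Λ)) * U t x) = _
      ring
  have hcard : ((Fintype.card (Fin H × S × A) : ℕ) : ℝ) =
      H * (Fintype.card S * Fintype.card A) := by
    simp [Fintype.card_prod]
  have s1 : ∑ y ∈ Finset.range T ×ˢ (Finset.univ : Finset (Fin H × S × A)),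
      (if N y.1 y.2 < c then q y.1 y.2 else 0) ≤
      H * (Fintype.card S * Fintype.card A) * (c + 1) := by
    rw [Finset.sum_product_right]
    refine (Finset.sum_le_sum fun x _ => sum_range_ite_lt_le (q := fun t => q t x)
      (fun t => hq0 t x) (fun t => hq1 t x) ?_ T).trans_eq ?_
    · have := one_le_log_sixteen (A := A) x.1 x.2.1 hδ hδ1
      linarith
    · rw [Finset.sum_const, Finset.card_univ, nsmul_eq_mul, hcard]
  have s2 : ∑ y ∈ Finset.range T ×ˢ (Finset.univ : Finset (Fin H × S × A)),
      q y.1 y.2 * U y.1 y.2 ≤ H * (Fintype.card S * Fintype.card A) * (4 * Λ) := by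
    rw [Finset.sum_product_right]
    refine (Finset.sum_le_sum fun x _ => sum_range_div_max_le (q := fun t => q t x)
      (fun t => hq0 t x) (fun t => hq1 t x) T).trans_eq ?_
    rw [Finset.sum_const, Finset.card_univ, nsmul_eq_mul, hcard]
  -- Total variance per episode: `maxVal ^ 2` instead of H times that. This is what gives H³ in the
  -- leading term.
  have s3 : ∑ y ∈ Finset.range T ×ˢ (Finset.univ : Finset (Fin H × S × A)),
      q y.1 y.2 * V y.1 y.2 ≤ T * maxVal S A H ^ 2 := by
    rw [Finset.sum_product]
    refine (Finset.sum_le_sum fun t _ => (?_ : _ ≤ maxVal S A H ^ 2)).trans_eq ?_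
    · have h1 := M.sum_occ_variance_le (optimistic (firstEpisodes D t) δ)
        (optimistic_mem (firstEpisodes D t) δ)
      simp only [Fintype.sum_prod_type]
      exact h1
    · simp
  have s4 : ∑ y ∈ Finset.range T ×ˢ (Finset.univ : Finset (Fin H × S × A)), q y.1 y.2 ≤
      T * H := by
    rw [Finset.sum_product]
    refine (Finset.sum_le_sum fun t _ => (?_ : _ ≤ (H : ℝ))).trans_eq ?_
    · simp only [Fintype.sum_prod_type]
      refine (Finset.sum_le_sum fun h _ => (M.sum_occ (optimistic (firstEpisodes D t) δ)
        (optimistic_mem (firstEpisodes D t) δ) h).le).trans_eq ?_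
      simp
    · simp
  have s5 : ∑ y ∈ Finset.range T ×ˢ (Finset.univ : Finset (Fin H × S × A)),
      √(q y.1 y.2 * V y.1 y.2) * √(q y.1 y.2 * U y.1 y.2) ≤
      √(T * maxVal S A H ^ 2) * √(H * (Fintype.card S * Fintype.card A) * (4 * Λ)) :=
    (Real.sum_sqrt_mul_sqrt_le _ (fun y => mul_nonneg (hq0 _ _) (hV0 _ _))
      (fun y => mul_nonneg (hq0 _ _) (hU0 _ _))).trans
      (mul_le_mul (Real.sqrt_le_sqrt s3) (Real.sqrt_le_sqrt s2) (Real.sqrt_nonneg _)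
        (Real.sqrt_nonneg _))
  have s6 : ∑ y ∈ Finset.range T ×ˢ (Finset.univ : Finset (Fin H × S × A)),
      √(q y.1 y.2) * √(q y.1 y.2 * U y.1 y.2) ≤
      √(T * H) * √(H * (Fintype.card S * Fintype.card A) * (4 * Λ)) :=
    (Real.sum_sqrt_mul_sqrt_le _ (fun y => hq0 _ _)
      (fun y => mul_nonneg (hq0 _ _) (hU0 _ _))).trans
      (mul_le_mul (Real.sqrt_le_sqrt s4) (Real.sqrt_le_sqrt s2) (Real.sqrt_nonneg _)
        (Real.sqrt_nonneg _))
  have hℓ0 : 0 ≤ ℓ := (Real.log_pos one_lt_two).le.trans (log_two_le_logConf hsa hH hδ hδ1)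
  have hΛ0 : 0 ≤ Λ := Real.log_nonneg (by linarith [(Nat.cast_nonneg T : (0 : ℝ) ≤ T)])
  have hR0 : 0 ≤ R := log_card_mul_card_nonneg S A
  have hsum : ∑ t ∈ Finset.range T, ∑ x, q t x *
      pairCost M δ t (firstEpisodes D t) x.1 x.2.1 x.2.2 ≤
      maxVal S A H * (H * (Fintype.card S * Fintype.card A) * (c + 1)) +
      64 * √(ℓ + Λ) * (√(T * maxVal S A H ^ 2) *
        √(H * (Fintype.card S * Fintype.card A) * (4 * Λ))) +
      10 * √(Λ ^ 2 * (ℓ + Λ)) *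
        (√(T * H) * √(H * (Fintype.card S * Fintype.card A) * (4 * Λ))) +
      2436 * ((H : ℝ) ^ 2 * R * (ℓ + Fintype.card S * Λ)) *
        (H * (Fintype.card S * Fintype.card A) * (4 * Λ)) := by
    refine (Finset.sum_le_sum fun t ht => Finset.sum_le_sum fun x _ => hpt t ht x).trans ?_
    rw [← Finset.sum_product']
    simp only [Finset.sum_add_distrib, ← Finset.mul_sum]
    gcongr
  have hgapsum : ε * T ≤ ∑ t ∈ Finset.range T, Real.exp 8 * ∑ x, q t x *
      pairCost M δ t (firstEpisodes D t) x.1 x.2.1 x.2.2 := by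
    have h1 : ε * T = ∑ t ∈ Finset.range T, ε := by simp [mul_comm]
    rw [h1]
    refine Finset.sum_le_sum fun t ht => (hgap t (Finset.mem_range.1 ht)).trans ?_
    have h2 := (hG t).gap_le hδ hδ1
    simp only [Fintype.sum_prod_type]
    exact h2
  rw [← Finset.mul_sum] at hgapsum
  exact hgapsum.trans (mul_le_mul_of_nonneg_left hsum (Real.exp_pos 8).le)

end run

end

/-! ### Solving the self-bounding inequality -/

/-- The arithmetic-geometric mean inequality 2εa√x ≤ ε²x + a² absorbs half of the left-hand side. -/
theorem le_of_mul_le_mul_sqrt_add {x a b ε : ℝ} (hε : 0 < ε) (hx : 0 ≤ x)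
    (h : ε * x ≤ a * √x + b) : x ≤ a ^ 2 / ε ^ 2 + 2 * b / ε := by
  have h1 : 2 * ε * (a * √x) ≤ ε ^ 2 * x + a ^ 2 := by
    have h2 := sq_nonneg (ε * √x - a)
    have h3 := Real.sq_sqrt hx
    nlinarith
  have h4 : ε ^ 2 * x ≤ a ^ 2 + 2 * b * ε := by nlinarith
  have h5 : a ^ 2 / ε ^ 2 + 2 * b / ε = (a ^ 2 + 2 * b * ε) / ε ^ 2 := by field_simp
  rw [h5, le_div_iff₀ (by positivity)]
  linarith

/-- An explicit value of the constant in `le_of_episode_bound`. -/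
def boundConst : ℝ := 46225 * Real.exp 16

theorem one_le_boundConst : 1 ≤ boundConst := by
  have := Real.add_one_le_exp (16 : ℝ)
  unfold boundConst
  linarith

/-- The logarithm Λ of 1 + T is treated as a fixed number, so the inequality is quadratic in √T. All
logarithms are at least log 2 and may be multiplied in at a factor 1.45. -/
theorem le_of_episode_bound {H c S R l Λ T ε : ℝ} (hH : 1 ≤ H) (hc : 0 ≤ c) (hS : 1 ≤ S)
    (hR : Real.log 2 ≤ R) (hl : Real.log 2 ≤ l) (hΛ : Real.log 2 ≤ Λ) (hT : 0 ≤ T) (hε : 0 < ε)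
    (h : ε * T ≤ Real.exp 8 *
      (H * R * (H * c * (4 * (4 * Real.log 2 + l) + 1)) +
      64 * √(l + Λ) * (√(T * (H * R) ^ 2) * √(H * c * (4 * Λ))) +
      10 * √(Λ ^ 2 * (l + Λ)) * (√(T * H) * √(H * c * (4 * Λ))) +
      2436 * (H ^ 2 * R * (l + S * Λ)) * (H * c * (4 * Λ)))) :
    T ≤ boundConst * (H ^ 3 * c * R ^ 2 * ((l + Λ) * Λ ^ 3) / ε ^ 2 +
      H ^ 3 * c * R * ((l + S * Λ) * Λ) / ε) := by
  have h12 := one_le_log_two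
  have h02 : 0 < Real.log 2 := Real.log_pos one_lt_two
  have hR1 : 1 ≤ 1.45 * R := by linarith
  have hΛ1 : 1 ≤ 1.45 * Λ := by linarith
  have hR0 : 0 ≤ R := by linarith
  have hl0 : 0 ≤ l := by linarith
  have hΛ0 : 0 ≤ Λ := by linarith
  have hH0 : 0 ≤ H := by linarith
  have hS0 : 0 ≤ S := by linarith
  set P := H ^ 3 * c * R ^ 2 * ((l + Λ) * Λ ^ 3) with hP
  set Q := H ^ 3 * c * R * ((l + S * Λ) * Λ) with hQ
  have hP0 : 0 ≤ P := by positivity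
  have hQ0 : 0 ≤ Q := by positivity
  have t1 : H * R * (H * c * (4 * (4 * Real.log 2 + l) + 1)) ≤ 32 * Q := by
    have h1 : 4 * (4 * Real.log 2 + l) + 1 ≤ 22 * l := by linarith
    have h2 : l ≤ 1.45 * ((l + S * Λ) * Λ) := by
      have : l * 1 ≤ l * (1.45 * Λ) := mul_le_mul_of_nonneg_left hΛ1 hl0
      have : 0 ≤ S * Λ * Λ := by positivity
      nlinarith
    have h3 : H ^ 2 ≤ H ^ 3 := pow_le_pow_right₀ hH (by norm_num)
    calc H * R * (H * c * (4 * (4 * Real.log 2 + l) + 1))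
        = H ^ 2 * (c * R * (4 * (4 * Real.log 2 + l) + 1)) := by ring
      _ ≤ H ^ 3 * (c * R * (22 * (1.45 * ((l + S * Λ) * Λ)))) := by
          gcongr
          linarith
      _ = 31.9 * Q := by rw [hQ]; ring
      _ ≤ 32 * Q := by linarith
  have t2 : √(l + Λ) * (√(T * (H * R) ^ 2) * √(H * c * (4 * Λ))) ≤ 2.9 * (√P * √T) := by
    rw [← Real.sqrt_mul (by positivity), ← Real.sqrt_mul (by positivity),
      ← Real.sqrt_mul hP0, ← Real.sqrt_sq (by norm_num : (0 : ℝ) ≤ 2.9),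
      ← Real.sqrt_mul (by positivity)]
    refine Real.sqrt_le_sqrt ?_
    have h1 : (1 : ℝ) ≤ (1.45 * Λ) ^ 2 := one_le_pow₀ hΛ1
    have h2 : 0 ≤ 4 * (H ^ 3 * c * R ^ 2 * ((l + Λ) * Λ) * T) := by positivity
    have h3 := mul_le_mul_of_nonneg_left h1 h2
    rw [hP]
    linarith
  have t3 : √(Λ ^ 2 * (l + Λ)) * (√(T * H) * √(H * c * (4 * Λ))) ≤ 2.9 * (√P * √T) := by
    rw [← Real.sqrt_mul (by positivity), ← Real.sqrt_mul (by positivity),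
      ← Real.sqrt_mul hP0, ← Real.sqrt_sq (by norm_num : (0 : ℝ) ≤ 2.9),
      ← Real.sqrt_mul (by positivity)]
    refine Real.sqrt_le_sqrt ?_
    have h1 : (1 : ℝ) ≤ (1.45 * R) ^ 2 := one_le_pow₀ hR1
    have h2 : 1 ≤ H * (1.45 * R) ^ 2 := by nlinarith
    have h3 : 0 ≤ 4 * (H ^ 2 * c * ((l + Λ) * Λ ^ 3) * T) := by positivity
    have h4 := mul_le_mul_of_nonneg_left h2 h3
    rw [hP]
    linarith
  have t4 : 2436 * (H ^ 2 * R * (l + S * Λ)) * (H * c * (4 * Λ)) = 9744 * Q := by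
    rw [hQ]
    ring
  have h8 := Real.exp_pos 8
  -- (64 + 10) · 2.9 ≤ 215 and 32 + 9744 = 9776.
  have hmain : ε * T ≤ 215 * Real.exp 8 * √P * √T + 9776 * Real.exp 8 * Q := by
    refine h.trans ?_
    have h0 : 0 ≤ √P * √T := by positivity
    calc _ ≤ Real.exp 8 * (32 * Q + 64 * (2.9 * (√P * √T)) + 10 * (2.9 * (√P * √T)) +
          9744 * Q) := by
          refine mul_le_mul_of_nonneg_left ?_ h8.le
          linarith
      _ ≤ Real.exp 8 * (215 * (√P * √T) + 9776 * Q) := by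
          refine mul_le_mul_of_nonneg_left ?_ h8.le
          linarith
      _ = _ := by ring
  have h16 : Real.exp 16 = Real.exp 8 ^ 2 := by
    rw [← Real.exp_nat_mul]
    norm_num
  refine (le_of_mul_le_mul_sqrt_add hε hT hmain).trans ?_
  have e1 : (215 * Real.exp 8 * √P) ^ 2 / ε ^ 2 = boundConst * (P / ε ^ 2) := by
    rw [mul_pow, Real.sq_sqrt hP0, boundConst, h16]
    ring
  have e2 : 2 * (9776 * Real.exp 8 * Q) / ε ≤ boundConst * (Q / ε) := by
    have h9 := Real.add_one_le_exp (8 : ℝ)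
    have : 2 * 9776 * Real.exp 8 ≤ boundConst := by
      rw [boundConst, h16]
      nlinarith
    calc _ = 2 * 9776 * Real.exp 8 * (Q / ε) := by ring
      _ ≤ _ := mul_le_mul_of_nonneg_right this (by positivity)
  rw [e1, mul_add]
  linarith

/-- log x is 8 times the logarithm of the eighth root of x, and log y ≤ y; 8⁴ = 4096. -/
theorem log_pow_four_le {x : ℝ} (hx : 0 < x) (hx1 : 1 ≤ x) : Real.log x ^ 4 ≤ 4096 * √x := by
  have h1 : Real.log x = 8 * Real.log (√(√(√x))) := by
    rw [Real.log_sqrt (by positivity), Real.log_sqrt (by positivity), Real.log_sqrt hx.le]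
    ring
  have h2 := Real.log_le_sub_one_of_pos (by positivity : 0 < √(√(√x)))
  have h3 : 0 ≤ Real.log x := Real.log_nonneg hx1
  have h4 : Real.log x ≤ 8 * √(√(√x)) := by linarith
  calc Real.log x ^ 4 ≤ (8 * √(√(√x))) ^ 4 := pow_le_pow_left₀ h3 h4 4
    _ = 4096 * ((√(√(√x)) ^ 2) ^ 2) := by ring
    _ = 4096 * √x := by rw [Real.sq_sqrt (by positivity), Real.sq_sqrt (by positivity)]

/-- From (log 2)⁵ ≥ 2⁻³. The number l may be below 1, so log l may be negative; this limits how far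
it lowers L. -/
theorem neg_log_log_two_le : -Real.log (Real.log 2) ≤ 0.6 * Real.log 2 := by
  have h1 : (1 / 8 : ℝ) ≤ Real.log 2 ^ 5 := by
    have := Real.log_two_gt_d9
    calc (1 / 8 : ℝ) ≤ 0.69 ^ 5 := by norm_num
      _ ≤ _ := pow_le_pow_left₀ (by norm_num) (by linarith) 5
  have h2 := Real.log_le_log (by norm_num) h1
  rw [Real.log_pow, one_div, Real.log_inv, show (8 : ℝ) = 2 ^ 3 by norm_num, Real.log_pow] at h2
  push_cast at h2
  linarith

/-- A universal factor with which `L` dominates `log (1 + τ)`. -/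
def logConst : ℝ := 12 + 8 * Real.log (81920 * boundConst)

theorem one_le_logConst : 1 ≤ logConst := by
  have := one_le_boundConst
  have := Real.log_nonneg (by linarith : 1 ≤ 81920 * boundConst)
  unfold logConst
  linarith

theorem log_add_log_log_pos {Z l : ℝ} (hZ : 2 ≤ Z) (hl : Real.log 2 ≤ l) :
    0.4 * Real.log Z ≤ Real.log Z + Real.log l := by
  have h1 := neg_log_log_two_le
  have h2 := Real.log_le_log (Real.log_pos one_lt_two) hl
  have h3 := Real.log_le_log two_pos hZ
  linarith

/-- A crude polynomial bound on 1 + T suffices: its factor Λ⁴ is at most 4096 √(1 + T), which is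
cancelled before taking logarithms. -/
theorem log_one_add_le_of_bound {H c S R l T ε : ℝ} (hH : 1 ≤ H) (hc : 2 ≤ c) (hS : 1 ≤ S)
    (hSc : S ≤ c) (hR0 : 0 ≤ R) (hRc : R ≤ c) (hl : Real.log 2 ≤ l) (hT : 1 ≤ T) (hε : 0 < ε)
    (hε1 : ε ≤ 1)
    (h : T ≤ boundConst * (H ^ 3 * c * R ^ 2 * ((l + Real.log (1 + T)) * Real.log (1 + T) ^ 3) /
      ε ^ 2 + H ^ 3 * c * R * ((l + S * Real.log (1 + T)) * Real.log (1 + T)) / ε)) :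
    Real.log (1 + T) ≤ logConst * (Real.log (c * H / ε) + Real.log l) := by
  set Λ := Real.log (1 + T) with hΛ
  have h12 := one_le_log_two
  have h02 : 0 < Real.log 2 := Real.log_pos one_lt_two
  have hΛ2 : Real.log 2 ≤ Λ := Real.log_le_log two_pos (by linarith)
  have hl0 : 0 < l := by linarith
  have hΛ0 : 0 < Λ := by linarith
  have hc0 : 0 ≤ c := by linarith
  have hH0 : 0 ≤ H := by linarith
  have hS0 : 0 ≤ S := by linarith
  have hb := one_le_boundConst
  set Z := c * H / ε with hZ
  have hZ2 : 2 ≤ Z := by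
    rw [hZ, le_div_iff₀ hε]
    nlinarith
  have hY : l + Λ ≤ 2.9 * (l * Λ) := by nlinarith
  have hΛsq : 1 ≤ (1.45 * Λ) ^ 2 := one_le_pow₀ (by linarith)
  have e1 : H ^ 3 * c * R ^ 2 * ((l + Λ) * Λ ^ 3) / ε ^ 2 ≤ 3 * (Z ^ 3 * (l * Λ ^ 4)) := by
    calc H ^ 3 * c * R ^ 2 * ((l + Λ) * Λ ^ 3) / ε ^ 2
        ≤ H ^ 3 * c * c ^ 2 * (2.9 * (l * Λ) * Λ ^ 3) / ε ^ 3 := by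
          gcongr ?_ * ?_ * ?_ ^ 2 * (?_ * _) / ?_
          exact pow_le_pow_of_le_one hε.le hε1 (by norm_num)
      _ = 2.9 * (Z ^ 3 * (l * Λ ^ 4)) := by rw [hZ]; field_simp
      _ ≤ _ := by
        have : 0 ≤ Z ^ 3 * (l * Λ ^ 4) := by positivity
        linarith
  have e2 : H ^ 3 * c * R * ((l + S * Λ) * Λ) / ε ≤ 7 * (Z ^ 3 * (l * Λ ^ 4)) := by
    have h1 : l + S * Λ ≤ c * (2.9 * (l * Λ)) := by
      have : l ≤ c * l := le_mul_of_one_le_left hl0.le (by linarith)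
      have : S * Λ ≤ c * Λ := mul_le_mul_of_nonneg_right hSc hΛ0.le
      have := mul_le_mul_of_nonneg_left hY hc0
      linarith
    calc H ^ 3 * c * R * ((l + S * Λ) * Λ) / ε
        ≤ H ^ 3 * c * c * (c * (2.9 * (l * Λ)) * Λ) / ε ^ 3 := by
          gcongr ?_ * ?_ * ?_ * (?_ * _) / ?_
          simpa using pow_le_pow_of_le_one hε.le hε1 (by norm_num : 1 ≤ 3)
      _ = 2.9 * (Z ^ 3 * (l * Λ ^ 2)) * 1 := by rw [hZ]; field_simp
      _ ≤ 2.9 * (Z ^ 3 * (l * Λ ^ 2)) * (1.45 * Λ) ^ 2 := by gcongr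
      _ ≤ _ := by
        have : 0 ≤ Z ^ 3 * (l * Λ ^ 4) := by positivity
        linarith
  have hW : 0 < 1 + T := by linarith
  have e3 : 1 + T ≤ 20 * boundConst * (Z ^ 3 * l * Λ ^ 4) := by
    have := mul_le_mul_of_nonneg_left (add_le_add e1 e2) (by linarith : 0 ≤ boundConst)
    linarith
  have e4 : √(1 + T) ≤ 81920 * boundConst * (Z ^ 3 * l) := by
    have h1 := log_pow_four_le hW (by linarith)
    have h2 : 0 ≤ 20 * boundConst * (Z ^ 3 * l) := by positivity
    have h3 := mul_le_mul_of_nonneg_left h1 h2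
    have h4 := Real.sqrt_pos.2 hW
    have h5 := Real.sq_sqrt hW.le
    refine le_of_mul_le_mul_right ?_ h4
    rw [← sq, h5]
    linarith
  have e5 := Real.log_le_log (Real.sqrt_pos.2 hW) e4
  rw [Real.log_sqrt hW.le, Real.log_mul (by positivity) (by positivity),
    Real.log_mul (by positivity) hl0.ne', Real.log_pow, ← hΛ] at e5
  push_cast at e5
  -- Doubling the bound on Λ / 2 gives 6 log Z + 2 log l = 2L + 4 log Z ≤ 12 L, and the constant is
  -- absorbed by 1 ≤ 4L; this explains `logConst`.
  have hL := log_add_log_log_pos hZ2 hl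
  have hZl := Real.log_le_log two_pos hZ2
  have hk := Real.log_nonneg (by linarith : 1 ≤ 81920 * boundConst)
  have hL1 : 1 ≤ 4 * (Real.log Z + Real.log l) := by linarith
  have hk1 := mul_le_mul_of_nonneg_left hL1 hk
  rw [logConst]
  linarith

theorem le_complexity_of_episode_bound {H c S R l T ε : ℝ} (hH : 1 ≤ H) (hc : 2 ≤ c) (hS : 1 ≤ S)
    (hSc : S ≤ c) (hR : Real.log 2 ≤ R) (hRc : R ≤ c) (hl : Real.log 2 ≤ l) (hT : 1 ≤ T)
    (hε : 0 < ε) (hε1 : ε ≤ 1)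
    (h : ε * T ≤ Real.exp 8 *
      (H * R * (H * c * (4 * (4 * Real.log 2 + l) + 1)) +
      64 * √(l + Real.log (1 + T)) *
        (√(T * (H * R) ^ 2) * √(H * c * (4 * Real.log (1 + T)))) +
      10 * √(Real.log (1 + T) ^ 2 * (l + Real.log (1 + T))) *
        (√(T * H) * √(H * c * (4 * Real.log (1 + T)))) +
      2436 * (H ^ 2 * R * (l + S * Real.log (1 + T))) * (H * c * (4 * Real.log (1 + T))))) :
    T ≤ 3 * boundConst * logConst ^ 4 *
      (H ^ 3 * c * R ^ 2 * l * (Real.log (c * H / ε) + Real.log l) ^ 4 / ε ^ 2 +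
        H ^ 3 * c * R * (l + S * (Real.log (c * H / ε) + Real.log l)) *
          (Real.log (c * H / ε) + Real.log l) / ε) := by
  have h12 := one_le_log_two
  have h02 : 0 < Real.log 2 := Real.log_pos one_lt_two
  have hΛ2 : Real.log 2 ≤ Real.log (1 + T) := Real.log_le_log two_pos (by linarith)
  have h1 := le_of_episode_bound hH (by linarith) hS hR hl hΛ2 (by linarith) hε h
  have h2 := log_one_add_le_of_bound hH hc hS hSc (by linarith) hRc hl hT hε hε1 h1
  set Λ := Real.log (1 + T) with hΛ
  set L := Real.log (c * H / ε) + Real.log l with hL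
  have hK := one_le_logConst
  have hb := one_le_boundConst
  have hl0 : 0 < l := by linarith
  have hΛ0 : 0 < Λ := by linarith
  have hR0 : 0 ≤ R := by linarith
  have hL0 : 0 ≤ L := by
    by_contra! hneg
    nlinarith
  have e1 : (l + Λ) * Λ ^ 3 ≤ 3 * logConst ^ 4 * (l * L ^ 4) := by
    -- Both logarithms are at least log 2, so 1/l + 1/Λ ≤ 3.
    have hY : l + Λ ≤ 3 * (l * Λ) := by nlinarith
    calc (l + Λ) * Λ ^ 3 ≤ 3 * (l * Λ) * Λ ^ 3 := by gcongr
      _ = 3 * l * Λ ^ 4 := by ring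
      _ ≤ 3 * l * (logConst * L) ^ 4 := by gcongr
      _ = _ := by ring
  have e2 : (l + S * Λ) * Λ ≤ 3 * logConst ^ 4 * ((l + S * L) * L) := by
    have h3 : l ≤ logConst * l := le_mul_of_one_le_left hl0.le hK
    have h4 : logConst ^ 2 ≤ 3 * logConst ^ 4 := by
      have := pow_le_pow_right₀ hK (by norm_num : 2 ≤ 4)
      have : 0 ≤ logConst ^ 4 := by positivity
      linarith
    calc (l + S * Λ) * Λ ≤ (logConst * l + S * (logConst * L)) * (logConst * L) := by gcongr
      _ = logConst ^ 2 * ((l + S * L) * L) := by ring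
      _ ≤ _ := by gcongr
  calc T ≤ boundConst * (H ^ 3 * c * R ^ 2 * ((l + Λ) * Λ ^ 3) / ε ^ 2 +
        H ^ 3 * c * R * ((l + S * Λ) * Λ) / ε) := h1
    _ ≤ boundConst * (H ^ 3 * c * R ^ 2 * (3 * logConst ^ 4 * (l * L ^ 4)) / ε ^ 2 +
        H ^ 3 * c * R * (3 * logConst ^ 4 * ((l + S * L) * L)) / ε) := by gcongr
    _ = _ := by ring

section

variable {S : Type u} {A : Type v} [Fintype S] [DecidableEq S] [Fintype A] [DecidableEq A]
  {H : ℕ} {s₁ : S}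

/-! ### Stopping time and sample complexity -/

/-- The universal constant of the sample complexity bound. -/
def rateConst : ℝ := 3 * boundConst * logConst ^ 4

theorem rateConst_pos : 0 < rateConst := by
  have := one_le_logConst
  have := one_le_boundConst
  unfold rateConst
  positivity

section complexity

variable {s a : ℕ}

theorem complexity_nonneg (hsa : 1 ≤ s * a) (hH : 1 ≤ H) {ε δ : ℝ} (hε : 0 < ε) (hε1 : ε ≤ 1)
    (hδ : 0 < δ) (hδ1 : δ < 1) : 0 ≤ complexity s a H ε δ := by
  rcases hsa.eq_or_lt with h | h
  · have : (s : ℝ) * a = 1 := by exact_mod_cast h.symm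
    simp [complexity, this]
  · have h1 : Real.log 2 ≤ Real.log (s * a * H / δ) := log_two_le_logConf h hH hδ hδ1
    have h02 : 0 < Real.log 2 := Real.log_pos one_lt_two
    have hc : (2 : ℝ) ≤ s * a := by exact_mod_cast h
    have hH' : (1 : ℝ) ≤ H := by exact_mod_cast hH
    have hZ : 2 ≤ (s : ℝ) * a * H / ε := by
      rw [le_div_iff₀ hε]
      nlinarith
    have h2 := log_add_log_log_pos hZ h1
    have h3 := Real.log_nonneg (by linarith : 1 ≤ (s : ℝ) * a * H / ε)
    have hL : 0 ≤ logFactor s a H ε δ := by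
      rw [logFactor]
      linarith
    have hR := Real.log_nonneg (by linarith : 1 ≤ (s : ℝ) * a)
    have hl : 0 ≤ Real.log (s * a * H / δ) := by linarith
    unfold complexity
    positivity

end complexity

variable [Nonempty A] {M : MDP S A H s₁} {δ ε : ℝ}

theorem le_complexity_of_forall_isGood (D : ℕ → Episode S A H) {T : ℕ}
    (hsa : 2 ≤ Fintype.card S * Fintype.card A) (hH : 1 ≤ H) (hδ : 0 < δ) (hδ1 : δ < 1)
    (hε : 0 < ε) (hε1 : ε ≤ 1) (hG : ∀ t, IsGood M δ t (firstEpisodes D t))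
    (hgap : ∀ t < T, ε ≤ gap (firstEpisodes D t) δ 0 s₁) :
    T ≤ rateConst * complexity (Fintype.card S) (Fintype.card A) H ε δ := by
  rcases Nat.eq_zero_or_pos T with rfl | hT
  · have := complexity_nonneg (by omega) hH hε hε1 hδ hδ1
      (s := Fintype.card S) (a := Fintype.card A)
    have := rateConst_pos
    push_cast
    positivity
  have hS : 1 ≤ Fintype.card S := Fintype.card_pos_iff.2 ⟨s₁⟩
  have hA : 1 ≤ Fintype.card A := Fintype.card_pos
  have hc : (2 : ℝ) ≤ Fintype.card S * Fintype.card A := by exact_mod_cast hsa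
  have hSc : (Fintype.card S : ℝ) ≤ Fintype.card S * Fintype.card A := by
    exact_mod_cast Nat.le_mul_of_pos_right _ hA
  have hRc := (Real.log_le_sub_one_of_pos (by linarith :
    (0 : ℝ) < Fintype.card S * Fintype.card A)).trans (sub_le_self _ zero_le_one)
  have h := mul_le_of_forall_isGood D hsa hH hδ hδ1 hG hgap
  rw [log_mul_logConf hsa hH hδ (by norm_num : (0 : ℝ) < 16),
    show Real.log 16 = 4 * Real.log 2 by
      rw [show (16 : ℝ) = 2 ^ 4 by norm_num, Real.log_pow]; norm_num] at h
  have h1 := le_complexity_of_episode_bound (by exact_mod_cast hH) hc (by exact_mod_cast hS) hSc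
    (log_two_le_log_card_mul_card hsa) hRc (log_two_le_logConf hsa hH hδ hδ1)
    (by exact_mod_cast hT) hε hε1 h
  refine h1.trans (le_of_eq ?_)
  rw [rateConst, complexity, logFactor, logConf]
  ring

/-- On the good event UCBVI-Ent stops within the stated number of episodes. -/
theorem exists_stopsAt (D : ℕ → Episode S A H) (hH : 1 ≤ H) (hδ : 0 < δ) (hδ1 : δ < 1)
    (hε : 0 < ε) (hG : ∀ t, IsGood M δ t (firstEpisodes D t)) :
    ∃ τ : ℕ, (ucbviEnt S A H s₁ ε δ).StopsAt D τ ∧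
      (ε ≤ 1 → (τ : ℝ) ≤ rateConst * complexity (Fintype.card S) (Fintype.card A) H ε δ) := by
  have hcard : 1 ≤ Fintype.card S * Fintype.card A :=
    Nat.mul_pos (Fintype.card_pos_iff.2 ⟨s₁⟩) Fintype.card_pos
  have key : ∃ t, gap (firstEpisodes D t) δ 0 s₁ ≤ ε := by
    rcases hcard.eq_or_lt with hsa | hsa
    -- With one state and one action `maxVal` is 0, so the algorithm stops before the first episode.
    · refine ⟨0, ((gap_mem _ δ (Nat.zero_le H) s₁).2.trans (le_of_eq ?_)).trans hε.le⟩
      have : (Fintype.card S : ℝ) * Fintype.card A = 1 := by exact_mod_cast hsa.symm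
      simp [maxVal, this]
    · by_contra! hne
      -- Precision min ε 1 covers ε > 1: if the gap never falls to ε, it also stays above this
      -- smaller level.
      obtain ⟨T, hT⟩ := exists_nat_gt
        (rateConst * complexity (Fintype.card S) (Fintype.card A) H (min ε 1) δ)
      refine hT.not_ge (le_complexity_of_forall_isGood D hsa hH hδ hδ1 (lt_min hε one_pos)
        (min_le_right _ _) hG fun t _ => (min_le_left _ _).trans (hne t).le)
  classical
  refine ⟨Nat.find key, ⟨Nat.find_spec key, fun t ht => Nat.find_min' key ht⟩, fun hε1 => ?_⟩
  rcases hcard.eq_or_lt with hsa | hsa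
  · have h0 : Nat.find key = 0 := by
      refine (Nat.find_eq_zero key).2
        (((gap_mem _ δ (Nat.zero_le H) s₁).2.trans (le_of_eq ?_)).trans hε.le)
      have : (Fintype.card S : ℝ) * Fintype.card A = 1 := by exact_mod_cast hsa.symm
      simp [maxVal, this]
    rw [h0, Nat.cast_zero]
    exact mul_nonneg rateConst_pos.le (complexity_nonneg hcard hH hε hε1 hδ hδ1)
  · exact le_complexity_of_forall_isGood D hsa hH hδ hδ1 hε hε1 hG
      fun t ht => (not_le.1 (Nat.find_min key ht)).le

end

end

end MTEE

/-- Both claims hold on the same event, where `IsGood` is true at every time; finite stopping and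
the explicit bound come from the same count of episodes. -/
theorem mainTheorem7 :
    ∃ C : ℝ, 0 < C ∧
      ∀ (S : Type u) (A : Type v) [Fintype S] [DecidableEq S] [Fintype A] [DecidableEq A]
        [Nonempty A] (H : ℕ) (s₁ : S) (ε δ : ℝ), 1 ≤ H → 0 < ε → 0 < δ → δ < 1 →
        MTEE.IsPAC.{u, v, w} (MTEE.ucbviEnt S A H s₁ ε δ) s₁ ε δ ∧
        (ε ≤ 1 →
          ∀ (M : MTEE.MDP S A H s₁) (Ω : Type w) [MeasurableSpace Ω]
            (μ : MeasureTheory.Measure Ω) (X : ℕ → Ω → MTEE.Episode S A H),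
            MTEE.IsInteraction M (MTEE.ucbviEnt S A H s₁ ε δ) μ X →
            ENNReal.ofReal (1 - δ) ≤
              μ {ω | ∃ τ : ℕ, (MTEE.ucbviEnt S A H s₁ ε δ).StopsAt (fun t => X t ω) τ ∧
                (τ : ℝ) ≤
                  C * MTEE.complexity (Fintype.card S) (Fintype.card A) H ε δ}) := by
  refine ⟨MTEE.rateConst, MTEE.rateConst_pos, fun S A _ _ _ _ _ H s₁ ε δ hH hε hδ hδ1 =>
    ⟨fun M Ω _ μ X hI => ?_, fun hε1 M Ω _ μ X hI => ?_⟩⟩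
  · refine (MTEE.le_measure_isGood M hH hδ hδ1 hI).trans
      (MeasureTheory.measure_mono fun ω hω => ?_)
    obtain ⟨τ, hτ, -⟩ := MTEE.exists_stopsAt (fun t => X t ω) hH hδ hδ1 hε hω
    exact ⟨τ, hτ, fun π => ((hω τ).suboptimality_le hH hδ hδ1 π).trans hτ.1⟩
  · refine (MTEE.le_measure_isGood M hH hδ hδ1 hI).trans
      (MeasureTheory.measure_mono fun ω hω => ?_)
    obtain ⟨τ, hτ, hle⟩ := MTEE.exists_stopsAt (fun t => X t ω) hH hδ hδ1 hε hω
    exact ⟨τ, hτ, hle hε1⟩
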